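/- **Setting.** Let $(A,B,D)$ be a random vector with values in $(0,\infty)\times\mathbb R^2$ and law $\mu$, and let $F_{(a,b,d)}(v)=a\max(d,v)+b$. Let $P(v,\cdot)$ be the law of $F_{(A,B,D)}(v)$, and let $\{V_n\}$ be generated by $V_n=F_{Y_n}(V_{n-1})$ with $Y_n=(A_n,B_n,D_n)$. Put $\Lambda(\alpha)=\log E[A^\alpha]$ and assume: * $(H_1)$ the law of $A$ has a nonzero absolutely continuous component, and $\Lambda(\xi)=0$ for some $\xi\in(0,\infty)$ at which $\Lambda$ is differentiable (in particular finite in a neighbourhood of $\xi$); * $(H_2)$ $E[|B|^\xi]<\infty$ and $E[(A|D|)^\xi]<\infty$; * $(H_3)$ $P(A>1,B>0)>0$ or $P(A>1,B\ge0,D>0)>0$. Let $\mu_\xi(dy)=a^\xi\mu(dy)$, $y=(a,b,d)$. Fix a minorization $\delta\mathbf 1_{\mathcal C}(x)\nu(E)\le P(x,E)$ with $\delta>0$, $\nu$ a probability measure, and $\mathcal C$ a bounded Borel set with $\varphi(\mathcal C)>0$ for an irreducibility measure $\varphi$ of the chain. Start from $V_0\sim\nu$, and let $\tau-1=\inf\{n\ge0:V_n\in\mathcal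 C,\ \eta_n=1\}$, where $\eta_n\in\{0,1\}$ are the splitting variables: under the original law, $\eta_n$ given $V_0,\dots,V_n,\eta_0,\dots,\eta_{n-1}$ is Bernoulli($\delta$), and given moreover $\eta_n=1$ the next state $V_{n+1}$ has law $\nu$ if $V_n\in\mathcal C$ and law $P(V_n,\cdot)$ if $V_n\notin\mathcal C$. For $u>0$ let $T_u=\inf\{n\ge0:V_n>u\}$ and $N_u=\sum_{n=0}^{\tau-1}\mathbf 1_{(u,\infty)}(V_n)$. In the dual measure, with expectation $E_{\mathfrak D}$, given the past, $Y_n$ has law $\mu_\xi$ for $n\le T_u$ and law $\mu$ for $n>T_u$, and from time $T_u$ on $(V_n,\eta_n)$ is the split chain just described (how the chain is split before $T_u$ is immaterial). Let $\mathfrak F_n=\sigma(V_0,\dots,V_n,\eta_0,\dots,\eta_n)$. **Theorem 4.2.** There exist functions $C_1,C_2:(0,\infty)\to(0,\infty)$, depending only on $\mu,\xi,\delta,\mathcal C,\nu$, such that for all $u>0$, almost surely, $$E_{\mathfrak D}\big[N_u\,\big|\,\mathfrak F_{T_u\wedge(\tau-1)}\big]\le\Big(C_1(u)\log\frac{V_{T_u}}u+C_2(u)\Big)\mathbf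 1_{\{T_u<\tau\}} .$$ Moreover, let $m=-E[\log A]$ and $\sigma^2=\mathrm{Var}(\log A)$ (computed under the original law $\mu$). As $u\to\infty$, $C_1(u)\to 1/m$ provided $E|\log A|<\infty$, and $C_2(u)\to1+\sigma^2/m^2$ provided $E[(\log A)^2]<\infty$. -/

import Mathlib

open MeasureTheory ProbabilityTheory Filter Topology
open scoped ENNReal

namespace Letac

noncomputable section

/-! ### Letac's Model E

The driving vector is `Y = (A, B, D)`, encoded as `y : ℝ × ℝ × ℝ` with `A = y.1`, `B = y.2.1`,
`D = y.2.2`; its law is a probability measure `ρ` on `ℝ × ℝ × ℝ`. -/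

/-- The random map `F_Y(v) = A max(D, v) + B`. -/
def step (y : ℝ × ℝ × ℝ) (v : ℝ) : ℝ := y.1 * max y.2.2 v + y.2.1

theorem measurable_step : Measurable (fun p : ℝ × (ℝ × ℝ × ℝ) => step p.2 p.1) := by
  unfold step
  fun_prop

/-- The transition kernel of the forward recursion `V_n = A_n max(D_n, V_{n-1}) + B_n`:
`P(v, ·)` is the law of `F_Y(v)` for `Y ∼ ρ`. -/
def transition (ρ : Measure (ℝ × ℝ × ℝ)) [SFinite ρ] : Kernel ℝ ℝ where
  toFun v := ρ.map (fun y => step y v)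
  measurable' := by
    refine Measure.measurable_of_measurable_coe _ fun E hE => ?_
    have h : ∀ v, ρ.map (fun y => step y v) E
        = ρ (Prod.mk v ⁻¹' ((fun p : ℝ × (ℝ × ℝ × ℝ) => step p.2 p.1) ⁻¹' E)) := by
      intro v
      have hm : Measurable (fun y => step y v) := measurable_step.comp measurable_prodMk_left
      rw [Measure.map_apply hm hE]
      rfl
    simp_rw [h]
    exact measurable_measure_prodMk_left (measurable_step hE)

/-- The `ξ`-shifted law of `(A, B, D)`: `dρ_ξ = A ^ ξ dρ`
(that is, `exp (ξ x)` in terms of `x = log A`). -/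
def shiftedLaw (ρ : Measure (ℝ × ℝ × ℝ)) (ξ : ℝ) : Measure (ℝ × ℝ × ℝ) :=
  ρ.withDensity (fun y => ENNReal.ofReal (y.1 ^ ξ))

/-- Letac's Model E (`A > 0`) together with the standing hypotheses. With
`Λ(α) = log E[A ^ α] = log E[exp (α log A)]` (the cumulant generating function of `log A`),
`Λ` is differentiable at `ξ` iff `ξ` is interior to the interval where `E[A ^ α] < ∞`. -/
structure Hypotheses (ρ : Measure (ℝ × ℝ × ℝ)) (ξ : ℝ) : Prop where
  A_pos : ∀ᵐ y ∂ρ, 0 < y.1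
  /-- The law of `A` has a nonzero absolutely continuous component. -/
  A_ac : ¬ (ρ.map (fun y => y.1)) ⟂ₘ (volume : Measure ℝ)
  xi_pos : 0 < ξ
  xi_dom : ξ ∈ interior (integrableExpSet (fun y : ℝ × ℝ × ℝ => Real.log y.1) ρ)
  xi_root : cgf (fun y : ℝ × ℝ × ℝ => Real.log y.1) ρ ξ = 0
  B_moment : Integrable (fun y : ℝ × ℝ × ℝ => |y.2.1| ^ ξ) ρ
  AD_moment : Integrable (fun y : ℝ × ℝ × ℝ => (y.1 * |y.2.2|) ^ ξ) ρ
  unbounded : 0 < ρ {y | 1 < y.1 ∧ 0 < y.2.1} ∨ 0 < ρ {y | 1 < y.1 ∧ 0 ≤ y.2.1 ∧ 0 < y.2.2}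

/-- The one-step minorization `δ 1_C(x) ν(E) ≤ P(x, E)`, for a bounded set `C` that is charged by
an irreducibility measure `φ` of the chain. -/
structure Minorization (ρ : Measure (ℝ × ℝ × ℝ)) [SFinite ρ] (δ : ℝ) (C : Set ℝ)
    (ν : Measure ℝ) : Prop where
  delta_pos : 0 < δ
  measurableSet : MeasurableSet C
  bounded : Bornology.IsBounded C
  charged : ∃ φ : Measure ℝ, Kernel.IsIrreducible φ (transition ρ) ∧ 0 < φ C
  minorizes : ∀ x ∈ C, ∀ E, MeasurableSet E → ENNReal.ofReal δ * ν E ≤ transition ρ x E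

/-! ### Path functionals of the augmented chain `(V_n, η_n)` -/

variable {Ω : Type*}

/-- `T_u = inf {n ≥ 0 : V_n > u}`, equal to `⊤` if there is no such `n`. -/
def exceedTime (V : ℕ → Ω → ℝ) (u : ℝ) : Ω → WithTop ℕ :=
  hittingAfter V (Set.Ioi u) 0

/-- `τ - 1`: the first `n ≥ 0` with `(V_n, η_n) ∈ C × {1}`, equal to `⊤` if there is none. -/
def regenTimePred (C : Set ℝ) (V : ℕ → Ω → ℝ) (η : ℕ → Ω → Bool) : Ω → WithTop ℕ :=
  hittingAfter (fun n ω => (V n ω, η n ω)) (C ×ˢ {true}) 0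

/-- The regeneration time `τ`. -/
def regenTime (C : Set ℝ) (V : ℕ → Ω → ℝ) (η : ℕ → Ω → Bool) (ω : Ω) : WithTop ℕ :=
  regenTimePred C V η ω + 1

open Classical in
/-- `N_u = ∑_{n = 0}^{τ - 1} 1_{(u, ∞)}(V_n)`, with values in `[0, ∞]`. -/
def exceedances (C : Set ℝ) (V : ℕ → Ω → ℝ) (η : ℕ → Ω → Bool) (u : ℝ) (ω : Ω) : ℝ≥0∞ :=
  ∑' n : ℕ, if (n : WithTop ℕ) < regenTime C V η ω ∧ u < V n ω then 1 else 0

/-- The history `σ(V_0, …, V_n, η_0, …, η_{n-1})`. -/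
@[reducible] def history (V : ℕ → Ω → ℝ) (η : ℕ → Ω → Bool) (n : ℕ) : MeasurableSpace Ω :=
  (⨆ k ≤ n, MeasurableSpace.comap (V k) inferInstance) ⊔
    ⨆ k < n, MeasurableSpace.comap (η k) inferInstance

/-- The filtration `𝔉_n = σ(V_0, …, V_n, η_0, …, η_n)` of the augmented chain. -/
def filtration [mΩ : MeasurableSpace Ω] (V : ℕ → Ω → ℝ) (η : ℕ → Ω → Bool)
    (hV : ∀ n, Measurable (V n)) (hη : ∀ n, Measurable (η n)) : Filtration ℕ mΩ where
  seq n := ⨆ k ≤ n, MeasurableSpace.comap (fun ω => (V k ω, η k ω)) inferInstance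
  mono' _ _ hij := biSup_mono fun _ hk => hk.trans hij
  le' _ := iSup₂_le fun k _ => ((hV k).prodMk (hη k)).comap_le

theorem measurable_pair_filtration [MeasurableSpace Ω] (V : ℕ → Ω → ℝ) (η : ℕ → Ω → Bool)
    (hV : ∀ n, Measurable (V n)) (hη : ∀ n, Measurable (η n)) (n : ℕ) :
    Measurable[filtration V η hV hη n] (fun ω => (V n ω, η n ω)) :=
  Measurable.of_comap_le
    (le_iSup₂_of_le (f := fun k (_ : k ≤ n) =>
      MeasurableSpace.comap (fun ω => (V k ω, η k ω)) inferInstance) n le_rfl le_rfl)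

/-- `T_u ∧ (τ - 1)` is a stopping time of the augmented chain. -/
theorem isStoppingTime_min [MeasurableSpace Ω] {V : ℕ → Ω → ℝ} {η : ℕ → Ω → Bool}
    (hV : ∀ n, Measurable (V n)) (hη : ∀ n, Measurable (η n)) {C : Set ℝ} (hC : MeasurableSet C)
    (u : ℝ) :
    IsStoppingTime (filtration V η hV hη)
      (fun ω => min (exceedTime V u ω) (regenTimePred C V η ω)) := by
  refine IsStoppingTime.min ?_ ?_
  · exact Adapted.isStoppingTime_hittingAfter
      (fun n => measurable_fst.comp (measurable_pair_filtration V η hV hη n)) measurableSet_Ioi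
  · exact Adapted.isStoppingTime_hittingAfter
      (measurable_pair_filtration V η hV hη) (hC.prod (measurableSet_singleton true))

/-! ### The dual measure -/

open Classical in
/-- `(V_n, η_n)` with driving sequence `Y_n = (A_n, B_n, D_n)` is, under the probability measure
`P`, a realization of the regenerative forward recursion in the dual measure at level `u`:

* `V_0 ∼ ν` and `V_{n+1} = F_{Y_{n+1}}(V_n)`;
* given the history up to time `n`, `Y_{n+1}` has law `ρ_ξ` if `n + 1 ≤ T_u` and law `ρ` if
  `n + 1 > T_u`;
* once the process runs under the original law (`n ≥ T_u`), `(V_n, η_n)` is the split chain of the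
  minorization: given the history, `η_n` is Bernoulli(`δ`), and given moreover `η_n = 1`, the next
  state has law `ν` if `V_n ∈ C` and law `P(V_n, ·)` if `V_n ∉ C` (the case `η_n = 0` is then
  determined by the law of `Y_{n+1}`).

The joint law of `η_n` and `Y_{n+1}` before time `T_u` is left free. So every way of splitting the
chain in the `ξ`-shifted regime is covered: splitting by a minorization of the shifted kernel as
well as transporting the splitting of the original chain by the likelihood ratio. -/
structure IsDualChain (ρ : Measure (ℝ × ℝ × ℝ)) [SFinite ρ] (ξ δ : ℝ) (C : Set ℝ)
    (ν : Measure ℝ) (u : ℝ) [MeasurableSpace Ω] (P : Measure Ω) (V : ℕ → Ω → ℝ)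
    (η : ℕ → Ω → Bool) (Y : ℕ → Ω → ℝ × ℝ × ℝ) : Prop where
  measurable_V : ∀ n, Measurable (V n)
  measurable_η : ∀ n, Measurable (η n)
  measurable_Y : ∀ n, Measurable (Y n)
  initial : P.map (V 0) = ν
  recursion : ∀ n ω, V (n + 1) ω = step (Y (n + 1) ω) (V n ω)
  shifted : ∀ (n : ℕ) (G : Set Ω), MeasurableSet[history V η n] G →
    (∀ ω ∈ G, (n : WithTop ℕ) < exceedTime V u ω) →
    ∀ E : Set (ℝ × ℝ × ℝ), MeasurableSet E → P (G ∩ Y (n + 1) ⁻¹' E) = P G * shiftedLaw ρ ξ E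
  original : ∀ (n : ℕ) (G : Set Ω), MeasurableSet[history V η n] G →
    (∀ ω ∈ G, exceedTime V u ω ≤ (n : WithTop ℕ)) →
    ∀ E : Set (ℝ × ℝ × ℝ), MeasurableSet E → P (G ∩ Y (n + 1) ⁻¹' E) = P G * ρ E
  split : ∀ (n : ℕ) (G : Set Ω), MeasurableSet[history V η n] G →
    (∀ ω ∈ G, exceedTime V u ω ≤ (n : WithTop ℕ)) →
    ∀ E : Set ℝ, MeasurableSet E →
      P (G ∩ {ω | η n ω = true} ∩ V (n + 1) ⁻¹' E) =
        ENNReal.ofReal δ * ∫⁻ ω in G, (if V n ω ∈ C then ν E else transition ρ (V n ω) E) ∂P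

/-- `m = -E[log A]`, in the original measure. -/
def drift (ρ : Measure (ℝ × ℝ × ℝ)) : ℝ := -∫ y, Real.log y.1 ∂ρ

/-- `σ² = Var(log A)`, in the original measure. -/
def logVariance (ρ : Measure (ℝ × ℝ × ℝ)) : ℝ := variance (fun y => Real.log y.1) ρ

end

end Letac

set_option linter.unusedSectionVars false

/-! From time `T_u` on, the process is the original split chain, so `N_u` counts visits to `(u, ∞)`
by the chain killed at its first regeneration. Its kernel is `Q = P - δ 1_C ν`, and the theorem
becomes a bound on the potential `∑ Qⁿ 1_{(u,∞)}` at points `v > u`, plus a correction for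
conditioning on `η` at time `T_u`.

High up the recursion is almost multiplicative. Above a level `w`, `log V` is dominated by a random
walk with increments `logStep w`. These converge to `log A` as `w → ∞`, and their mean is negative
for large `w` because `E[A^s] < 1` for `0 < s < ξ`. A walk with increment `X`, `E X < 0`, started
from `z ≥ 0`, visits `[0, ∞)` at most `z / |E X| + E[X²] / (E X)²` times on average
(`walkCount_le`). For `X = log A` and `z = log (v / u)` this is `log (v / u) / m + 1 + σ² / m²`. For
one-sided steps this is Lorden's inequality (`renewalCount_le_lorden`); the two-sided case is
reduced to it through the Lindley recursion, in place of ladder heights.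

The walk is used at level `w = √u`. Once the chain is at or below `√u`, the expected number of later
visits above `u` is `O(u^{-s/2})` and disappears in the limit (`exists_potential_Ioi_le`). That
estimate combines the Lyapunov function `1 + |v|^s` with a bound on the time which the killed chain
spends in a compact set. The latter (`exists_absorbing_potential_compact_le`) follows from the
Feller property and Baire's theorem on a closed absorbing set `S` with `ν Sᶜ = 0`. The dual chain
never leaves `S`, since it starts from `ν` and the shifted law is absolutely continuous with respect
to the original one.

Given `V_n ∈ C` and `η_n = 0`, the next state has law `Q / (1 - δ)`, so conditioning on `η` costs a
factor `1 / (1 - δ)`. It is only paid if `C` meets `(u, ∞)`, hence not for large `u`, and the limits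
are unaffected. -/

namespace Letac

noncomputable section

/-! ### Lorden's inequality for nonnegative steps -/

/-- The expected number of `k < n` with `t_1 + ⋯ + t_k ≤ z`, for i.i.d. steps `t_i ≥ 0` of
law `H`. -/
def renewalCount (H : Measure ℝ) : ℕ → ℝ → ℝ
  | 0, _ => 0
  | n + 1, z => if z < 0 then 0 else 1 + ∫ t, renewalCount H n (z - t) ∂H

theorem renewalCount_of_neg (H : Measure ℝ) (n : ℕ) {z : ℝ} (hz : z < 0) :
    renewalCount H n z = 0 := by
  cases n <;> simp [renewalCount, hz]

theorem renewalCount_succ_of_nonneg (H : Measure ℝ) (n : ℕ) {z : ℝ} (hz : 0 ≤ z) :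
    renewalCount H (n + 1) z = 1 + ∫ t, renewalCount H n (z - t) ∂H := by
  simp [renewalCount, hz.not_gt]

variable (H : Measure ℝ) [IsProbabilityMeasure H]

theorem measurable_renewalCount (n : ℕ) : Measurable (renewalCount H n) := by
  induction n with
  | zero => exact measurable_const
  | succ n ih =>
    have h : StronglyMeasurable (fun z => ∫ t, renewalCount H n (z - t) ∂H) := by
      refine StronglyMeasurable.integral_prod_right
        (f := fun z t => renewalCount H n (z - t)) ?_
      exact (ih.comp (measurable_fst.sub measurable_snd)).stronglyMeasurable
    exact Measurable.ite measurableSet_Iio measurable_const (measurable_const.add h.measurable)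

theorem renewalCount_nonneg (n : ℕ) (z : ℝ) : 0 ≤ renewalCount H n z := by
  induction n generalizing z with
  | zero => exact le_rfl
  | succ n ih =>
    rcases lt_or_ge z 0 with hz | hz
    · rw [renewalCount_of_neg H _ hz]
    · rw [renewalCount_succ_of_nonneg H n hz]
      exact add_nonneg zero_le_one (integral_nonneg fun t => ih _)

theorem renewalCount_le (n : ℕ) (z : ℝ) : renewalCount H n z ≤ n := by
  induction n generalizing z with
  | zero => simp [renewalCount]
  | succ n ih =>
    rcases lt_or_ge z 0 with hz | hz
    · rw [renewalCount_of_neg H _ hz]; positivity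
    · rw [renewalCount_succ_of_nonneg H n hz]
      have : ∫ t, renewalCount H n (z - t) ∂H ≤ ∫ _, (n : ℝ) ∂H :=
        integral_mono_of_nonneg (ae_of_all _ fun t => renewalCount_nonneg H n _)
          (integrable_const _) (ae_of_all _ fun t => ih _)
      simp only [integral_const, probReal_univ, smul_eq_mul, one_mul] at this
      push_cast
      linarith

theorem integrable_renewalCount (μ : Measure ℝ) [IsFiniteMeasure μ] (n : ℕ) {f : ℝ → ℝ}
    (hf : Measurable f) : Integrable (fun t => renewalCount H n (f t)) μ :=
  Integrable.of_bound ((measurable_renewalCount H n).comp hf).aestronglyMeasurable (n : ℝ)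
    (ae_of_all _ fun t => by
      rw [Real.norm_of_nonneg (renewalCount_nonneg H n _)]
      exact renewalCount_le H n _)

theorem renewalCount_mono (n : ℕ) : Monotone (renewalCount H n) := by
  induction n with
  | zero => intro x y _; exact le_rfl
  | succ n ih =>
    intro x y hxy
    rcases lt_or_ge x 0 with hx | hx
    · rw [renewalCount_of_neg H _ hx]; exact renewalCount_nonneg H _ _
    · rw [renewalCount_succ_of_nonneg H n hx, renewalCount_succ_of_nonneg H n (hx.trans hxy)]
      gcongr 1 + ?_
      exact integral_mono (integrable_renewalCount H H n (by fun_prop))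
        (integrable_renewalCount H H n (by fun_prop)) fun t => ih (by linarith)

theorem renewalCount_le_succ (n : ℕ) (z : ℝ) : renewalCount H n z ≤ renewalCount H (n + 1) z := by
  induction n generalizing z with
  | zero => exact renewalCount_nonneg H _ _
  | succ n ih =>
    rcases lt_or_ge z 0 with hz | hz
    · rw [renewalCount_of_neg H _ hz, renewalCount_of_neg H _ hz]
    · rw [renewalCount_succ_of_nonneg H n hz, renewalCount_succ_of_nonneg H _ hz]
      gcongr 1 + ?_
      exact integral_mono (integrable_renewalCount H H n (by fun_prop))
        (integrable_renewalCount H H _ (by fun_prop)) fun t => ih _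

/-- Once the walk has passed `x`, it has at most `y` left to go. In the induction, a first step `t >
x` overshoots `x` at once and monotonicity takes the place of subadditivity. -/
theorem renewalCount_add_le (n : ℕ) {x y : ℝ} (hx : 0 ≤ x) (hy : 0 ≤ y) :
    renewalCount H n (x + y) ≤ renewalCount H n x + renewalCount H n y := by
  induction n generalizing x y with
  | zero => simp [renewalCount]
  | succ n ih =>
    have key : ∫ t, renewalCount H n (x + y - t) ∂H
        ≤ (∫ t, renewalCount H n (x - t) ∂H) + renewalCount H n y := by
      have : ∫ t, renewalCount H n (x + y - t) ∂H
          ≤ ∫ t, (renewalCount H n (x - t) + renewalCount H n y) ∂H := by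
        refine integral_mono (integrable_renewalCount H H n (by fun_prop))
          ((integrable_renewalCount H H n (by fun_prop)).add (integrable_const _)) fun t => ?_
        rcases le_or_gt t x with ht | ht
        · have := ih (x := x - t) (y := y) (by linarith) hy
          rwa [show x + y - t = x - t + y by ring]
        · have h1 := renewalCount_mono H n (show x + y - t ≤ y by linarith)
          have h2 := renewalCount_nonneg H n (x - t)
          simp only
          linarith
      rwa [integral_add (integrable_renewalCount H H n (by fun_prop)) (integrable_const _),
        integral_const, probReal_univ, one_smul] at this
    rw [renewalCount_succ_of_nonneg H n (add_nonneg hx hy), renewalCount_succ_of_nonneg H n hx]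
    have := renewalCount_le_succ H n y
    linarith

/-- The integrated renewal function. -/
def renewalArea (n : ℕ) (z : ℝ) : ℝ := ∫ s in (0 : ℝ)..z, renewalCount H n s

theorem intervalIntegrable_renewalCount (n : ℕ) (a b : ℝ) :
    IntervalIntegrable (renewalCount H n) volume a b :=
  (renewalCount_mono H n).intervalIntegrable

theorem renewalArea_of_nonpos (n : ℕ) {z : ℝ} (hz : z ≤ 0) : renewalArea H n z = 0 := by
  unfold renewalArea
  rw [intervalIntegral.integral_symm, intervalIntegral.integral_of_le hz,
    integral_Ioc_eq_integral_Ioo, setIntegral_congr_fun (g := fun _ => (0 : ℝ)) measurableSet_Ioo]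
  · simp
  · intro s hs
    exact renewalCount_of_neg H n hs.2

theorem renewalArea_sub (n : ℕ) (z : ℝ) {t : ℝ} (ht : 0 ≤ t) :
    renewalArea H n (z - t) = ∫ s in (0 : ℝ)..z, renewalCount H n (s - t) := by
  rw [intervalIntegral.integral_comp_sub_right (fun s => renewalCount H n s) t,
    ← intervalIntegral.integral_add_adjacent_intervals
      (intervalIntegrable_renewalCount H n (0 - t) 0)
      (intervalIntegrable_renewalCount H n 0 (z - t))]
  have : ∫ s in (0 - t)..0, renewalCount H n s = 0 := by
    rw [intervalIntegral.integral_symm]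
    exact neg_eq_zero.2 (renewalArea_of_nonpos H n (by linarith))
  rw [this, zero_add]
  rfl

/-- This is the renewal equation integrated over the level, by Fubini. For `t ≥ 0` the shift of the
window loses nothing, because the count vanishes on negative levels. -/
theorem renewalArea_succ (hH : ∀ᵐ t ∂H, 0 ≤ t) (n : ℕ) {z : ℝ} (hz : 0 ≤ z) :
    renewalArea H (n + 1) z = z + ∫ t, renewalArea H n (z - t) ∂H := by
  have h1 : ∫ t, renewalArea H n (z - t) ∂H
      = ∫ t, (∫ s in Set.Ioc 0 z, renewalCount H n (s - t)) ∂H := by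
    refine integral_congr_ae (hH.mono fun t ht => ?_)
    simp only
    rw [renewalArea_sub H n z ht, intervalIntegral.integral_of_le hz]
  have h2 : Integrable (Function.uncurry fun t s => renewalCount H n (s - t))
      (H.prod (volume.restrict (Set.Ioc 0 z))) := by
    refine Integrable.of_bound ((measurable_renewalCount H n).comp
      (measurable_snd.sub measurable_fst)).aestronglyMeasurable (n : ℝ) (ae_of_all _ fun p => ?_)
    rw [Function.uncurry, Real.norm_of_nonneg (renewalCount_nonneg H n _)]
    exact renewalCount_le H n _
  rw [h1, integral_integral_swap h2, renewalArea, intervalIntegral.integral_of_le hz]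
  rw [setIntegral_congr_fun (g := fun s => 1 + ∫ t, renewalCount H n (s - t) ∂H) measurableSet_Ioc
    (fun s hs => renewalCount_succ_of_nonneg H n hs.1.le), integral_add (by simp)]
  · simp [hz]
  · exact h2.integral_prod_right

/-- Integrate `U(z) ≤ U(s) + U(z - s)` over `s ∈ [0, z]`; the reflection `s ↦ z - s` makes the two
integrals equal. -/
theorem mul_renewalCount_le_renewalArea (n : ℕ) {z : ℝ} (hz : 0 ≤ z) :
    z * renewalCount H n z ≤ 2 * renewalArea H n z := by
  have h1 : ∫ _ in (0 : ℝ)..z, renewalCount H n z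
      ≤ ∫ s in (0 : ℝ)..z, (renewalCount H n s + renewalCount H n (z - s)) := by
    refine intervalIntegral.integral_mono_on hz (by simp)
      ((intervalIntegrable_renewalCount H n 0 z).add ?_) fun s hs => ?_
    · simpa using ((intervalIntegrable_renewalCount H n 0 z).comp_sub_left z).symm
    · simpa using renewalCount_add_le H n hs.1 (sub_nonneg.2 hs.2)
  rw [intervalIntegral.integral_add (intervalIntegrable_renewalCount H n 0 z)
    (by simpa using ((intervalIntegrable_renewalCount H n 0 z).comp_sub_left z).symm),
    intervalIntegral.integral_comp_sub_left (fun s => renewalCount H n s)] at h1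
  simp only [intervalIntegral.integral_const, sub_zero, smul_eq_mul, sub_self] at h1
  unfold renewalArea
  linarith

theorem renewalArea_nonneg (n : ℕ) (z : ℝ) : 0 ≤ renewalArea H n z := by
  rcases le_total z 0 with hz | hz
  · rw [renewalArea_of_nonpos H n hz]
  · exact intervalIntegral.integral_nonneg hz fun s _ => renewalCount_nonneg H n s

theorem renewalArea_le (n : ℕ) (z : ℝ) : renewalArea H n z ≤ n * |z| := by
  rcases le_total z 0 with hz | hz
  · rw [renewalArea_of_nonpos H n hz]; positivity
  · have : renewalArea H n z ≤ ∫ _ in (0 : ℝ)..z, (n : ℝ) :=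
      intervalIntegral.integral_mono_on hz (intervalIntegrable_renewalCount H n 0 z) (by simp)
        fun s _ => renewalCount_le H n s
    simp only [intervalIntegral.integral_const, sub_zero, smul_eq_mul] at this
    rw [abs_of_nonneg hz]
    linarith

theorem measurable_renewalArea (n : ℕ) : Measurable (renewalArea H n) :=
  (intervalIntegral.continuous_primitive
    (fun a b => intervalIntegrable_renewalCount H n a b) 0).measurable

theorem integral_sub_add {α : Type*} [MeasurableSpace α] {μ : Measure α} {f g h : α → ℝ}
    (hf : Integrable f μ) (hg : Integrable g μ) (hh : Integrable h μ) :
    ∫ t, (f t - g t + h t) ∂μ = ∫ t, f t ∂μ - ∫ t, g t ∂μ + ∫ t, h t ∂μ := by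
  rw [← integral_sub hf hg]
  exact integral_add (hf.sub hg) hh

/-- Wald's identities for the walk stopped at its first passage, combined with Jensen's
inequality. -/
theorem sq_sub_renewalCount_le (hH : ∀ᵐ t ∂H, 0 ≤ t) (h1 : Integrable (fun t : ℝ => t) H)
    (h2 : Integrable (fun t : ℝ => t ^ 2) H) (n : ℕ) (z : ℝ) :
    (z - (∫ t, t ∂H) * renewalCount H n z) ^ 2 ≤
      z ^ 2 - 2 * (∫ t, t ∂H) * renewalArea H n z + (∫ t, t ^ 2 ∂H) * renewalCount H n z := by
  set m := ∫ t, t ∂H with hm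
  set K := ∫ t, t ^ 2 ∂H with hK
  induction n generalizing z with
  | zero => simp [renewalCount, renewalArea]
  | succ n ih =>
    rcases lt_or_ge z 0 with hz | hz
    · rw [renewalCount_of_neg H _ hz, renewalArea_of_nonpos H _ hz.le]; simp
    have iU := integrable_renewalCount H H n (f := fun t => z - t) (by fun_prop)
    have iJ : Integrable (fun t => renewalArea H n (z - t)) H := by
      refine Integrable.mono' (((integrable_const z).sub h1).abs.const_mul (n : ℝ))
        ((measurable_renewalArea H n).comp (by fun_prop)).aestronglyMeasurable
        (ae_of_all _ fun t => ?_)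
      rw [Real.norm_of_nonneg (renewalArea_nonneg H n _)]
      exact renewalArea_le H n _
    have izt : Integrable (fun t => z - t) H := (integrable_const z).sub h1
    have izt2 : Integrable (fun t => (z - t) ^ 2) H := by
      have : (fun t => (z - t) ^ 2) = fun t => z ^ 2 - 2 * z * t + t ^ 2 := by ext t; ring
      rw [this]
      exact ((integrable_const _).sub (h1.const_mul _)).add h2
    set f : ℝ → ℝ := fun t => z - t - m * renewalCount H n (z - t) with hf
    set g : ℝ → ℝ := fun t => (z - t) ^ 2 - 2 * m * renewalArea H n (z - t)
      + K * renewalCount H n (z - t) with hg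
    have intf : Integrable f H := izt.sub (iU.const_mul m)
    have intg : Integrable g H := (izt2.sub (iJ.const_mul (2 * m))).add (iU.const_mul K)
    have hfg : ∀ t, f t ^ 2 ≤ g t := fun t => ih (z - t)
    have intf2 : Integrable (fun t => f t ^ 2) H :=
      intg.mono' (intf.aestronglyMeasurable.pow 2) (ae_of_all _ fun t => by
        rw [Real.norm_of_nonneg (sq_nonneg _)]; exact hfg t)
    have jensen : (∫ t, f t ∂H) ^ 2 ≤ ∫ t, f t ^ 2 ∂H := by
      have hv : 0 ≤ ∫ t, (f t - ∫ s, f s ∂H) ^ 2 ∂H := integral_nonneg fun t => sq_nonneg _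
      have he : ∀ t, (f t - ∫ s, f s ∂H) ^ 2
          = f t ^ 2 - 2 * (∫ s, f s ∂H) * f t + (∫ s, f s ∂H) ^ 2 := fun t => by ring
      simp_rw [he] at hv
      rw [integral_sub_add intf2 (intf.const_mul _) (integrable_const _), integral_const_mul,
        integral_const, probReal_univ, one_smul] at hv
      nlinarith
    have hle : (∫ t, f t ∂H) ^ 2 ≤ ∫ t, g t ∂H := jensen.trans (integral_mono intf2 intg hfg)
    have ef : ∫ t, f t ∂H = z - m * renewalCount H (n + 1) z := by
      rw [hf, integral_sub izt (iU.const_mul m), integral_const_mul,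
        integral_sub (integrable_const z) h1, integral_const, probReal_univ, one_smul, ← hm,
        renewalCount_succ_of_nonneg H n hz]
      ring
    have ezt2 : ∫ t, (z - t) ^ 2 ∂H = z ^ 2 - 2 * z * m + K := by
      have : ∀ t, (z - t) ^ 2 = z ^ 2 - 2 * z * t + t ^ 2 := fun t => by ring
      simp_rw [this]
      rw [integral_sub_add (integrable_const _) (h1.const_mul _) h2, integral_const_mul,
        integral_const, probReal_univ, one_smul]
    have eg : ∫ t, g t ∂H = z ^ 2 - 2 * m * renewalArea H (n + 1) z
        + K * renewalCount H (n + 1) z := by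
      rw [hg, integral_sub_add izt2 (iJ.const_mul (2 * m)) (iU.const_mul K), integral_const_mul,
        integral_const_mul, ezt2,
        renewalCount_succ_of_nonneg H n hz, renewalArea_succ H hH n hz]
      ring
    rwa [ef, eg] at hle

/-- Lorden's inequality. -/
theorem renewalCount_le_lorden (hH : ∀ᵐ t ∂H, 0 ≤ t) (h1 : Integrable (fun t : ℝ => t) H)
    (h2 : Integrable (fun t : ℝ => t ^ 2) H) (hpos : 0 < ∫ t, t ∂H) (n : ℕ) {z : ℝ} (hz : 0 ≤ z) :
    renewalCount H n z ≤ z / (∫ t, t ∂H) + (∫ t, t ^ 2 ∂H) / (∫ t, t ∂H) ^ 2 := by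
  have hs := sq_sub_renewalCount_le H hH h1 h2 n z
  have ha := mul_renewalCount_le_renewalArea H n hz
  have hU := renewalCount_nonneg H n z
  have hK : 0 ≤ ∫ t, t ^ 2 ∂H := integral_nonneg fun t => sq_nonneg _
  set m := ∫ t, t ∂H
  set K := ∫ t, t ^ 2 ∂H
  set U := renewalCount H n z
  have hb : m * (z * U) ≤ m * (2 * renewalArea H n z) := mul_le_mul_of_nonneg_left ha hpos.le
  -- Expanding the square cancels `z ^ 2`, and replacing twice the area by its lower bound `z U`
  -- leaves one factor `U` to divide out.
  have hc : U * (m ^ 2 * U) ≤ U * (m * z + K) := by nlinarith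
  have hd : m ^ 2 * U ≤ m * z + K := by
    rcases hU.eq_or_lt with h0 | h0
    · rw [← h0, mul_zero]; positivity
    · exact le_of_mul_le_mul_left hc h0
  have : z / m + K / m ^ 2 = (m * z + K) / m ^ 2 := by field_simp
  rw [this, le_div_iff₀ (by positivity)]
  linarith

end

end Letac

namespace Letac

noncomputable section

/-! ### The renewal function as the limit of the truncated counts -/

section RenewalFunction

variable (H : Measure ℝ) [IsProbabilityMeasure H]

/-- The renewal function of a walk with nonnegative steps of law `H`. -/
def renewalFn (z : ℝ) : ℝ≥0∞ := ⨆ n, ENNReal.ofReal (renewalCount H n z)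

theorem renewalFn_mono : Monotone (renewalFn H) := fun _ _ h =>
  iSup_mono fun n => ENNReal.ofReal_le_ofReal (renewalCount_mono H n h)

theorem renewalFn_of_neg {z : ℝ} (hz : z < 0) : renewalFn H z = 0 := by
  simp [renewalFn, renewalCount_of_neg H _ hz]

/-- Monotone convergence in the truncated renewal equation. This half of the equation suffices for
the comparison with two-sided walks. -/
theorem one_add_lintegral_renewalFn_le {z : ℝ} (hz : 0 ≤ z) :
    1 + ∫⁻ t, renewalFn H (z - t) ∂H ≤ renewalFn H z := by
  have h1 : ∫⁻ t, renewalFn H (z - t) ∂H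
      = ⨆ n, ∫⁻ t, ENNReal.ofReal (renewalCount H n (z - t)) ∂H := by
    refine lintegral_iSup (fun n => ?_) (monotone_nat_of_le_succ fun n t => ?_)
    · exact ((measurable_renewalCount H n).comp (by fun_prop)).ennreal_ofReal
    · exact ENNReal.ofReal_le_ofReal (renewalCount_le_succ H n _)
  rw [h1, ENNReal.add_iSup]
  refine iSup_le fun n => le_iSup_of_le (n + 1) ?_
  rw [renewalCount_succ_of_nonneg H n hz, ENNReal.ofReal_add zero_le_one
    (integral_nonneg fun t => renewalCount_nonneg H n _), ENNReal.ofReal_one,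
    ofReal_integral_eq_lintegral_ofReal (integrable_renewalCount H H n (by fun_prop))
    (ae_of_all _ fun t => renewalCount_nonneg H n _)]

theorem renewalFn_le (hH : ∀ᵐ t ∂H, 0 ≤ t) (h1 : Integrable (fun t : ℝ => t) H)
    (h2 : Integrable (fun t : ℝ => t ^ 2) H) (hpos : 0 < ∫ t, t ∂H) {z : ℝ} (hz : 0 ≤ z) :
    renewalFn H z ≤ ENNReal.ofReal (z / (∫ t, t ∂H) + (∫ t, t ^ 2 ∂H) / (∫ t, t ∂H) ^ 2) :=
  iSup_le fun n => ENNReal.ofReal_le_ofReal (renewalCount_le_lorden H hH h1 h2 hpos n hz)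

end RenewalFunction

/-! ### Random walks with steps of both signs -/

/-- The expected number of `k < n` with `z + x_1 + ⋯ + x_k ≥ 0`, for i.i.d. steps of law `Ξ`. -/
def walkCount (Ξ : Measure ℝ) : ℕ → ℝ → ℝ≥0∞
  | 0, _ => 0
  | n + 1, z => (if 0 ≤ z then 1 else 0) + ∫⁻ x, walkCount Ξ n (z + x) ∂Ξ

/-- The laws of the Lindley recursion `M ↦ (M + x)⁺` started from `0`. -/
def lindley (Ξ : Measure ℝ) : ℕ → Measure ℝ
  | 0 => Measure.dirac 0
  | n + 1 => ((lindley Ξ n).prod Ξ).map (fun p => max (p.1 + p.2) 0)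

/-- The law of `(M_n + x)⁻` for the Lindley recursion. -/
def descent (Ξ : Measure ℝ) (n : ℕ) : Measure ℝ :=
  ((lindley Ξ n).prod Ξ).map (fun p => max (-(p.1 + p.2)) 0)

variable (Ξ : Measure ℝ) [IsProbabilityMeasure Ξ]

theorem walkCount_mono (n : ℕ) : Monotone (walkCount Ξ n) := by
  induction n with
  | zero => intro x y _; exact le_rfl
  | succ n ih =>
    intro x y hxy
    refine add_le_add ?_ (lintegral_mono fun t => ih (by simpa using hxy))
    split_ifs with h1 h2
    · exact le_rfl
    · exact absurd (h1.trans hxy) h2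
    · exact zero_le
    · exact le_rfl

theorem measurable_walkCount (n : ℕ) : Measurable (walkCount Ξ n) := (walkCount_mono Ξ n).measurable

instance isProbabilityMeasure_lindley (n : ℕ) : IsProbabilityMeasure (lindley Ξ n) := by
  induction n with
  | zero => exact inferInstanceAs (IsProbabilityMeasure (Measure.dirac 0))
  | succ n ih => exact Measure.isProbabilityMeasure_map (by fun_prop)

instance isProbabilityMeasure_descent (n : ℕ) : IsProbabilityMeasure (descent Ξ n) :=
  Measure.isProbabilityMeasure_map (by fun_prop)

theorem ae_nonneg_lindley (n : ℕ) : ∀ᵐ x ∂lindley Ξ n, 0 ≤ x := by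
  cases n with
  | zero => simp [lindley]
  | succ n =>
    rw [lindley, ae_map_iff (by fun_prop) measurableSet_Ici]
    exact ae_of_all _ fun p => le_max_right _ _

theorem ae_nonneg_descent (n : ℕ) : ∀ᵐ x ∂descent Ξ n, 0 ≤ x := by
  rw [descent, ae_map_iff (by fun_prop) measurableSet_Ici]
  exact ae_of_all _ fun p => le_max_right _ _

theorem lintegral_lindley_succ (n : ℕ) {f : ℝ → ℝ≥0∞} (hf : Measurable f) :
    ∫⁻ x, f x ∂lindley Ξ (n + 1) = ∫⁻ x, ∫⁻ t, f (max (x + t) 0) ∂Ξ ∂lindley Ξ n := by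
  rw [lindley, lintegral_map hf (by fun_prop), lintegral_prod _ (by fun_prop)]

theorem lintegral_descent (n : ℕ) {f : ℝ → ℝ≥0∞} (hf : Measurable f) :
    ∫⁻ x, f x ∂descent Ξ n = ∫⁻ x, ∫⁻ t, f (max (-(x + t)) 0) ∂Ξ ∂lindley Ξ n := by
  rw [descent, lintegral_map hf (by fun_prop), lintegral_prod _ (by fun_prop)]

/-- The recursion starts from its least state `0`, so its first move can only go up; being monotone
in the state, it preserves this stochastic order at later times. -/
theorem lintegral_lindley_le_succ (n : ℕ) {f : ℝ → ℝ≥0∞} (hf : Monotone f) :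
    ∫⁻ x, f x ∂lindley Ξ n ≤ ∫⁻ x, f x ∂lindley Ξ (n + 1) := by
  induction n generalizing f with
  | zero =>
    rw [lintegral_lindley_succ Ξ 0 hf.measurable]
    simp only [lindley, lintegral_dirac]
    calc f 0 = ∫⁻ _, f 0 ∂Ξ := by simp
      _ ≤ _ := lintegral_mono fun t => hf (le_max_right _ _)
  | succ n ih =>
    rw [lintegral_lindley_succ Ξ n hf.measurable, lintegral_lindley_succ Ξ (n + 1) hf.measurable]
    exact ih fun x y hxy => lintegral_mono fun t => hf (by gcongr)

theorem lintegral_descent_mono {f : ℝ → ℝ≥0∞} (hf : Antitone f) :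
    Monotone fun n => ∫⁻ x, f x ∂descent Ξ n := by
  refine monotone_nat_of_le_succ fun n => ?_
  rw [lintegral_descent Ξ n hf.measurable, lintegral_descent Ξ _ hf.measurable]
  exact lintegral_lindley_le_succ Ξ n fun x y hxy => lintegral_mono fun t => hf (by gcongr)

/-- A finite-horizon substitute for the Wiener–Hopf factorization: the Lindley state stands for the
running maximum, and the renewal process with steps `descent` for the descending ladder process. The
right side dominates the recursion that defines `walkCount`. -/
theorem walkCount_le_lintegral_renewalFn {n N : ℕ} (hn : n ≤ N)
    (hfin : ∀ z, renewalFn (descent Ξ N) z ≠ ∞) (z : ℝ) :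
    walkCount Ξ n z ≤ ∫⁻ x, renewalFn (descent Ξ N) (z + x) ∂lindley Ξ n := by
  set R := renewalFn (descent Ξ N) with hR
  have hmono : Monotone R := renewalFn_mono _
  have hmeas : Measurable R := hmono.measurable
  induction n generalizing z with
  | zero => exact zero_le
  | succ n ih =>
    have ih' := fun z => ih (by omega) z
    have e1 : ∫⁻ t, walkCount Ξ n (z + t) ∂Ξ
        ≤ ∫⁻ x, ∫⁻ t, R (z + (x + t)) ∂Ξ ∂lindley Ξ n := by
      rw [lintegral_lintegral_swap (by fun_prop)]
      refine lintegral_mono fun t => (ih' (z + t)).trans (lintegral_mono fun x => ?_)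
      rw [show z + t + x = z + (x + t) by ring]
    rw [walkCount, lintegral_lindley_succ Ξ n (f := fun x => R (z + x)) (by fun_prop)]
    rcases lt_or_ge z 0 with hz | hz
    · rw [if_neg hz.not_ge, zero_add]
      refine e1.trans (lintegral_mono fun x => lintegral_mono fun t => ?_)
      exact hmono (by gcongr; exact le_max_left _ _)
    · rw [if_pos hz]
      have hA : ∫⁻ t, R (z - t) ∂descent Ξ n ≤ ∫⁻ t, R (z - t) ∂descent Ξ N :=
        lintegral_descent_mono Ξ (f := fun t => R (z - t)) (fun x y hxy => hmono (by gcongr))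
          (by omega)
      have hB : 1 + ∫⁻ t, R (z - t) ∂descent Ξ N ≤ R z := one_add_lintegral_renewalFn_le _ hz
      have hC : ∫⁻ t, R (z - t) ∂descent Ξ n ≠ ∞ :=
        ne_top_of_le_ne_top (hfin z) (hA.trans (le_add_self.trans hB))
      -- Of the arguments `z + (x + t)⁺` and `z - (x + t)⁻`, one is `z` and the other is `z + (x +
      -- t)`. This exchanges the Lindley move for the free move of the walk; the leftover `R z` pays
      -- for the current visit and the descent term, which cancels because it is finite.
      have hD : (∫⁻ x, ∫⁻ t, R (z + max (x + t) 0) ∂Ξ ∂lindley Ξ n)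
            + ∫⁻ t, R (z - t) ∂descent Ξ n
          = (∫⁻ x, ∫⁻ t, R (z + (x + t)) ∂Ξ ∂lindley Ξ n) + R z := by
        rw [lintegral_descent Ξ n (f := fun t => R (z - t)) (by fun_prop),
          ← lintegral_add_left (by fun_prop)]
        have : R z = ∫⁻ _, R z ∂lindley Ξ n := by simp
        conv_rhs => rw [this]
        rw [← lintegral_add_right _ measurable_const]
        refine lintegral_congr fun x => ?_
        have h2 : R z = ∫⁻ _, R z ∂Ξ := by simp
        conv_rhs => rw [h2]
        rw [← lintegral_add_left (by fun_prop), ← lintegral_add_right _ measurable_const]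
        refine lintegral_congr fun t => ?_
        rcases le_total 0 (x + t) with h | h
        · rw [max_eq_left h, max_eq_right (by linarith), sub_zero]
        · rw [max_eq_right h, max_eq_left (by linarith), add_zero, sub_neg_eq_add, add_comm]
      refine (ENNReal.add_le_add_iff_right hC).1 ?_
      rw [hD]
      calc 1 + ∫⁻ t, walkCount Ξ n (z + t) ∂Ξ + ∫⁻ t, R (z - t) ∂descent Ξ n
          ≤ 1 + (∫⁻ x, ∫⁻ t, R (z + (x + t)) ∂Ξ ∂lindley Ξ n)
            + ∫⁻ t, R (z - t) ∂descent Ξ N := by gcongr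
        _ = (∫⁻ x, ∫⁻ t, R (z + (x + t)) ∂Ξ ∂lindley Ξ n)
            + (1 + ∫⁻ t, R (z - t) ∂descent Ξ N) := by ring
        _ ≤ _ := by gcongr


theorem memLp_lindley_and_descent (hΞ : MemLp (fun x : ℝ => x) 2 Ξ) (n : ℕ) :
    MemLp (fun x : ℝ => x) 2 (lindley Ξ n) ∧
    MemLp (fun p : ℝ × ℝ => p.1 + p.2) 2 ((lindley Ξ n).prod Ξ) ∧
    MemLp (fun x : ℝ => x) 2 (descent Ξ n) := by
  have step : ∀ n, MemLp (fun x : ℝ => x) 2 (lindley Ξ n) →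
      MemLp (fun p : ℝ × ℝ => p.1 + p.2) 2 ((lindley Ξ n).prod Ξ) := fun n h =>
    (h.comp_measurePreserving measurePreserving_fst).add
      (hΞ.comp_measurePreserving measurePreserving_snd)
  have h1 : MemLp (fun x : ℝ => x) 2 (lindley Ξ n) := by
    induction n with
    | zero =>
      refine MemLp.of_bound (C := 0) (by fun_prop) ?_
      simp [lindley, ae_dirac_eq]
    | succ n ih =>
      rw [lindley, memLp_map_measure_iff (by fun_prop) (by fun_prop)]
      exact (step n ih).pos_part
  refine ⟨h1, step n h1, ?_⟩
  rw [descent, memLp_map_measure_iff (by fun_prop) (by fun_prop)]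
  exact (step n h1).neg_part

/-- This is `x⁺ = x + x⁻` in mean. As the Lindley means increase with `n`, the mean descent is at
least the downward drift of the walk. -/
theorem integral_lindley_succ (hΞ : MemLp (fun x : ℝ => x) 2 Ξ) (n : ℕ) : ∫ x, x ∂lindley Ξ (n + 1)
    = ∫ x, x ∂lindley Ξ n + ∫ x, x ∂Ξ + ∫ x, x ∂descent Ξ n := by
  obtain ⟨h1, h2, -⟩ := memLp_lindley_and_descent Ξ hΞ n
  rw [lindley, descent, integral_map (by fun_prop) (by fun_prop),
    integral_map (by fun_prop) (by fun_prop)]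
  have e : ∫ p : ℝ × ℝ, (p.1 + p.2) ∂((lindley Ξ n).prod Ξ)
      = ∫ x, x ∂lindley Ξ n + ∫ x, x ∂Ξ := by
    rw [integral_add ((h1.integrable one_le_two).comp_fst Ξ)
      ((hΞ.integrable one_le_two).comp_snd _), integral_fun_fst (fun x : ℝ => x),
      integral_fun_snd (fun x : ℝ => x)]
    simp
  rw [← e, ← integral_add (h2.integrable one_le_two) (h2.neg_part.integrable one_le_two)]
  refine integral_congr_ae (ae_of_all _ fun p => ?_)
  simp only
  rcases le_total 0 (p.1 + p.2) with h | h
  · rw [max_eq_left h, max_eq_right (by linarith), add_zero]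
  · rw [max_eq_right h, max_eq_left (by linarith), add_neg_cancel]

/-- This is `(x⁺)² + (x⁻)² = x²`, with the state independent of the increment. Since the second
moments increase with `n`, it bounds the second moment of the descent from above. -/
theorem integral_sq_lindley_succ (hΞ : MemLp (fun x : ℝ => x) 2 Ξ) (n : ℕ) :
    ∫ x, x ^ 2 ∂lindley Ξ (n + 1)
    = ∫ x, x ^ 2 ∂lindley Ξ n + 2 * (∫ x, x ∂lindley Ξ n) * (∫ x, x ∂Ξ) + ∫ x, x ^ 2 ∂Ξ
      - ∫ x, x ^ 2 ∂descent Ξ n := by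
  obtain ⟨h1, h2, -⟩ := memLp_lindley_and_descent Ξ hΞ n
  rw [lindley, descent, integral_map (by fun_prop) (by fun_prop),
    integral_map (by fun_prop) (by fun_prop)]
  have e : ∫ p : ℝ × ℝ, (p.1 + p.2) ^ 2 ∂((lindley Ξ n).prod Ξ)
      = ∫ x, x ^ 2 ∂lindley Ξ n + 2 * (∫ x, x ∂lindley Ξ n) * (∫ x, x ∂Ξ) + ∫ x, x ^ 2 ∂Ξ := by
    have i1 : Integrable (fun p : ℝ × ℝ => p.1 ^ 2) ((lindley Ξ n).prod Ξ) :=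
      h1.integrable_sq.comp_fst Ξ
    have i2 : Integrable (fun p : ℝ × ℝ => p.2 ^ 2) ((lindley Ξ n).prod Ξ) :=
      hΞ.integrable_sq.comp_snd _
    have i3 : Integrable (fun p : ℝ × ℝ => p.1 * p.2) ((lindley Ξ n).prod Ξ) :=
      (h1.integrable one_le_two).mul_prod (hΞ.integrable one_le_two)
    have : ∀ p : ℝ × ℝ, (p.1 + p.2) ^ 2 = p.1 ^ 2 - (-2) * (p.1 * p.2) + p.2 ^ 2 :=
      fun p => by ring
    simp_rw [this]
    rw [integral_sub_add i1 (i3.const_mul (-2)) i2, integral_const_mul,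
      integral_prod_mul (fun x : ℝ => x) (fun x : ℝ => x),
      integral_fun_fst (fun x : ℝ => x ^ 2), integral_fun_snd (fun x : ℝ => x ^ 2)]
    simp only [probReal_univ, one_smul]
    ring
  rw [← e, eq_sub_iff_add_eq, ← integral_add h2.pos_part.integrable_sq h2.neg_part.integrable_sq]
  refine integral_congr_ae (ae_of_all _ fun p => ?_)
  simp only
  rcases le_total 0 (p.1 + p.2) with h | h
  · rw [max_eq_left h, max_eq_right (by linarith)]; ring
  · rw [max_eq_right h, max_eq_left (by linarith)]; ring

theorem integral_lindley_le_succ (hΞ : MemLp (fun x : ℝ => x) 2 Ξ) (n : ℕ) :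
    ∫ x, x ∂lindley Ξ n ≤ ∫ x, x ∂lindley Ξ (n + 1) ∧
      ∫ x, x ^ 2 ∂lindley Ξ n ≤ ∫ x, x ^ 2 ∂lindley Ξ (n + 1) := by
  obtain ⟨h1, -⟩ := memLp_lindley_and_descent Ξ hΞ n
  obtain ⟨h1', -⟩ := memLp_lindley_and_descent Ξ hΞ (n + 1)
  constructor
  · rw [← ENNReal.ofReal_le_ofReal_iff (integral_nonneg_of_ae (ae_nonneg_lindley Ξ (n + 1))),
      ofReal_integral_eq_lintegral_ofReal (h1.integrable one_le_two) (ae_nonneg_lindley Ξ n),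
      ofReal_integral_eq_lintegral_ofReal (h1'.integrable one_le_two) (ae_nonneg_lindley Ξ _)]
    exact lintegral_lindley_le_succ Ξ n fun x y h => ENNReal.ofReal_le_ofReal h
  · rw [← ENNReal.ofReal_le_ofReal_iff (integral_nonneg fun _ => sq_nonneg _),
      ofReal_integral_eq_lintegral_ofReal h1.integrable_sq (ae_of_all _ fun _ => sq_nonneg _),
      ofReal_integral_eq_lintegral_ofReal h1'.integrable_sq (ae_of_all _ fun _ => sq_nonneg _)]
    have hc : ∀ k, ∫⁻ x, ENNReal.ofReal (x ^ 2) ∂lindley Ξ k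
        = ∫⁻ x, ENNReal.ofReal (max x 0 ^ 2) ∂lindley Ξ k := fun k =>
      lintegral_congr_ae ((ae_nonneg_lindley Ξ k).mono fun x hx => by simp only [max_eq_left hx])
    rw [hc, hc]
    exact lintegral_lindley_le_succ Ξ n fun x y h => ENNReal.ofReal_le_ofReal (by gcongr)

/-- The expected number of visits to `[0, ∞)` of a random walk with negative drift. -/
theorem walkCount_le (hΞ : MemLp (fun x : ℝ => x) 2 Ξ) (hneg : ∫ x, x ∂Ξ < 0) (n : ℕ)
    {z : ℝ} (hz : 0 ≤ z) :
    walkCount Ξ n z ≤ ENNReal.ofReal (z / (-∫ x, x ∂Ξ) + (∫ x, x ^ 2 ∂Ξ) / (∫ x, x ∂Ξ) ^ 2) := by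
  obtain ⟨h1, h2, h3⟩ := memLp_lindley_and_descent Ξ hΞ n
  obtain ⟨ha, hb⟩ := integral_lindley_le_succ Ξ hΞ n
  have ha0 : 0 ≤ ∫ x, x ∂lindley Ξ n := integral_nonneg_of_ae (ae_nonneg_lindley Ξ n)
  rw [integral_lindley_succ Ξ hΞ] at ha
  rw [integral_sq_lindley_succ Ξ hΞ] at hb
  set a := ∫ x, x ∂lindley Ξ n
  set μ := ∫ x, x ∂Ξ
  set K := ∫ x, x ^ 2 ∂Ξ
  set o := ∫ x, x ∂descent Ξ n with ho
  set r := ∫ x, x ^ 2 ∂descent Ξ n with hr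
  have ho0 : 0 < o := by linarith
  have hr0 : 0 ≤ r := integral_nonneg fun _ => sq_nonneg _
  have hbd : ∀ z, 0 ≤ z → renewalFn (descent Ξ n) z ≤ ENNReal.ofReal (z / o + r / o ^ 2) :=
    fun z hz => renewalFn_le (descent Ξ n) (ae_nonneg_descent Ξ n) (h3.integrable one_le_two)
      h3.integrable_sq ho0 hz
  have hfin : ∀ z, renewalFn (descent Ξ n) z ≠ ∞ := fun z => by
    rcases lt_or_ge z 0 with h | h
    · simp [renewalFn_of_neg _ h]
    · exact ne_top_of_le_ne_top ENNReal.ofReal_ne_top (hbd z h)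
  refine (walkCount_le_lintegral_renewalFn Ξ le_rfl hfin z).trans ?_
  have i1 : Integrable (fun x => (z + x) / o + r / o ^ 2) (lindley Ξ n) :=
    (((integrable_const z).add (h1.integrable one_le_two)).div_const o).add (integrable_const _)
  calc ∫⁻ x, renewalFn (descent Ξ n) (z + x) ∂lindley Ξ n
      ≤ ∫⁻ x, ENNReal.ofReal ((z + x) / o + r / o ^ 2) ∂lindley Ξ n :=
        lintegral_mono_ae ((ae_nonneg_lindley Ξ n).mono fun x hx => hbd _ (by linarith))
    _ = ENNReal.ofReal (∫ x, ((z + x) / o + r / o ^ 2) ∂lindley Ξ n) := by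
        rw [ofReal_integral_eq_lintegral_ofReal i1]
        filter_upwards [ae_nonneg_lindley Ξ n] with x hx
        have : 0 ≤ z + x := by linarith
        simp only [Pi.zero_apply]
        positivity
    _ ≤ _ := by
        refine ENNReal.ofReal_le_ofReal ?_
        have e0 : ∫ x, ((z + x) / o + r / o ^ 2) ∂lindley Ξ n = (z + a) / o + r / o ^ 2 := by
          have : ∀ x, (z + x) / o + r / o ^ 2 = o⁻¹ * x + (z / o + r / o ^ 2) := fun x => by ring
          simp_rw [this]
          rw [integral_add ((h1.integrable one_le_two).const_mul _) (integrable_const _),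
            integral_const_mul, integral_const, probReal_univ, one_smul]
        rw [e0]
        have e1 : (z + a) / o ≤ (z + a) / (-μ) := by gcongr <;> linarith
        have e2 : r / o ^ 2 ≤ (K + 2 * a * μ) / (-μ) ^ 2 := by
          have : 0 ≤ K + 2 * a * μ := by linarith
          have hp : 0 < -μ := by linarith
          have ho' : -μ ≤ o := by linarith
          exact div_le_div₀ this (by linarith) (by positivity) (by gcongr)
        -- The mean `a` of the Lindley state enters once through the shifted start and `-2` times
        -- through the second moment of the descent. Its net coefficient is negative, so no estimate
        -- of `a` is needed.
        have e3 : (z + a) / (-μ) + (K + 2 * a * μ) / (-μ) ^ 2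
            = z / (-μ) + K / μ ^ 2 - a / (-μ) := by
          field_simp
          ring
        have e4 : 0 ≤ a / (-μ) := div_nonneg ha0 (by linarith)
        linarith

end

end Letac

namespace Letac

noncomputable section

/-! ### Discounted potentials of a kernel -/

section Potential

variable {X : Type*} [MeasurableSpace X] (κ : Kernel X X)

/-- The action of a kernel on nonnegative functions. -/
def act (f : X → ℝ≥0∞) (x : X) : ℝ≥0∞ := ∫⁻ y, f y ∂κ x

/-- The partial sums of the `c`-discounted potential `∑ cⁿ κⁿ f`. -/
def partialPotential (c : ℝ≥0∞) (f : X → ℝ≥0∞) : ℕ → X → ℝ≥0∞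
  | 0, _ => 0
  | n + 1, x => f x + c * act κ (partialPotential c f n) x

/-- The `c`-discounted potential `∑ cⁿ κⁿ f`. -/
def potential (c : ℝ≥0∞) (f : X → ℝ≥0∞) (x : X) : ℝ≥0∞ := ⨆ n, partialPotential κ c f n x

variable {κ} {c : ℝ≥0∞} {f g : X → ℝ≥0∞}

theorem measurable_act (hf : Measurable f) : Measurable (act κ f) := hf.lintegral_kernel

theorem act_mono (h : ∀ x, f x ≤ g x) (x : X) : act κ f x ≤ act κ g x := lintegral_mono h

theorem act_const_mul (a : ℝ≥0∞) (hf : Measurable f) (x : X) :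
    act κ (fun y => a * f y) x = a * act κ f x := lintegral_const_mul a hf

theorem act_add (hf : Measurable f) (x : X) :
    act κ (fun y => f y + g y) x = act κ f x + act κ g x := lintegral_add_left hf g

theorem measurable_partialPotential (hf : Measurable f) (n : ℕ) :
    Measurable (partialPotential κ c f n) := by
  induction n with
  | zero => exact measurable_const
  | succ n ih => exact hf.add ((measurable_act ih).const_mul c)

theorem measurable_potential (hf : Measurable f) : Measurable (potential κ c f) :=
  Measurable.iSup fun n => measurable_partialPotential hf n

theorem partialPotential_le_succ (n : ℕ) (x : X) :
    partialPotential κ c f n x ≤ partialPotential κ c f (n + 1) x := by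
  induction n generalizing x with
  | zero => exact zero_le
  | succ n ih =>
    have := act_mono (κ := κ) ih x
    simp only [partialPotential]
    gcongr
    exact this

theorem partialPotential_le_potential (n : ℕ) (x : X) :
    partialPotential κ c f n x ≤ potential κ c f x :=
  le_iSup (fun n => partialPotential κ c f n x) n

theorem act_potential (hf : Measurable f) (x : X) :
    act κ (potential κ c f) x = ⨆ n, act κ (partialPotential κ c f n) x :=
  lintegral_iSup (fun n => measurable_partialPotential hf n)
    (monotone_nat_of_le_succ fun n x => partialPotential_le_succ n x)

theorem potential_eq (hf : Measurable f) (x : X) :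
    potential κ c f x = f x + c * act κ (potential κ c f) x := by
  rw [act_potential hf, ENNReal.mul_iSup, ENNReal.add_iSup, potential,
    ← Monotone.iSup_nat_add (monotone_nat_of_le_succ fun n => partialPotential_le_succ n x) 1]
  rfl

theorem le_potential (hf : Measurable f) (x : X) : f x ≤ potential κ c f x := by
  rw [potential_eq hf]
  exact le_self_add

/-- The potential is the least supersolution of `f + c κ g ≤ g`, on any absorbing set. -/
theorem potential_le_of_absorbing {S : Set X} (hS : ∀ x ∈ S, κ x Sᶜ = 0)
    (h : ∀ x ∈ S, f x + c * act κ g x ≤ g x) {x : X} (hx : x ∈ S) : potential κ c f x ≤ g x := by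
  refine iSup_le fun n => ?_
  induction n generalizing x with
  | zero => exact zero_le
  | succ n ih =>
    refine le_trans ?_ (h x hx)
    have : act κ (partialPotential κ c f n) x ≤ act κ g x :=
      lintegral_mono_ae (by
        have : ∀ᵐ y ∂κ x, y ∈ S := by
          rw [ae_iff]; exact hS x hx
        filter_upwards [this] with y hy using ih hy)
    simp only [partialPotential]
    gcongr

theorem potential_le (h : ∀ x, f x + c * act κ g x ≤ g x) (x : X) : potential κ c f x ≤ g x :=
  potential_le_of_absorbing (S := Set.univ) (by simp) (fun x _ => h x) (Set.mem_univ x)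

theorem potential_mono_on {S : Set X} (hS : ∀ x ∈ S, κ x Sᶜ = 0) (hg : Measurable g)
    (h : ∀ x ∈ S, f x ≤ g x) {x : X} (hx : x ∈ S) : potential κ c f x ≤ potential κ c g x :=
  potential_le_of_absorbing hS (fun x hx => by
    rw [potential_eq hg x]
    gcongr
    exact h x hx) hx

theorem potential_mono (hg : Measurable g) (h : ∀ x, f x ≤ g x) (x : X) :
    potential κ c f x ≤ potential κ c g x :=
  potential_mono_on (S := Set.univ) (by simp) hg (fun x _ => h x) (Set.mem_univ x)

theorem potential_const_mul_le (a : ℝ≥0∞) (hf : Measurable f) (x : X) :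
    potential κ c (fun y => a * f y) x ≤ a * potential κ c f x := by
  refine potential_le (g := fun x => a * potential κ c f x) (fun x => ?_) x
  rw [act_const_mul a (measurable_potential hf), potential_eq hf x, mul_add, mul_left_comm]

theorem potential_add (hf : Measurable f) (x : X) :
    potential κ c (fun y => f y + g y) x = potential κ c f x + potential κ c g x := by
  have h : ∀ n x, partialPotential κ c (fun y => f y + g y) n x
      = partialPotential κ c f n x + partialPotential κ c g n x := by
    intro n
    induction n with
    | zero => intro x; simp [partialPotential]
    | succ n ih =>
      intro x
      have : partialPotential κ c (fun y => f y + g y) n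
        = fun y => partialPotential κ c f n y + partialPotential κ c g n y := funext ih
      simp only [partialPotential, this, act_add (measurable_partialPotential hf n)]
      ring
  simp only [potential, h]
  exact (ENNReal.iSup_add_iSup_of_monotone
    (monotone_nat_of_le_succ fun n => partialPotential_le_succ n x)
    (monotone_nat_of_le_succ fun n => partialPotential_le_succ n x)).symm

theorem partialPotential_le_natCast [IsMarkovKernel κ] (hf : ∀ x, f x ≤ 1) (n : ℕ) (x : X) :
    partialPotential κ 1 f n x ≤ n := by
  induction n generalizing x with
  | zero => simp [partialPotential]
  | succ n ih =>
    have : act κ (partialPotential κ 1 f n) x ≤ n := by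
      refine (act_mono ih x).trans ?_
      simp [act]
    simp only [partialPotential, one_mul]
    push_cast
    rw [add_comm (n : ℝ≥0∞)]
    exact add_le_add (hf x) this

/-- A geometric series, the same from every point. That it is a finite constant allows the potential
of a set to be traded for that of its complement. -/
theorem exists_potential_one_eq [Nonempty X] [IsMarkovKernel κ] (hc : c < 1) :
    ∃ t : ℝ≥0∞, t ≠ ∞ ∧ ∀ x, potential κ c (fun _ => 1) x = t := by
  have h : ∀ n, ∃ s, ∀ x, partialPotential κ c (fun _ => 1) n x = s := by
    intro n
    induction n with
    | zero => exact ⟨0, fun x => rfl⟩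
    | succ n ih =>
      obtain ⟨s, hs⟩ := ih
      exact ⟨1 + c * s, fun x => by simp [partialPotential, act, hs]⟩
  choose s hs using h
  refine ⟨⨆ n, s n, ?_, fun x => by simp only [potential, hs]⟩
  obtain ⟨x⟩ := ‹Nonempty X›
  have hc' : 1 - c ≠ 0 := (tsub_pos_of_lt hc).ne'
  have : potential κ c (fun _ => 1) x ≤ (1 - c)⁻¹ := by
    refine potential_le (g := fun _ => (1 - c)⁻¹) (fun x => ?_) x
    have h1 : act κ (fun _ => (1 - c)⁻¹) x = (1 - c)⁻¹ := by simp [act]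
    rw [h1]
    calc 1 + c * (1 - c)⁻¹ = (1 - c) * (1 - c)⁻¹ + c * (1 - c)⁻¹ := by
          rw [ENNReal.mul_inv_cancel hc' (by finiteness)]
      _ ≤ (1 - c)⁻¹ := by rw [← add_mul, tsub_add_cancel_of_le hc.le, one_mul]
  simp only [potential, hs] at this
  exact ne_top_of_le_ne_top (ENNReal.inv_ne_top.2 hc') this

/-- The zero set of a potential is absorbing. -/
theorem absorbing_potential_eq_zero (hc : c ≠ 0) (hf : Measurable f) {x : X}
    (hx : potential κ c f x = 0) : f x = 0 ∧ κ x {y | potential κ c f y = 0}ᶜ = 0 := by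
  rw [potential_eq hf, add_eq_zero, mul_eq_zero, or_iff_right hc, act,
    lintegral_eq_zero_iff (measurable_potential hf)] at hx
  exact ⟨hx.1, ae_iff.1 hx.2⟩

/-- If the potential vanished at `x`, the chain would stay in the zero set of the potential, which
is disjoint from `A`. -/
theorem potential_indicator_pos (hc : c ≠ 0) {A : Set X} (hA : MeasurableSet A) {x : X} {n : ℕ}
    (h : 0 < (κ ^ n) x A) : 0 < potential κ c (A.indicator 1) x := by
  by_contra h0
  rw [not_lt, nonpos_iff_eq_zero] at h0
  refine h.ne' ?_
  clear h
  induction n generalizing x with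
  | zero =>
    have := (absorbing_potential_eq_zero hc (measurable_one.indicator hA) h0).1
    rw [pow_zero]
    have hx : x ∉ A := fun hx => by simp [hx] at this
    change Kernel.id x A = 0
    rw [Kernel.id_apply, Measure.dirac_apply' _ hA]
    simp [hx]
  | succ n ih =>
    have := (absorbing_potential_eq_zero hc (measurable_one.indicator hA) h0).2
    rw [pow_succ]
    change ((κ ^ n) ∘ₖ κ) x A = 0
    rw [Kernel.comp_apply' _ _ _ hA, lintegral_eq_zero_iff (Kernel.measurable_coe _ hA)]
    filter_upwards [ae_iff.2 this] with y hy using ih hy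

/-! ### Killed kernels -/

variable {P Q : Kernel X X} {k : X → ℝ≥0∞} {ν : Measure X} [IsMarkovKernel P]
  [IsProbabilityMeasure ν]

theorem act_eq_act_add (hPQ : ∀ x, P x = Q x + k x • ν) (f : X → ℝ≥0∞) (x : X) :
    act P f x = act Q f x + k x * ∫⁻ y, f y ∂ν := by
  simp [act, hPQ, lintegral_add_measure, lintegral_smul_measure]

/-- The potential is the probability of ever being killed. The constant `1` is a supersolution
because the mass of `Q x` and the killing rate `k x` add up to one. -/
theorem potential_killing_le_one (hPQ : ∀ x, P x = Q x + k x • ν) (x : X) :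
    potential Q 1 k x ≤ 1 := by
  refine potential_le (g := fun _ => 1) (fun x => ?_) x
  have := act_eq_act_add hPQ (fun _ => 1) x
  simp only [lintegral_one, measure_univ, mul_one] at this
  rw [one_mul, add_comm, ← this]
  simp [act]

theorem potential_half_le_potential (hk : Measurable k) (x : X) :
    potential Q 2⁻¹ k x ≤ potential Q 1 k x := by
  refine potential_le (fun x => ?_) x
  rw [potential_eq hk x]
  gcongr
  simp

/-- In the double sum `Qⁿ k` has coefficient `∑_{j ≤ n} 2⁻ʲ ≤ 2`, and the total killing mass is at
most one. The induction carries one extra copy of the half-discounted potential so that it closes.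
-/
theorem potential_potential_half_le (hPQ : ∀ x, P x = Q x + k x • ν) (hk : Measurable k) (x : X) :
    potential Q 1 (potential Q 2⁻¹ k) x ≤ 2 := by
  have key : ∀ n x, partialPotential Q 1 (potential Q 2⁻¹ k) n x + potential Q 2⁻¹ k x
      ≤ 2 * potential Q 1 k x := by
    intro n
    induction n with
    | zero =>
      intro x
      simp only [partialPotential, zero_add]
      exact (potential_half_le_potential hk x).trans (le_mul_of_one_le_left' one_le_two)
    | succ n ih =>
      intro x
      have e : potential Q 2⁻¹ k x + potential Q 2⁻¹ k x
          = 2 * k x + act Q (potential Q 2⁻¹ k) x := by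
        rw [← two_mul]
        conv_lhs => rw [potential_eq hk x]
        rw [mul_add, ← mul_assoc, ENNReal.mul_inv_cancel two_ne_zero ENNReal.ofNat_ne_top, one_mul]
      calc partialPotential Q 1 (potential Q 2⁻¹ k) (n + 1) x + potential Q 2⁻¹ k x
          = (potential Q 2⁻¹ k x + potential Q 2⁻¹ k x)
            + act Q (partialPotential Q 1 (potential Q 2⁻¹ k) n) x := by
              simp only [partialPotential, one_mul]; ring
        _ = 2 * k x + act Q (fun y => partialPotential Q 1 (potential Q 2⁻¹ k) n y
            + potential Q 2⁻¹ k y) x := by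
              rw [e, act_add (measurable_partialPotential (measurable_potential hk) n)]; ring
        _ ≤ 2 * k x + act Q (fun y => 2 * potential Q 1 k y) x := by
              gcongr; exact act_mono ih x
        _ = 2 * potential Q 1 k x := by
              rw [act_const_mul _ (measurable_potential hk)]
              conv_rhs => rw [potential_eq hk x]
              ring
  refine iSup_le fun n => ?_
  calc _ ≤ _ := le_self_add
    _ ≤ _ := key n x
    _ ≤ 2 * 1 := by gcongr; exact potential_killing_le_one hPQ x
    _ = 2 := mul_one _

/-- The chains differ only by the restart from `ν`, after which the discounted killing mass is again
at most one. The factor `2` supplies the second copy of `d⁻¹ * k` that this restart consumes. -/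
theorem potential_indicator_le (hPQ : ∀ x, P x = Q x + k x • ν) {d : ℝ≥0∞} (hd : d ≠ 0)
    (hd' : d ≠ ∞) {C : Set X} (hC : MeasurableSet C) (hk : k = C.indicator (fun _ => d)) (x : X) :
    potential P 2⁻¹ (C.indicator 1) x ≤ 2 * d⁻¹ * potential Q 2⁻¹ k x := by
  have hkm : Measurable k := hk ▸ measurable_const.indicator hC
  refine potential_le (g := fun x => 2 * d⁻¹ * potential Q 2⁻¹ k x) (fun x => ?_) x
  rw [act_eq_act_add hPQ, act_const_mul _ (measurable_potential hkm),
    lintegral_const_mul _ (measurable_potential hkm)]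
  have hν : ∫⁻ y, potential Q 2⁻¹ k y ∂ν ≤ 1 := by
    calc _ ≤ ∫⁻ _, 1 ∂ν := lintegral_mono fun y =>
          (potential_half_le_potential hkm y).trans (potential_killing_le_one hPQ y)
      _ = 1 := by simp
  have h1 : C.indicator 1 x = d⁻¹ * k x := by
    rw [hk]
    by_cases hx : x ∈ C <;> simp [hx, ENNReal.inv_mul_cancel hd hd']
  conv_rhs => rw [potential_eq hkm x]
  calc C.indicator 1 x + 2⁻¹ * (2 * d⁻¹ * act Q (potential Q 2⁻¹ k) x
        + k x * (2 * d⁻¹ * ∫⁻ y, potential Q 2⁻¹ k y ∂ν))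
      ≤ d⁻¹ * k x + 2⁻¹ * (2 * d⁻¹ * act Q (potential Q 2⁻¹ k) x + k x * (2 * d⁻¹ * 1)) := by
        rw [h1]; gcongr
    _ = d⁻¹ * k x + (2⁻¹ * 2) * (d⁻¹ * k x) + 2 * d⁻¹ * (2⁻¹ * act Q (potential Q 2⁻¹ k) x) := by
        ring
    _ = 2 * d⁻¹ * (k x + 2⁻¹ * act Q (potential Q 2⁻¹ k) x) := by
        rw [ENNReal.inv_mul_cancel two_ne_zero ENNReal.ofNat_ne_top]; ring

/-- Foster–Lyapunov drift bounds the potential of the Lyapunov function. -/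
theorem potential_le_of_drift {W : X → ℝ≥0∞} {l b : ℝ≥0∞} (hl : l < 1) (hW : Measurable W)
    (hf : Measurable f) (h : ∀ x, act Q W x ≤ l * W x + b * f x) (x : X) :
    potential Q 1 W x ≤ (1 - l)⁻¹ * (W x + b * potential Q 1 f x) := by
  have hl' : 1 - l ≠ 0 := (tsub_pos_of_lt hl).ne'
  refine potential_le (g := fun x => (1 - l)⁻¹ * (W x + b * potential Q 1 f x)) (fun x => ?_) x
  have e : act Q (fun x => (1 - l)⁻¹ * (W x + b * potential Q 1 f x)) x
      = (1 - l)⁻¹ * (act Q W x + b * act Q (potential Q 1 f) x) := by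
    rw [act_const_mul _ (f := fun x => W x + b * potential Q 1 f x)
      (hW.add ((measurable_potential hf).const_mul b)), act_add hW,
      act_const_mul _ (measurable_potential hf)]
  rw [one_mul, e]
  have h2 : W x = (1 - l)⁻¹ * ((1 - l) * W x) := by
    rw [← mul_assoc, ENNReal.inv_mul_cancel hl' (by finiteness), one_mul]
  calc W x + (1 - l)⁻¹ * (act Q W x + b * act Q (potential Q 1 f) x)
      ≤ (1 - l)⁻¹ * ((1 - l) * W x)
        + (1 - l)⁻¹ * (l * W x + b * f x + b * act Q (potential Q 1 f) x) := by
        conv_lhs => rw [h2]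
        gcongr
        exact h x
    _ = (1 - l)⁻¹ * ((1 - l + l) * W x + b * (f x + 1 * act Q (potential Q 1 f) x)) := by ring
    _ = _ := by rw [tsub_add_cancel_of_le hl.le, one_mul, ← potential_eq hf]

end Potential

end

end Letac

namespace Letac

noncomputable section

/-! ### Uniform regeneration on compact sets for Feller chains -/

section Feller

/-- The (weak) Feller property, in terms of lower semicontinuous functions. -/
def IsFeller (P : Kernel ℝ ℝ) : Prop :=
  ∀ f : ℝ → ℝ≥0∞, LowerSemicontinuous f → LowerSemicontinuous (act P f)

variable {P Q : Kernel ℝ ℝ} {ν : Measure ℝ}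

theorem IsFeller.lowerSemicontinuous_potential (hP : IsFeller P) {c : ℝ≥0∞} (hc : c ≠ ∞)
    {f : ℝ → ℝ≥0∞} (hf : LowerSemicontinuous f) : LowerSemicontinuous (potential P c f) := by
  refine lowerSemicontinuous_iSup fun n => ?_
  induction n with
  | zero => exact lowerSemicontinuous_const
  | succ n ih =>
    refine hf.add ?_
    exact (ENNReal.continuous_const_mul hc).comp_lowerSemicontinuous (hP _ ih)
      fun a b hab => mul_le_mul_right hab c

theorem lowerSemicontinuous_indicator_one {O : Set ℝ} (hO : IsOpen O) :
    LowerSemicontinuous (O.indicator (1 : ℝ → ℝ≥0∞)) :=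
  hO.lowerSemicontinuous_indicator zero_le

/-- The open sets that some starting point never reaches. -/
def unreachableSets (P : Kernel ℝ ℝ) : Set (Set ℝ) :=
  {O | IsOpen O ∧ ∃ y, potential P 4⁻¹ (O.indicator 1) y = 0}

/-- The set of points all of whose neighbourhoods are reached from everywhere. -/
def reachableSet (P : Kernel ℝ ℝ) : Set ℝ := (⋃₀ unreachableSets P)ᶜ

theorem isClosed_reachableSet : IsClosed (reachableSet P) :=
  (isOpen_sUnion fun _ hO => hO.1).isClosed_compl

/-- By the Lindelöf property, countably many of the open sets already cover the union. -/
theorem measure_compl_reachableSet {μ : Measure ℝ} (h : ∀ O ∈ unreachableSets P, μ O = 0) :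
    μ (reachableSet P)ᶜ = 0 := by
  rw [reachableSet, compl_compl]
  obtain ⟨T, hTc, hT, hU⟩ := TopologicalSpace.isOpen_sUnion_countable (unreachableSets P)
    fun O hO => hO.1
  rw [← hU]
  exact (measure_sUnion_null_iff hTc).2 fun O hO => h O (hT hO)

theorem act_indicator_one {O : Set ℝ} (hO : MeasurableSet O) (x : ℝ) :
    act P (O.indicator 1) x = P x O := lintegral_indicator_one hO

theorem not_mem_of_potential_indicator_eq_zero {c : ℝ≥0∞} (hc : c ≠ 0) {O : Set ℝ}
    (hO : MeasurableSet O) {z : ℝ} (hz : potential P c (O.indicator 1) z = 0) :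
    z ∉ O ∧ P z O = 0 := by
  have hm : Measurable (O.indicator (1 : ℝ → ℝ≥0∞)) := measurable_one.indicator hO
  have key : ∀ y, potential P c (O.indicator 1) y = 0 → y ∉ O := fun y hy hyO => by
    have := (absorbing_potential_eq_zero hc hm hy).1
    simp [hyO] at this
  exact ⟨key z hz, measure_mono_null (fun y hy h0 => key y h0 hy)
    (absorbing_potential_eq_zero hc hm hz).2⟩

/-- Suppose `P x` charges an open set `O` that some `y` never reaches. By the Feller property the
points charging `O` form an open set; it contains `x`, and `y` never reaches it either, so `x` is
not in the reachable set. -/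
theorem IsFeller.reachableSet_absorbing (hP : IsFeller P) {x : ℝ} (hx : x ∈ reachableSet P) :
    P x (reachableSet P)ᶜ = 0 := by
  refine measure_compl_reachableSet fun O ⟨hO, y, hy⟩ => ?_
  by_contra hne
  have hO' : IsOpen {x | 0 < act P (O.indicator 1) x} :=
    (hP _ (lowerSemicontinuous_indicator_one hO)).isOpen_preimage 0
  refine hx ⟨_, ⟨hO', y, ?_⟩, ?_⟩
  · have hm : Measurable (O.indicator (1 : ℝ → ℝ≥0∞)) := measurable_one.indicator hO.measurableSet
    refine nonpos_iff_eq_zero.1 (potential_le_of_absorbing (g := fun _ => 0)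
      (S := {y | potential P 4⁻¹ (O.indicator 1) y = 0})
      (fun z hz => (absorbing_potential_eq_zero (by simp) hm hz).2) (fun z hz => ?_) hy)
    have := (not_mem_of_potential_indicator_eq_zero (by simp) hO.measurableSet hz).2
    have h0 : act P (fun _ => 0) z = 0 := by simp [act]
    rw [h0]
    simp [act_indicator_one hO.measurableSet, this]
  · change 0 < act P (O.indicator 1) x
    rw [act_indicator_one hO.measurableSet]
    exact pos_iff_ne_zero.2 hne

/-- From every starting point the chain reaches `C`, hence every set charged after a regeneration
from `ν`. -/
theorem exists_potential_indicator_pos {c : ℝ≥0∞} (hc : c ≠ 0) {φ : Measure ℝ} {C : Set ℝ}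
    (hirr : Kernel.IsIrreducible φ P) (hC : MeasurableSet C) (hφ : 0 < φ C)
    (hmin : ∀ x ∈ C, ν ≪ P x) {A : Set ℝ} (hA : MeasurableSet A)
    (hν : ∫⁻ y, potential P c (A.indicator 1) y ∂ν ≠ 0) (x : ℝ) :
    0 < potential P c (A.indicator 1) x := by
  have hm : Measurable (A.indicator (1 : ℝ → ℝ≥0∞)) := measurable_one.indicator hA
  by_contra h0
  rw [not_lt, nonpos_iff_eq_zero] at h0
  obtain ⟨n, hn⟩ := hirr.irreducible hC hφ x
  refine (potential_indicator_pos hc hC hn).ne' ?_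
  refine nonpos_iff_eq_zero.1 (potential_le_of_absorbing (g := fun _ => 0)
    (S := {y | potential P c (A.indicator 1) y = 0})
    (fun z hz => (absorbing_potential_eq_zero hc hm hz).2) (fun z hz => ?_) h0)
  have : z ∉ C := fun hzC => hν <| by
    rw [lintegral_eq_zero_iff (measurable_potential hm)]
    exact ae_iff.2 (hmin z hzC (absorbing_potential_eq_zero hc hm hz).2)
  simp [this, act]

variable [IsMarkovKernel P] [IsProbabilityMeasure ν]

theorem isProbabilityMeasure_kernel_pow (n : ℕ) (x : ℝ) : IsProbabilityMeasure ((P ^ n) x) := by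
  have : IsMarkovKernel (P ^ n) := by
    induction n with
    | zero => exact inferInstanceAs (IsMarkovKernel Kernel.id)
    | succ n ih =>
      rw [pow_succ]
      exact inferInstanceAs (IsMarkovKernel ((P ^ n) ∘ₖ P))
  infer_instance

/-- Some iterate of `P` started from `ν` charges `C`, hence by inner regularity a closed part `F` of
`C`. Every start reaches `C`, and from `C` the one-step law charges all that `ν` does. Closedness of
`F` makes its potential upper semicontinuous. -/
theorem exists_isClosed_potential_pos {φ : Measure ℝ} {C : Set ℝ}
    (hirr : Kernel.IsIrreducible φ P) (hC : MeasurableSet C) (hφ : 0 < φ C)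
    (hmin : ∀ x ∈ C, ν ≪ P x) :
    ∃ F, IsClosed F ∧ F ⊆ C ∧ ∀ x, 0 < potential P 2⁻¹ (F.indicator 1) x := by
  obtain ⟨n, hn⟩ : ∃ n, ν {x | 0 < (P ^ n) x C} ≠ 0 := by
    by_contra! h
    have : ν (⋃ n, {x | 0 < (P ^ n) x C}) = 0 := measure_iUnion_null h
    rw [show (⋃ n, {x | 0 < (P ^ n) x C}) = Set.univ from
      Set.eq_univ_of_forall fun x => Set.mem_iUnion.2 (hirr.irreducible hC hφ x)] at this
    simp at this
  have hne : (ν.bind (P ^ n)) C ≠ 0 := by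
    rw [Measure.bind_apply hC (Kernel.aemeasurable _), ne_eq,
      lintegral_eq_zero_iff (Kernel.measurable_coe _ hC)]
    intro h
    refine hn ?_
    have := ae_iff.1 h
    simpa [pos_iff_ne_zero] using this
  have : IsFiniteMeasure (ν.bind (P ^ n)) := ⟨by
    rw [Measure.bind_apply .univ (Kernel.aemeasurable _)]
    have := fun x => (isProbabilityMeasure_kernel_pow (P := P) n x).measure_univ
    simp [this]⟩
  obtain ⟨F, hFC, hF, hpos⟩ := hC.exists_lt_isClosed_of_ne_top (measure_ne_top (ν.bind (P ^ n)) C)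
    (pos_iff_ne_zero.2 hne)
  refine ⟨F, hF, hFC, exists_potential_indicator_pos (by simp) hirr hC hφ hmin hF.measurableSet
    fun h0 => hpos.ne' ?_⟩
  have hm : Measurable (F.indicator (1 : ℝ → ℝ≥0∞)) := measurable_one.indicator hF.measurableSet
  rw [lintegral_eq_zero_iff (measurable_potential hm)] at h0
  rw [Measure.bind_apply hF.measurableSet (Kernel.aemeasurable _),
    lintegral_eq_zero_iff (Kernel.measurable_coe _ hF.measurableSet)]
  filter_upwards [h0] with x hx
  by_contra hne
  exact (potential_indicator_pos (c := 2⁻¹) (by simp) hF.measurableSet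
    (pos_iff_ne_zero.2 hne)).ne' hx

/-- The potentials of `F` and `Fᶜ` add up to a finite constant, and that of the open set `Fᶜ` is
lower semicontinuous. -/
theorem IsFeller.isClosed_le_potential_indicator (hP : IsFeller P) {F : Set ℝ} (hF : IsClosed F)
    (a : ℝ≥0∞) : IsClosed {x | a ≤ potential P 2⁻¹ (F.indicator 1) x} := by
  obtain ⟨t, ht, hpot⟩ := exists_potential_one_eq (κ := P) (c := 2⁻¹) (by simp)
  have hadd : ∀ x, potential P 2⁻¹ (F.indicator 1) x + potential P 2⁻¹ (Fᶜ.indicator 1) x = t := by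
    intro x
    rw [← potential_add (measurable_one.indicator hF.measurableSet), ← hpot x]
    congr 1
    ext y
    by_cases hy : y ∈ F <;> simp [hy]
  have hset : {x | a ≤ potential P 2⁻¹ (F.indicator 1) x}
      = (fun x => potential P 2⁻¹ (Fᶜ.indicator 1) x + a) ⁻¹' Set.Iic t := by
    ext x
    have hfin : potential P 2⁻¹ (Fᶜ.indicator 1) x ≠ ∞ :=
      ne_top_of_le_ne_top ht (le_add_self.trans (hadd x).le)
    simp only [Set.mem_ofPred_eq, Set.mem_preimage, Set.mem_Iic]
    rw [← hadd x, add_comm _ a]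
    exact (ENNReal.add_le_add_iff_right hfin).symm
  rw [hset]
  exact ((hP.lowerSemicontinuous_potential (by simp)
    (lowerSemicontinuous_indicator_one hF.isOpen_compl)).add
      lowerSemicontinuous_const).isClosed_preimage t

/-- A Feller chain with a minorized set `C` charged by an irreducibility measure, killed at its
regenerations, spends a bounded expected time in each compact set, when it starts in a suitable
closed absorbing set of full regeneration measure. -/
theorem exists_absorbing_potential_compact_le (hP : IsFeller P) {φ : Measure ℝ} {C : Set ℝ}
    (hirr : Kernel.IsIrreducible φ P) (hC : MeasurableSet C) (hφ : 0 < φ C) {d : ℝ≥0∞}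
    (hd : d ≠ 0) (hd' : d ≠ ∞)
    (hPQ : ∀ x, P x = Q x + C.indicator (fun _ => d) x • ν) :
    ∃ S : Set ℝ, IsClosed S ∧ (∀ x ∈ S, P x Sᶜ = 0) ∧ ν Sᶜ = 0 ∧
      ∀ K : Set ℝ, IsCompact K → ∃ M : ℝ≥0∞, M ≠ ∞ ∧
        ∀ x ∈ S, potential Q 1 (K.indicator 1) x ≤ M := by
  have hmin : ∀ x ∈ C, ν ≪ P x := fun x hx => by
    refine Measure.AbsolutelyContinuous.mk fun A _ h0 => ?_
    rw [hPQ x] at h0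
    simp only [hx, Set.indicator_of_mem, Measure.add_apply, Measure.smul_apply, smul_eq_mul,
      add_eq_zero, mul_eq_zero, or_iff_right hd] at h0
    exact h0.2
  have hSP : ∀ x ∈ reachableSet P, P x (reachableSet P)ᶜ = 0 :=
    fun x hx => hP.reachableSet_absorbing hx
  have hSQ : ∀ x ∈ reachableSet P, Q x (reachableSet P)ᶜ = 0 := fun x hx => by
    have := hSP x hx
    rw [hPQ x, Measure.add_apply, add_eq_zero] at this
    exact this.1
  have hSν : ν (reachableSet P)ᶜ = 0 := by
    refine measure_compl_reachableSet fun O ⟨hO, y, hy⟩ => ?_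
    by_contra hne
    refine (exists_potential_indicator_pos (c := 4⁻¹) (by simp) hirr hC hφ hmin hO.measurableSet
      (fun h0 => hne ?_) y).ne' hy
    have hm : Measurable (O.indicator (1 : ℝ → ℝ≥0∞)) := measurable_one.indicator hO.measurableSet
    rw [← nonpos_iff_eq_zero, ← h0, ← lintegral_indicator_one hO.measurableSet]
    exact lintegral_mono fun x => le_potential hm x
  refine ⟨reachableSet P, isClosed_reachableSet, hSP, hSν, fun K hK => ?_⟩
  obtain ⟨F, hF, hFC, hFpos⟩ := exists_isClosed_potential_pos hirr hC hφ hmin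
  set S := reachableSet P with hS
  set r := potential P 2⁻¹ (F.indicator 1) with hr
  have hFm : Measurable (F.indicator (1 : ℝ → ℝ≥0∞)) := measurable_one.indicator hF.measurableSet
  have hCm : Measurable (C.indicator (1 : ℝ → ℝ≥0∞)) := measurable_one.indicator hC
  have hrm : Measurable r := measurable_potential hFm
  have hSne : S.Nonempty := by
    by_contra h
    rw [Set.not_nonempty_iff_eq_empty] at h
    rw [h] at hSν
    simp at hSν
  have : Nonempty S := hSne.to_subtype
  have : CompleteSpace S := isClosed_reachableSet.completeSpace_coe
  -- Baire in the complete space `S`: the closed sets `{r ≥ 1 / m}` cover it because `r > 0`, so `r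
  -- ≥ 1 / m` on a nonempty relatively open part `I ∩ S`.
  obtain ⟨m, hm⟩ := nonempty_interior_of_iUnion_of_closed
    (f := fun m : ℕ => {x : S | (m : ℝ≥0∞)⁻¹ ≤ r x})
    (fun m => (hP.isClosed_le_potential_indicator hF _).preimage continuous_subtype_val) (by
      refine Set.eq_univ_of_forall fun x => Set.mem_iUnion.2 ?_
      obtain ⟨m, hm⟩ := ENNReal.exists_inv_nat_lt (hFpos x).ne'
      exact ⟨m, hm.le⟩)
  obtain ⟨x₀, hx₀⟩ := hm
  obtain ⟨t, htm, ht, hxt⟩ := mem_interior.1 hx₀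
  obtain ⟨I, hI, rfl⟩ := isOpen_induced_iff.1 ht
  have hIr : ∀ x ∈ S, I.indicator (1 : ℝ → ℝ≥0∞) x ≤ m * r x := fun x hx => by
    by_cases hxI : x ∈ I
    · have h1 : (m : ℝ≥0∞)⁻¹ ≤ r x := htm (show (⟨x, hx⟩ : S) ∈ Subtype.val ⁻¹' I from hxI)
      have hfin : r x ≠ ∞ := by
        obtain ⟨t, ht, hpot⟩ := exists_potential_one_eq (κ := P) (c := 2⁻¹) (by simp)
        refine ne_top_of_le_ne_top ht ((potential_mono measurable_const (fun y => ?_) x).trans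
          (hpot x).le)
        exact Set.indicator_le_self' (fun _ _ => zero_le) y
      have hm0 : (m : ℝ≥0∞) ≠ 0 := fun h0 => by
        rw [h0, ENNReal.inv_zero, top_le_iff] at h1
        exact hfin h1
      simp only [hxI, Set.indicator_of_mem, Pi.one_apply]
      rw [← ENNReal.mul_inv_cancel hm0 (ENNReal.natCast_ne_top m)]
      gcongr
    · simp [hxI]
  -- As `I` contains a point of the reachable set, no start avoids `I`. Hence `q > 0` everywhere,
  -- and lower semicontinuity gives a positive minimum on `K`.
  set q := potential P 4⁻¹ (I.indicator 1) with hq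
  have hqpos : ∀ x, 0 < q x := fun x => by
    by_contra h0
    rw [not_lt, nonpos_iff_eq_zero] at h0
    exact x₀.2 ⟨I, ⟨hI, x, h0⟩, hxt⟩
  have hqlsc : LowerSemicontinuous q :=
    hP.lowerSemicontinuous_potential (by simp) (lowerSemicontinuous_indicator_one hI)
  obtain ⟨ε, hε0, hε1, hε⟩ : ∃ ε : ℝ≥0∞, ε ≠ 0 ∧ ε ≠ ∞ ∧ ∀ x ∈ K, ε ≤ q x := by
    rcases K.eq_empty_or_nonempty with rfl | hne
    · exact ⟨1, by simp, by simp, by simp⟩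
    · obtain ⟨x₁, -, hx₁⟩ := LowerSemicontinuousOn.exists_isMinOn hne hK
        (hqlsc.lowerSemicontinuousOn K)
      exact ⟨min 1 (q x₁), (lt_min zero_lt_one (hqpos x₁)).ne',
        ne_top_of_le_ne_top ENNReal.one_ne_top (min_le_left _ _),
        fun x hx => (min_le_right _ _).trans (hx₁ hx)⟩
  have hqr : ∀ x ∈ S, q x ≤ m * (2 * r x) := fun x hx => by
    -- Since `r ≥ 2⁻¹ P r`, the function `2 r` is a supersolution at discount `4⁻¹`; hence the
    -- smaller discount in `q` and in `unreachableSets`.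
    have h1 : ∀ x, potential P 4⁻¹ r x ≤ 2 * r x := by
      refine potential_le (g := fun x => 2 * r x) fun x => ?_
      rw [act_const_mul _ hrm, ← mul_assoc]
      have h2 : (4⁻¹ : ℝ≥0∞) * 2 = 2⁻¹ := by
        rw [show (4 : ℝ≥0∞) = 2 * 2 by norm_num,
          ENNReal.mul_inv (Or.inl two_ne_zero) (Or.inl ENNReal.ofNat_ne_top), mul_assoc,
          ENNReal.inv_mul_cancel two_ne_zero ENNReal.ofNat_ne_top, mul_one]
      rw [h2, two_mul]
      gcongr
      conv_rhs => rw [hr, potential_eq hFm]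
      exact le_add_self
    calc q x ≤ potential P 4⁻¹ (fun x => m * r x) x :=
          potential_mono_on hSP (hrm.const_mul _) hIr hx
      _ ≤ m * potential P 4⁻¹ r x := potential_const_mul_le _ hrm x
      _ ≤ m * (2 * r x) := by gcongr; exact h1 x
  set k := C.indicator (fun _ => d) with hk
  have hkm : Measurable k := measurable_const.indicator hC
  have hrk : ∀ x, r x ≤ 2 * d⁻¹ * potential Q 2⁻¹ k x := fun x =>
    (potential_mono hCm (fun y => Set.indicator_le_indicator_of_subset hFC (fun _ => zero_le) y)
      x).trans (potential_indicator_le hPQ hd hd' hC hk x)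
  set a : ℝ≥0∞ := ε⁻¹ * (m * (2 * (2 * d⁻¹))) with ha
  have ha' : a ≠ ∞ := by
    have := ENNReal.inv_ne_top.2 hd
    have := ENNReal.inv_ne_top.2 hε0
    finiteness
  refine ⟨a * 2, by finiteness, fun x hx => ?_⟩
  calc potential Q 1 (K.indicator 1) x
      ≤ potential Q 1 (fun x => a * potential Q 2⁻¹ k x) x := by
        refine potential_mono_on hSQ ((measurable_potential hkm).const_mul a) (fun x hx => ?_) hx
        by_cases hxK : x ∈ K
        · simp only [hxK, Set.indicator_of_mem, Pi.one_apply]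
          calc (1 : ℝ≥0∞) = ε⁻¹ * ε := (ENNReal.inv_mul_cancel hε0 hε1).symm
            _ ≤ ε⁻¹ * (m * (2 * (2 * d⁻¹ * potential Q 2⁻¹ k x))) := by
              gcongr
              refine (hε x hxK).trans ((hqr x hx).trans ?_)
              gcongr
              exact hrk x
            _ = a * potential Q 2⁻¹ k x := by rw [ha]; ring
        · simp [hxK]
    _ ≤ a * potential Q 1 (potential Q 2⁻¹ k) x :=
        potential_const_mul_le _ (measurable_potential hkm) x
    _ ≤ a * 2 := by gcongr; exact potential_potential_half_le hPQ hkm x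

end Feller

/-! ### The forward recursion is a Feller chain -/

instance isMarkovKernel_transition (ρ : Measure (ℝ × ℝ × ℝ)) [IsProbabilityMeasure ρ] :
    IsMarkovKernel (transition ρ) :=
  ⟨fun _ => Measure.isProbabilityMeasure_map
    (measurable_step.comp measurable_prodMk_left).aemeasurable⟩

theorem act_transition (ρ : Measure (ℝ × ℝ × ℝ)) [SFinite ρ] {f : ℝ → ℝ≥0∞} (hf : Measurable f)
    (v : ℝ) : act (transition ρ) f v = ∫⁻ y, f (step y v) ∂ρ :=
  lintegral_map hf (measurable_step.comp measurable_prodMk_left)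

theorem continuous_step (y : ℝ × ℝ × ℝ) : Continuous (step y) := by
  unfold step
  fun_prop

/-- Fatou's lemma, since each random map is continuous. -/
theorem isFeller_transition (ρ : Measure (ℝ × ℝ × ℝ)) [SFinite ρ] : IsFeller (transition ρ) := by
  intro f hf
  rw [lowerSemicontinuous_iff_le_liminf]
  intro v
  rw [show act (transition ρ) f = fun v => ∫⁻ y, f (step y v) ∂ρ from
    funext (act_transition ρ hf.measurable)]
  calc ∫⁻ y, f (step y v) ∂ρ ≤ ∫⁻ y, liminf (fun w => f (step y w)) (𝓝 v) ∂ρ :=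
        lintegral_mono fun y => ((LowerSemicontinuous.comp hf (continuous_step y))).le_liminf v
    _ ≤ liminf (fun w => ∫⁻ y, f (step y w) ∂ρ) (𝓝 v) :=
        lintegral_liminf_le fun w =>
          hf.measurable.comp (measurable_step.comp measurable_prodMk_left)

end

end Letac

namespace Letac

noncomputable section

/-! ### Moments and the Lyapunov function -/

/-- The perturbation `A |D| + |B|` in `|F_Y(v)| ≤ A |v| + A |D| + |B|`. -/
def noise (y : ℝ × ℝ × ℝ) : ℝ := y.1 * |y.2.2| + |y.2.1|

theorem measurable_noise : Measurable noise := by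
  unfold noise
  fun_prop

theorem noise_nonneg {y : ℝ × ℝ × ℝ} (hy : 0 < y.1) : 0 ≤ noise y := by
  unfold noise
  positivity

theorem abs_step_le {y : ℝ × ℝ × ℝ} (hy : 0 < y.1) (v : ℝ) : |step y v| ≤ y.1 * |v| + noise y := by
  unfold step noise
  have h1 := abs_add_le (y.1 * max y.2.2 v) y.2.1
  rw [abs_mul, abs_of_pos hy] at h1
  have h2 : |max y.2.2 v| ≤ |y.2.2| + |v| := abs_max_le_max_abs_abs.trans
    (max_le (by linarith [abs_nonneg v]) (by linarith [abs_nonneg y.2.2]))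
  nlinarith

/-- For `v ≤ 0` one has `|max D v| ≤ |D|`, so one step forgets how negative `v` was. This makes
later bounds uniform over starts that are unbounded below. -/
theorem abs_step_le_noise {y : ℝ × ℝ × ℝ} (hy : 0 < y.1) {v : ℝ} (hv : v ≤ 0) :
    |step y v| ≤ noise y := by
  unfold step noise
  have h1 := abs_add_le (y.1 * max y.2.2 v) y.2.1
  rw [abs_mul, abs_of_pos hy] at h1
  have h2 : |max y.2.2 v| ≤ |y.2.2| := by
    rcases le_total v y.2.2 with h | h
    · rw [max_eq_left h]
    · rw [max_eq_right h, abs_of_nonpos hv, abs_of_nonpos (h.trans hv)]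
      linarith
  nlinarith

theorem rpow_le_one_add_rpow {x s t : ℝ} (hx : 0 ≤ x) (hs : 0 < s) (hst : s ≤ t) :
    x ^ s ≤ 1 + x ^ t := by
  rcases le_total x 1 with h | h
  · have := Real.rpow_le_one hx h hs.le
    have := Real.rpow_nonneg hx t
    linarith
  · have := Real.rpow_le_rpow_of_exponent_le h hst
    linarith

namespace Hypotheses

variable {ρ : Measure (ℝ × ℝ × ℝ)} [IsProbabilityMeasure ρ] {ξ : ℝ} (hρ : Hypotheses ρ ξ)

include hρ

theorem exp_mul_log_ae : (fun y : ℝ × ℝ × ℝ => Real.exp (ξ * Real.log y.1)) =ᵐ[ρ]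
    fun y => y.1 ^ ξ := by
  filter_upwards [hρ.A_pos] with y hy
  rw [Real.rpow_def_of_pos hy, mul_comm]

theorem mem_integrableExpSet : ξ ∈ integrableExpSet (fun y : ℝ × ℝ × ℝ => Real.log y.1) ρ :=
  interior_subset hρ.xi_dom

theorem integrable_rpow_xi : Integrable (fun y : ℝ × ℝ × ℝ => y.1 ^ ξ) ρ :=
  (integrable_congr hρ.exp_mul_log_ae).1 hρ.mem_integrableExpSet

theorem integral_rpow_xi : ∫ y, y.1 ^ ξ ∂ρ = 1 := by
  rw [← integral_congr_ae hρ.exp_mul_log_ae]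
  change mgf (fun y : ℝ × ℝ × ℝ => Real.log y.1) ρ ξ = 1
  have hpos := mgf_pos hρ.mem_integrableExpSet
  have h0 := hρ.xi_root
  rw [cgf] at h0
  exact Real.eq_one_of_pos_of_log_eq_zero hpos h0

/-- Otherwise the law of `A` would be carried by a point and be singular. -/
theorem measure_ne_one_pos : 0 < ρ {y | y.1 ≠ 1} := by
  rw [pos_iff_ne_zero]
  intro h0
  refine hρ.A_ac ⟨{1}ᶜ, (measurableSet_singleton 1).compl, ?_, by simp⟩
  rw [Measure.map_apply measurable_fst (measurableSet_singleton 1).compl]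
  exact h0

theorem integrable_rpow {s : ℝ} (hs : 0 < s) (hsξ : s ≤ ξ) :
    Integrable (fun y : ℝ × ℝ × ℝ => y.1 ^ s) ρ := by
  refine Integrable.mono' ((integrable_const 1).add hρ.integrable_rpow_xi)
    (measurable_fst.pow_const s).aestronglyMeasurable ?_
  filter_upwards [hρ.A_pos] with y hy
  rw [Real.norm_of_nonneg (by positivity)]
  exact rpow_le_one_add_rpow hy.le hs hsξ

/-- Strict convexity of `Λ` between its zeros `0` and `ξ`, in the form of Bernoulli's inequality `(1
+ x)^p ≤ 1 + p x` with `p = s / ξ` and `x = A^ξ - 1`, which is strict where `A ≠ 1`. -/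
theorem integral_rpow_lt_one {s : ℝ} (hs : 0 < s) (hsξ : s < ξ) : ∫ y, y.1 ^ s ∂ρ < 1 := by
  have hξ := hρ.xi_pos
  have i1 := hρ.integrable_rpow hs hsξ.le
  have i2 := hρ.integrable_rpow_xi
  have hp0 : 0 < s / ξ := by positivity
  have hp1 : s / ξ < 1 := (div_lt_one hξ).2 hsξ
  set g : ℝ × ℝ × ℝ → ℝ := fun y => 1 + (s / ξ) * (y.1 ^ ξ - 1) - y.1 ^ s with hg
  have ig : Integrable g ρ :=
    ((integrable_const 1).add ((i2.sub (integrable_const 1)).const_mul _)).sub i1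
  have hrw : ∀ y : ℝ × ℝ × ℝ, 0 < y.1 → y.1 ^ s = (1 + (y.1 ^ ξ - 1)) ^ (s / ξ) := fun y hy => by
    rw [add_sub_cancel, ← Real.rpow_mul hy.le, mul_div_cancel₀ _ hξ.ne']
  have hg0 : 0 ≤ᵐ[ρ] g := by
    filter_upwards [hρ.A_pos] with y hy
    have : 0 ≤ y.1 ^ ξ := by positivity
    have := rpow_one_add_le_one_add_mul_self (s := y.1 ^ ξ - 1) (by linarith) hp0.le hp1.le
    simp only [hg, Pi.zero_apply, hrw y hy, sub_nonneg]
    exact this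
  have hgpos : 0 < ∫ y, g y ∂ρ := by
    rw [integral_pos_iff_support_of_nonneg_ae hg0 ig]
    refine hρ.measure_ne_one_pos.trans_le (measure_mono_ae ?_)
    filter_upwards [hρ.A_pos] with y hy hne
    have h1 : 0 ≤ y.1 ^ ξ := by positivity
    have h2 : y.1 ^ ξ - 1 ≠ 0 := fun h => by
      have : y.1 ^ ξ = 1 := by linarith
      exact hne (by rw [← Real.rpow_rpow_inv hy.le hξ.ne', this, Real.one_rpow])
    have := rpow_one_add_lt_one_add_mul_self (s := y.1 ^ ξ - 1) (by linarith) h2 hp0 hp1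
    refine ne_of_gt ?_
    simp only [hg, hrw y hy, sub_pos]
    exact this
  have : ∫ y, g y ∂ρ = 1 - ∫ y, y.1 ^ s ∂ρ := by
    have e1 : ∫ y : ℝ × ℝ × ℝ, (1 + (s / ξ) * (y.1 ^ ξ - 1)) ∂ρ = 1 := by
      have : ∀ y : ℝ × ℝ × ℝ, 1 + (s / ξ) * (y.1 ^ ξ - 1) = (s / ξ) * y.1 ^ ξ + (1 - s / ξ) :=
        fun y => by ring
      simp_rw [this]
      rw [integral_add (i2.const_mul _) (integrable_const _), integral_const_mul,
        hρ.integral_rpow_xi, integral_const, probReal_univ, one_smul]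
      ring
    rw [← e1]
    exact integral_sub ((integrable_const 1).add ((i2.sub (integrable_const 1)).const_mul _)) i1
  linarith

theorem integrable_noise_rpow {s : ℝ} (hs : 0 < s) (hs1 : s ≤ 1) (hsξ : s ≤ ξ) :
    Integrable (fun y => noise y ^ s) ρ := by
  refine Integrable.mono' (((integrable_const 1).add hρ.AD_moment).add
    ((integrable_const 1).add hρ.B_moment)) (measurable_noise.pow_const s).aestronglyMeasurable ?_
  filter_upwards [hρ.A_pos] with y hy
  have hn := noise_nonneg hy
  rw [Real.norm_of_nonneg (by positivity)]
  calc noise y ^ s ≤ (y.1 * |y.2.2|) ^ s + |y.2.1| ^ s :=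
        Real.rpow_add_le_add_rpow (by positivity) (by positivity) hs.le hs1
    _ ≤ _ := add_le_add (rpow_le_one_add_rpow (by positivity) hs hsξ)
        (rpow_le_one_add_rpow (by positivity) hs hsξ)

theorem act_transition_lyapunov_le {s : ℝ} (hs : 0 < s) (hs1 : s ≤ 1) (hsξ : s ≤ ξ) (v : ℝ) :
    act (transition ρ) (fun v => ENNReal.ofReal (1 + |v| ^ s)) v ≤
      ENNReal.ofReal (1 + (∫ y, y.1 ^ s ∂ρ) * |v| ^ s + ∫ y, noise y ^ s ∂ρ) := by
  have i1 := hρ.integrable_rpow hs hsξ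
  have i2 := hρ.integrable_noise_rpow hs hs1 hsξ
  have i3 : Integrable (fun y : ℝ × ℝ × ℝ => 1 + y.1 ^ s * |v| ^ s) ρ :=
    (integrable_const 1).add (i1.mul_const _)
  rw [act_transition ρ (by fun_prop)]
  calc ∫⁻ y, ENNReal.ofReal (1 + |step y v| ^ s) ∂ρ
      ≤ ∫⁻ y, ENNReal.ofReal (1 + y.1 ^ s * |v| ^ s + noise y ^ s) ∂ρ := by
        refine lintegral_mono_ae ?_
        filter_upwards [hρ.A_pos] with y hy
        refine ENNReal.ofReal_le_ofReal ?_
        have h1 : |step y v| ^ s ≤ (y.1 * |v| + noise y) ^ s := by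
          gcongr; exact abs_step_le hy v
        have h2 := Real.rpow_add_le_add_rpow (a := y.1 * |v|) (b := noise y) (by positivity)
          (noise_nonneg hy) hs.le hs1
        rw [Real.mul_rpow hy.le (abs_nonneg v)] at h2
        linarith
    _ = ENNReal.ofReal (∫ y, (1 + y.1 ^ s * |v| ^ s + noise y ^ s) ∂ρ) := by
        refine (ofReal_integral_eq_lintegral_ofReal (i3.add i2) ?_).symm
        filter_upwards [hρ.A_pos] with y hy
        have := noise_nonneg hy
        simp only [Pi.zero_apply, Pi.add_apply]
        positivity
    _ = _ := by
        rw [integral_add i3 i2, integral_add (integrable_const 1) (i1.mul_const _),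
          integral_mul_const, integral_const, probReal_univ, one_smul]

theorem act_transition_lyapunov_le_of_nonpos {s : ℝ} (hs : 0 < s) (hs1 : s ≤ 1) (hsξ : s ≤ ξ)
    {v : ℝ} (hv : v ≤ 0) : act (transition ρ) (fun v => ENNReal.ofReal (1 + |v| ^ s)) v ≤
      ENNReal.ofReal (1 + ∫ y, noise y ^ s ∂ρ) := by
  have i2 := hρ.integrable_noise_rpow hs hs1 hsξ
  rw [act_transition ρ (by fun_prop)]
  calc ∫⁻ y, ENNReal.ofReal (1 + |step y v| ^ s) ∂ρ
      ≤ ∫⁻ y, ENNReal.ofReal (1 + noise y ^ s) ∂ρ := by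
        refine lintegral_mono_ae ?_
        filter_upwards [hρ.A_pos] with y hy
        refine ENNReal.ofReal_le_ofReal ?_
        gcongr
        exact abs_step_le_noise hy hv
    _ = ENNReal.ofReal (∫ y, (1 + noise y ^ s) ∂ρ) := by
        refine (ofReal_integral_eq_lintegral_ofReal ((integrable_const 1).add i2) ?_).symm
        filter_upwards [hρ.A_pos] with y hy
        have := noise_nonneg hy
        simp only [Pi.zero_apply, Pi.add_apply]
        positivity
    _ = _ := by
        rw [integral_add (integrable_const 1) i2, integral_const, probReal_univ, one_smul]

end Hypotheses

/-! ### The killed kernel -/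

section Killed

variable {ρ : Measure (ℝ × ℝ × ℝ)} [IsProbabilityMeasure ρ] {ξ δ : ℝ} {C : Set ℝ}
  {ν : Measure ℝ} [IsProbabilityMeasure ν]

/-- `Q(v, ·) = P(v, ·) - δ 1_C(v) ν`, the kernel of the chain killed at its regenerations. -/
theorem Minorization.exists_killed (hM : Minorization ρ δ C ν) : ∃ Q : Kernel ℝ ℝ,
    ∀ v, transition ρ v = Q v + C.indicator (fun _ => ENNReal.ofReal δ) v • ν := by
  set k : ℝ → ℝ≥0∞ := C.indicator (fun _ => ENNReal.ofReal δ) with hk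
  have hkm : Measurable k := measurable_const.indicator hM.measurableSet
  have hfin : ∀ v, IsFiniteMeasure (k v • ν) := fun v => by
    refine Measure.smul_finite ν ?_
    by_cases hv : v ∈ C <;> simp [hk, hv]
  have hle : ∀ v, k v • ν ≤ transition ρ v := fun v => by
    refine Measure.le_iff.2 fun E hE => ?_
    by_cases hv : v ∈ C
    · simpa [hk, hv] using hM.minorizes v hv E hE
    · simp [hk, hv]
  refine ⟨⟨fun v => transition ρ v - k v • ν, ?_⟩, fun v => ?_⟩
  · refine Measure.measurable_of_measurable_coe _ fun E hE => ?_
    have : ∀ v, (transition ρ v - k v • ν) E = transition ρ v E - k v * ν E := fun v => by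
      rw [Measure.sub_apply hE (hle v), Measure.smul_apply, smul_eq_mul]
    simp_rw [this]
    exact (Kernel.measurable_coe _ hE).sub (hkm.mul_const _)
  · exact (Measure.sub_add_cancel_of_le (hle v)).symm

theorem act_le_act_of_eq_add {P Q : Kernel ℝ ℝ} {k : ℝ → ℝ≥0∞}
    (hPQ : ∀ v, P v = Q v + k v • ν) (f : ℝ → ℝ≥0∞) (v : ℝ) : act Q f v ≤ act P f v := by
  rw [act, act, hPQ, lintegral_add_measure]
  exact le_self_add

theorem exists_potential_lyapunov_le (hρ : Hypotheses ρ ξ) {s : ℝ} (hs : 0 < s) (hs1 : s ≤ 1)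
    (hsξ : s < ξ) {Q : Kernel ℝ ℝ} {k : ℝ → ℝ≥0∞} (hPQ : ∀ v, transition ρ v = Q v + k v • ν)
    {S : Set ℝ} (hK : ∀ K : Set ℝ, IsCompact K → ∃ M : ℝ≥0∞, M ≠ ∞ ∧
      ∀ x ∈ S, potential Q 1 (K.indicator 1) x ≤ M) :
    ∃ c : ℝ, 0 < c ∧ ∀ v ∈ S, potential Q 1 (fun v => ENNReal.ofReal (1 + |v| ^ s)) v ≤
      ENNReal.ofReal (c * (1 + |v| ^ s)) := by
  set lam := ∫ y, y.1 ^ s ∂ρ with hlam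
  set e := ∫ y, noise y ^ s ∂ρ with he
  have hlam1 : lam < 1 := hρ.integral_rpow_lt_one hs hsξ
  have hlam0 : 0 ≤ lam := integral_nonneg_of_ae (by
    filter_upwards [hρ.A_pos] with y hy
    simp only [Pi.zero_apply]
    positivity)
  have he0 : 0 ≤ e := integral_nonneg_of_ae (by
    filter_upwards [hρ.A_pos] with y hy
    have := noise_nonneg hy
    simp only [Pi.zero_apply]
    positivity)
  -- The rate `l` lies midway between `lam` and `1`, and `R` solves `(l - lam) R^s = 1 + e`: outside
  -- the ball the additive constant is absorbed by the contraction.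
  set l := (1 + lam) / 2 with hl
  have hl1 : l < 1 := by linarith
  have hlpos : 0 < l - lam := by rw [hl]; linarith
  set R := ((1 + e) / (l - lam)) ^ s⁻¹ with hR
  have hR0 : 0 ≤ R := by positivity
  obtain ⟨M, hM, hKM⟩ := hK (Metric.closedBall 0 R) (isCompact_closedBall 0 R)
  have hdrift : ∀ v, act Q (fun v => ENNReal.ofReal (1 + |v| ^ s)) v
      ≤ ENNReal.ofReal l * ENNReal.ofReal (1 + |v| ^ s)
        + ENNReal.ofReal (1 + e) * (Metric.closedBall (0 : ℝ) R).indicator 1 v := by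
    intro v
    refine (act_le_act_of_eq_add hPQ _ v).trans
      ((hρ.act_transition_lyapunov_le hs hs1 hsξ.le v).trans ?_)
    have hv0 : 0 ≤ |v| ^ s := by positivity
    have hl0 : 0 ≤ l := by positivity
    by_cases hv : v ∈ Metric.closedBall (0 : ℝ) R
    · simp only [hv, Set.indicator_of_mem, Pi.one_apply, mul_one]
      rw [← ENNReal.ofReal_mul hl0, ← ENNReal.ofReal_add (by positivity) (by positivity)]
      refine ENNReal.ofReal_le_ofReal ?_
      nlinarith
    · simp only [hv, not_false_eq_true, Set.indicator_of_notMem, mul_zero, add_zero]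
      rw [← ENNReal.ofReal_mul hl0]
      refine ENNReal.ofReal_le_ofReal ?_
      have h1 : R < |v| := by simpa using hv
      have h2 : (1 + e) / (l - lam) ≤ |v| ^ s := by
        have : R ^ s ≤ |v| ^ s := by gcongr
        rwa [hR, ← Real.rpow_mul (by positivity), inv_mul_cancel₀ hs.ne', Real.rpow_one] at this
      rw [div_le_iff₀ hlpos] at h2
      nlinarith
  refine ⟨(1 - l)⁻¹ * (1 + (1 + e) * M.toReal), ?_, fun v hv => ?_⟩
  · have : 0 < 1 - l := by linarith
    positivity
  · have h1 : 0 < 1 - l := by linarith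
    refine (potential_le_of_drift (l := ENNReal.ofReal l) (by simpa using hl1) (by fun_prop)
      (measurable_one.indicator Metric.isClosed_closedBall.measurableSet) hdrift v).trans ?_
    have h2 : 1 - ENNReal.ofReal l = ENNReal.ofReal (1 - l) := by
      rw [ENNReal.ofReal_sub _ (by positivity), ENNReal.ofReal_one]
    calc _ ≤ (1 - ENNReal.ofReal l)⁻¹ *
          (ENNReal.ofReal (1 + |v| ^ s) + ENNReal.ofReal (1 + e) * M) := by
          gcongr
          exact hKM v hv
      _ = ENNReal.ofReal ((1 - l)⁻¹ * ((1 + |v| ^ s) + (1 + e) * M.toReal)) := by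
          rw [h2, ← ENNReal.ofReal_inv_of_pos h1, ENNReal.ofReal_mul (by positivity),
            ENNReal.ofReal_add (p := 1 + |v| ^ s) (by positivity) (by positivity),
            ENNReal.ofReal_mul (p := 1 + e) (by positivity), ENNReal.ofReal_toReal hM]
      _ ≤ _ := by
          refine ENNReal.ofReal_le_ofReal ?_
          rw [mul_assoc]
          gcongr
          have : 0 ≤ |v| ^ s := by positivity
          have : 0 ≤ (1 + e) * M.toReal := by positivity
          nlinarith

/-- The expected number of exceedances of a high level, from below a lower level. -/
theorem exists_potential_Ioi_le (hρ : Hypotheses ρ ξ) {s : ℝ} (hs : 0 < s) (hs1 : s ≤ 1)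
    (hsξ : s < ξ) {Q : Kernel ℝ ℝ} {k : ℝ → ℝ≥0∞} (hPQ : ∀ v, transition ρ v = Q v + k v • ν)
    {S : Set ℝ} (hS : ∀ x ∈ S, transition ρ x Sᶜ = 0)
    (hK : ∀ K : Set ℝ, IsCompact K → ∃ M : ℝ≥0∞, M ≠ ∞ ∧
      ∀ x ∈ S, potential Q 1 (K.indicator 1) x ≤ M) :
    ∃ c : ℝ, 0 < c ∧ ∀ u w : ℝ, 0 < u → 0 ≤ w → ∀ v ∈ S, v ≤ w →
      potential Q 1 ((Set.Ioi u).indicator 1) v ≤ ENNReal.ofReal (c * (1 + w ^ s) * u ^ (-s)) := by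
  obtain ⟨c, hc, hbd⟩ := exists_potential_lyapunov_le hρ hs hs1 hsξ hPQ hK
  set e := ∫ y, noise y ^ s ∂ρ with he
  have he0 : 0 ≤ e := integral_nonneg_of_ae (by
    filter_upwards [hρ.A_pos] with y hy
    have := noise_nonneg hy
    simp only [Pi.zero_apply]
    positivity)
  refine ⟨c * (1 + e), by positivity, fun u w hu hw v hv hvw => ?_⟩
  have hWm : Measurable fun v : ℝ => ENNReal.ofReal (1 + |v| ^ s) := by fun_prop
  have hind : Measurable ((Set.Ioi u).indicator (1 : ℝ → ℝ≥0∞)) :=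
    measurable_one.indicator measurableSet_Ioi
  -- Markov's inequality: for `v > u` one has `1 ≤ u^{-s} (1 + |v|^s)`.
  have h1 : ∀ v ∈ S, potential Q 1 ((Set.Ioi u).indicator 1) v
      ≤ ENNReal.ofReal (u ^ (-s) * c) * ENNReal.ofReal (1 + |v| ^ s) := by
    intro v hv
    calc potential Q 1 ((Set.Ioi u).indicator 1) v
        ≤ potential Q 1 (fun v => ENNReal.ofReal (u ^ (-s)) * ENNReal.ofReal (1 + |v| ^ s)) v := by
          refine potential_mono (hWm.const_mul _) (fun v => ?_) v
          by_cases h : v ∈ Set.Ioi u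
          · simp only [h, Set.indicator_of_mem, Pi.one_apply]
            rw [← ENNReal.ofReal_mul (by positivity), ENNReal.one_le_ofReal]
            have hv0 : 0 < v := hu.trans h
            have h2 : u ^ s ≤ |v| ^ s := by
              rw [abs_of_pos hv0]; gcongr; exact (Set.mem_Ioi.1 h).le
            calc (1 : ℝ) = u ^ (-s) * u ^ s := by
                  rw [← Real.rpow_add hu, neg_add_cancel, Real.rpow_zero]
              _ ≤ u ^ (-s) * (1 + |v| ^ s) := by gcongr; linarith
          · simp [h]
      _ ≤ ENNReal.ofReal (u ^ (-s)) * potential Q 1 (fun v => ENNReal.ofReal (1 + |v| ^ s)) v :=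
          potential_const_mul_le _ hWm v
      _ ≤ ENNReal.ofReal (u ^ (-s)) * ENNReal.ofReal (c * (1 + |v| ^ s)) := by
          gcongr; exact hbd v hv
      _ = _ := by
          rw [ENNReal.ofReal_mul hc.le, ENNReal.ofReal_mul (by positivity), mul_assoc]
  rcases lt_or_ge 0 v with h0 | h0
  · refine (h1 v hv).trans ?_
    rw [← ENNReal.ofReal_mul (by positivity)]
    refine ENNReal.ofReal_le_ofReal ?_
    have h2 : |v| ^ s ≤ w ^ s := by rw [abs_of_pos h0]; gcongr
    have h3 : 0 ≤ w ^ s := by positivity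
    calc u ^ (-s) * c * (1 + |v| ^ s) ≤ u ^ (-s) * c * ((1 + e) * (1 + w ^ s)) := by
          gcongr
          nlinarith
      _ = _ := by ring
  -- Here `|v|` may be much larger than `w`; after one step only the noise remains.
  · rw [potential_eq hind, Set.indicator_of_notMem (by simpa using h0.trans hu.le), zero_add,
      one_mul]
    have hae : ∀ᵐ x ∂transition ρ v, x ∈ S := ae_iff.2 (hS v hv)
    calc act Q (potential Q 1 ((Set.Ioi u).indicator 1)) v
        ≤ act (transition ρ) (potential Q 1 ((Set.Ioi u).indicator 1)) v :=
          act_le_act_of_eq_add hPQ _ v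
      _ ≤ act (transition ρ)
          (fun v => ENNReal.ofReal (u ^ (-s) * c) * ENNReal.ofReal (1 + |v| ^ s)) v :=
          lintegral_mono_ae (hae.mono h1)
      _ = ENNReal.ofReal (u ^ (-s) * c)
          * act (transition ρ) (fun v => ENNReal.ofReal (1 + |v| ^ s)) v := act_const_mul _ hWm v
      _ ≤ ENNReal.ofReal (u ^ (-s) * c) * ENNReal.ofReal (1 + e) := by
          gcongr
          exact hρ.act_transition_lyapunov_le_of_nonpos hs hs1 hsξ.le h0
      _ ≤ _ := by
          rw [← ENNReal.ofReal_mul (by positivity)]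
          refine ENNReal.ofReal_le_ofReal ?_
          have h3 : 0 ≤ w ^ s := by positivity
          calc u ^ (-s) * c * (1 + e) = u ^ (-s) * c * (1 + e) * 1 := by ring
            _ ≤ u ^ (-s) * c * (1 + e) * (1 + w ^ s) := by gcongr; linarith
            _ = _ := by ring

end Killed

end

end Letac

namespace Letac

noncomputable section

/-! ### Domination by a random walk above a high level -/

/-- The increment of a random walk that dominates `log V_n` above the level `w`. -/
def logStep (w : ℝ) (y : ℝ × ℝ × ℝ) : ℝ := Real.log (max (y.1 + noise y / w) (1 / w))

theorem measurable_logStep (w : ℝ) : Measurable (logStep w) := by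
  have := measurable_noise
  unfold logStep
  fun_prop

/-- The floor `1 / w` in `logStep` keeps the increments square integrable without any moment
assumption on the negative part of `log A`. -/
theorem neg_log_le_logStep {w : ℝ} (hw : 0 < w) (y : ℝ × ℝ × ℝ) : -Real.log w ≤ logStep w y := by
  rw [← Real.log_inv, ← one_div]
  exact Real.log_le_log (by positivity) (le_max_right _ _)

theorem log_le_logStep {w : ℝ} (hw : 0 < w) {y : ℝ × ℝ × ℝ} (hy : 0 < y.1) :
    Real.log y.1 ≤ logStep w y := by
  have := noise_nonneg hy
  refine Real.log_le_log hy (le_max_of_le_left ?_)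
  have : 0 ≤ noise y / w := by positivity
  linarith

/-- The bound is independent of `w`. The exponent is `s / 2` so that its square involves only
moments of order `s`. -/
theorem logStep_le {w : ℝ} (hw : 1 ≤ w) {s : ℝ} (hs : 0 < s) {y : ℝ × ℝ × ℝ} (hy : 0 < y.1) :
    logStep w y ≤ (y.1 + noise y) ^ (s / 2) / (s / 2) := by
  have hn := noise_nonneg hy
  have hw0 : 0 < w := by linarith
  have h1 : logStep w y ≤ Real.log (max (y.1 + noise y) 1) := by
    refine Real.log_le_log (lt_max_of_lt_right (by positivity)) (max_le_max ?_ ?_)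
    · have := div_le_self hn hw
      linarith
    · exact (div_le_one hw0).2 hw
  refine h1.trans ?_
  rcases le_total (y.1 + noise y) 1 with h | h
  · rw [max_eq_right h, Real.log_one]
    positivity
  · rw [max_eq_left h]
    exact Real.log_le_rpow_div (by positivity) (by positivity)

theorem log_step_div_le {u v w : ℝ} (hu : 0 < u) (hw : 0 < w) (hv : w < v) {y : ℝ × ℝ × ℝ}
    (hy : 0 < y.1) (hs : 0 < step y v) :
    Real.log (step y v / u) ≤ Real.log (v / u) + logStep w y := by
  have hn := noise_nonneg hy
  have hv0 : 0 < v := hw.trans hv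
  have hm : 0 < max (y.1 + noise y / w) (1 / w) := lt_max_of_lt_right (by positivity)
  rw [logStep, ← Real.log_mul (by positivity) hm.ne']
  refine Real.log_le_log (by positivity) ?_
  have h1 : step y v ≤ y.1 * v + noise y := by
    have := abs_step_le hy v
    rw [abs_of_pos hv0] at this
    exact (le_abs_self _).trans this
  have h2 : noise y ≤ v * (noise y / w) := by
    rw [mul_div_assoc', le_div_iff₀ hw, mul_comm]
    gcongr
  calc step y v / u ≤ v * (y.1 + noise y / w) / u := by gcongr; nlinarith
    _ = v / u * (y.1 + noise y / w) := by ring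
    _ ≤ _ := by gcongr; exact le_max_left _ _

section Domination

variable {ρ : Measure (ℝ × ℝ × ℝ)} [IsProbabilityMeasure ρ] {ξ : ℝ}
  {ν : Measure ℝ} [IsProbabilityMeasure ν]

instance isProbabilityMeasure_map_logStep (w : ℝ) : IsProbabilityMeasure (ρ.map (logStep w)) :=
  Measure.isProbabilityMeasure_map (measurable_logStep w).aemeasurable

/-- As long as the chain stays above `w`, the walk dominates it. When it first falls to `w` or
below, all that is still to come costs at most `b`, so `b` is paid only once. -/
theorem partialPotential_Ioi_le (hρ : Hypotheses ρ ξ) {Q : Kernel ℝ ℝ} {k : ℝ → ℝ≥0∞}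
    (hPQ : ∀ v, transition ρ v = Q v + k v • ν) {S : Set ℝ}
    (hS : ∀ x ∈ S, transition ρ x Sᶜ = 0) {u w : ℝ} (hu : 0 < u) (hw : 0 < w) {b : ℝ≥0∞}
    (hb : ∀ v ∈ S, v ≤ w → potential Q 1 ((Set.Ioi u).indicator 1) v ≤ b) (n : ℕ) {v : ℝ}
    (hvS : v ∈ S) (hv : w < v) :
    partialPotential Q 1 ((Set.Ioi u).indicator 1) n v ≤
      walkCount (ρ.map (logStep w)) n (Real.log (v / u)) + b := by
  induction n generalizing v with
  | zero => exact zero_le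
  | succ n ih =>
    have hv0 : 0 < v := hw.trans hv
    have hind : Measurable ((Set.Ioi u).indicator (1 : ℝ → ℝ≥0∞)) :=
      measurable_one.indicator measurableSet_Ioi
    have h1 : (Set.Ioi u).indicator (1 : ℝ → ℝ≥0∞) v ≤
        if 0 ≤ Real.log (v / u) then 1 else 0 := by
      by_cases h : v ∈ Set.Ioi u
      · rw [if_pos (Real.log_nonneg ((one_le_div hu).2 (Set.mem_Ioi.1 h).le))]
        simp [h]
      · simp [h]
    have hstep : ∀ᵐ y ∂ρ, step y v ∈ S :=
      ae_of_ae_map (measurable_step.comp measurable_prodMk_left).aemeasurable (ae_iff.2 (hS v hvS))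
    have h2 : act Q (partialPotential Q 1 ((Set.Ioi u).indicator 1) n) v ≤
        (∫⁻ x, walkCount (ρ.map (logStep w)) n (Real.log (v / u) + x) ∂ρ.map (logStep w)) + b := by
      calc act Q (partialPotential Q 1 ((Set.Ioi u).indicator 1) n) v
          ≤ act (transition ρ) (partialPotential Q 1 ((Set.Ioi u).indicator 1) n) v :=
            act_le_act_of_eq_add hPQ _ v
        _ = ∫⁻ y, partialPotential Q 1 ((Set.Ioi u).indicator 1) n (step y v) ∂ρ :=
            act_transition ρ (measurable_partialPotential hind n) v
        _ ≤ ∫⁻ y, (walkCount (ρ.map (logStep w)) n (Real.log (v / u) + logStep w y) + b) ∂ρ := by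
            refine lintegral_mono_ae ?_
            filter_upwards [hstep, hρ.A_pos] with y hyS hy
            rcases le_or_gt (step y v) w with h | h
            · exact ((partialPotential_le_potential n _).trans (hb _ hyS h)).trans le_add_self
            · refine (ih hyS h).trans ?_
              gcongr
              exact walkCount_mono _ n (log_step_div_le hu hw hv hy (hw.trans h))
        _ = _ := by
            have hm := measurable_walkCount (ρ.map (logStep w)) n
            rw [lintegral_add_right _ measurable_const,
              lintegral_map (by fun_prop) (measurable_logStep w)]
            simp
    simp only [partialPotential, walkCount, one_mul]
    rw [add_assoc]
    exact add_le_add h1 h2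

end Domination

/-! ### Moments and limits of the dominating increments -/

namespace Hypotheses

variable {ρ : Measure (ℝ × ℝ × ℝ)} [IsProbabilityMeasure ρ] {ξ : ℝ} (hρ : Hypotheses ρ ξ)

include hρ

theorem memLp_log_bound {s : ℝ} (hs : 0 < s) (hs1 : s ≤ 1) (hsξ : s ≤ ξ) :
    MemLp (fun y : ℝ × ℝ × ℝ => (y.1 + noise y) ^ (s / 2) / (s / 2)) 2 ρ := by
  have hm := measurable_noise
  have hmeas : Measurable (fun y : ℝ × ℝ × ℝ => (y.1 + noise y) ^ (s / 2) / (s / 2)) := by fun_prop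
  rw [memLp_two_iff_integrable_sq hmeas.aestronglyMeasurable]
  refine Integrable.mono' (((hρ.integrable_rpow hs hsξ).add
    (hρ.integrable_noise_rpow hs hs1 hsξ)).div_const ((s / 2) ^ 2))
    (hmeas.pow_const 2).aestronglyMeasurable ?_
  filter_upwards [hρ.A_pos] with y hy
  have hn := noise_nonneg hy
  rw [Real.norm_of_nonneg (sq_nonneg _), div_pow, ← Real.rpow_natCast,
    ← Real.rpow_mul (by positivity)]
  have : s / 2 * (2 : ℕ) = s := by push_cast; ring
  rw [this]
  simp only [Pi.add_apply]
  gcongr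
  exact Real.rpow_add_le_add_rpow hy.le hn hs.le hs1

/-- The term `log w` of the minimum gives square integrability at fixed `w`; the term `|log A|`
gives a dominating function as `w → ∞`. -/
theorem abs_logStep_le {w : ℝ} (hw : 1 ≤ w) {s : ℝ} (hs : 0 < s) : ∀ᵐ y ∂ρ,
    |logStep w y| ≤ min (Real.log w) |Real.log y.1| + (y.1 + noise y) ^ (s / 2) / (s / 2) := by
  filter_upwards [hρ.A_pos] with y hy
  have hw0 : 0 < w := by linarith
  have hn := noise_nonneg hy
  have h1 := neg_log_le_logStep hw0 y
  have h2 := log_le_logStep hw0 hy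
  have h3 := logStep_le hw hs hy
  have h4 : 0 ≤ (y.1 + noise y) ^ (s / 2) / (s / 2) := by positivity
  have h5 : 0 ≤ min (Real.log w) |Real.log y.1| := le_min (Real.log_nonneg hw) (abs_nonneg _)
  have h6 : -min (Real.log w) |Real.log y.1| ≤ logStep w y := by
    rcases min_choice (Real.log w) |Real.log y.1| with h | h <;> rw [h]
    · exact h1
    · exact (neg_abs_le _).trans h2
  exact abs_le.2 ⟨by linarith, by linarith⟩

theorem memLp_logStep {w : ℝ} (hw : 1 ≤ w) {s : ℝ} (hs : 0 < s) (hs1 : s ≤ 1) (hsξ : s ≤ ξ) :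
    MemLp (logStep w) 2 ρ := by
  refine MemLp.mono' ((memLp_const (Real.log w)).add (hρ.memLp_log_bound hs hs1 hsξ))
    (measurable_logStep w).aestronglyMeasurable ?_
  filter_upwards [hρ.abs_logStep_le hw hs] with y hy
  rw [Real.norm_eq_abs]
  refine hy.trans ?_
  simp only [Pi.add_apply]
  gcongr
  exact min_le_left _ _

/-- From `s log x ≤ x^s - 1` and subadditivity of `x^s`. The bound tends to `(E[A^s] - 1) / s < 0`,
so the walk has negative drift at high levels even if `log A` is not integrable. -/
theorem integral_logStep_le {w : ℝ} (hw : 1 ≤ w) {s : ℝ} (hs : 0 < s) (hs1 : s ≤ 1)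
    (hsξ : s ≤ ξ) : ∫ y, logStep w y ∂ρ ≤
      (∫ y, y.1 ^ s ∂ρ + (∫ y, noise y ^ s ∂ρ + 1) * w ^ (-s) - 1) / s := by
  have hw0 : 0 < w := by linarith
  have i1 := hρ.integrable_rpow hs hsξ
  have i2 := hρ.integrable_noise_rpow hs hs1 hsξ
  have i3 : Integrable (fun y => (noise y ^ s + 1) * w ^ (-s) - 1) ρ :=
    ((i2.add (integrable_const 1)).mul_const _).sub (integrable_const 1)
  have hle : ∫ y, logStep w y ∂ρ
      ≤ ∫ y, (y.1 ^ s + ((noise y ^ s + 1) * w ^ (-s) - 1)) / s ∂ρ := by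
    refine integral_mono_ae ((hρ.memLp_logStep hw hs hs1 hsξ).integrable one_le_two)
      ((i1.add i3).div_const s) ?_
    filter_upwards [hρ.A_pos] with y hy
    have hn := noise_nonneg hy
    have hm : 0 < max (y.1 + noise y / w) (1 / w) := lt_max_of_lt_right (by positivity)
    rw [le_div_iff₀ hs, mul_comm]
    have h1 : s * logStep w y = Real.log (max (y.1 + noise y / w) (1 / w) ^ s) := by
      rw [logStep, Real.log_rpow hm]
    have h2 := Real.log_le_sub_one_of_pos (Real.rpow_pos_of_pos hm s)
    have h3 : max (y.1 + noise y / w) (1 / w) ^ s ≤ y.1 ^ s + (noise y ^ s + 1) * w ^ (-s) := by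
      have e1 : (noise y / w) ^ s = noise y ^ s * w ^ (-s) := by
        rw [Real.div_rpow hn hw0.le, Real.rpow_neg hw0.le, div_eq_mul_inv]
      have e2 : (1 / w) ^ s = w ^ (-s) := by
        rw [Real.div_rpow zero_le_one hw0.le, Real.rpow_neg hw0.le, Real.one_rpow, one_div]
      have e3 := Real.rpow_add_le_add_rpow hy.le (show 0 ≤ noise y / w by positivity) hs.le hs1
      have e4 : 0 ≤ y.1 ^ s := by positivity
      have e5 : 0 ≤ noise y ^ s * w ^ (-s) := by positivity
      have e6 : 0 ≤ w ^ (-s) := by positivity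
      rcases max_choice (y.1 + noise y / w) (1 / w) with h | h <;> rw [h]
      · rw [e1] at e3; linarith
      · rw [e2]; linarith
    rw [h1]
    linarith
  refine hle.trans (le_of_eq ?_)
  have h1 : ∫ y, (noise y ^ s + 1) ∂ρ = ∫ y, noise y ^ s ∂ρ + 1 := by
    rw [integral_add i2 (integrable_const 1)]; simp
  have hi : Integrable (fun y => (noise y ^ s + 1) * w ^ (-s)) ρ :=
    (i2.add (integrable_const 1)).mul_const _
  have h2 : ∫ y, ((noise y ^ s + 1) * w ^ (-s) - 1) ∂ρ
      = (∫ y, noise y ^ s ∂ρ + 1) * w ^ (-s) - 1 := by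
    rw [integral_sub hi (integrable_const 1), integral_mul_const, h1]; simp
  rw [integral_div, integral_add i1 i3, h2]
  ring

theorem eventually_integral_logStep_neg {s : ℝ} (hs : 0 < s) (hs1 : s ≤ 1) (hsξ : s < ξ) :
    ∀ᶠ w in atTop, ∫ y, logStep w y ∂ρ < 0 := by
  have hlam := hρ.integral_rpow_lt_one hs hsξ
  have h1 : Tendsto (fun w : ℝ => (∫ y, y.1 ^ s ∂ρ + (∫ y, noise y ^ s ∂ρ + 1) * w ^ (-s) - 1) / s)
      atTop (𝓝 ((∫ y, y.1 ^ s ∂ρ + (∫ y, noise y ^ s ∂ρ + 1) * 0 - 1) / s)) :=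
    (((tendsto_rpow_neg_atTop hs).const_mul _).const_add _ |>.sub_const 1).div_const s
  have h2 : (∫ y, y.1 ^ s ∂ρ + (∫ y, noise y ^ s ∂ρ + 1) * 0 - 1) / s < 0 :=
    div_neg_of_neg_of_pos (by linarith) hs
  filter_upwards [h1.eventually_lt_const h2, eventually_ge_atTop 1] with w hw hw1
  exact (hρ.integral_logStep_le hw1 hs hs1 hsξ.le).trans_lt hw

theorem tendsto_logStep : ∀ᵐ y ∂ρ, Tendsto (fun w => logStep w y) atTop (𝓝 (Real.log y.1)) := by
  filter_upwards [hρ.A_pos] with y hy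
  have h1 : Tendsto (fun w : ℝ => max (y.1 + noise y / w) (1 / w)) atTop (𝓝 (max (y.1 + 0) 0)) :=
    ((tendsto_const_nhds.div_atTop tendsto_id).const_add _).max
      (tendsto_const_nhds.div_atTop tendsto_id)
  rw [add_zero, max_eq_left hy.le] at h1
  exact h1.log hy.ne'

theorem tendsto_integral_logStep {s : ℝ} (hs : 0 < s) (hs1 : s ≤ 1) (hsξ : s ≤ ξ)
    (hint : Integrable (fun y : ℝ × ℝ × ℝ => Real.log y.1) ρ) :
    Tendsto (fun w => ∫ y, logStep w y ∂ρ) atTop (𝓝 (∫ y, Real.log y.1 ∂ρ)) := by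
  refine tendsto_integral_filter_of_dominated_convergence _
    (Eventually.of_forall fun w => (measurable_logStep w).aestronglyMeasurable) ?_
    (hint.abs.add ((hρ.memLp_log_bound hs hs1 hsξ).integrable one_le_two)) hρ.tendsto_logStep
  filter_upwards [eventually_ge_atTop 1] with w hw
  filter_upwards [hρ.abs_logStep_le hw hs] with y hy
  rw [Real.norm_eq_abs]
  refine hy.trans ?_
  simp only [Pi.add_apply]
  gcongr
  exact min_le_right _ _

theorem tendsto_integral_logStep_sq {s : ℝ} (hs : 0 < s) (hs1 : s ≤ 1) (hsξ : s ≤ ξ)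
    (hint : MemLp (fun y : ℝ × ℝ × ℝ => Real.log y.1) 2 ρ) :
    Tendsto (fun w => ∫ y, logStep w y ^ 2 ∂ρ) atTop (𝓝 (∫ y, Real.log y.1 ^ 2 ∂ρ)) := by
  refine tendsto_integral_filter_of_dominated_convergence _
    (Eventually.of_forall fun w => ((measurable_logStep w).pow_const 2).aestronglyMeasurable) ?_
    (hint.abs.add (hρ.memLp_log_bound hs hs1 hsξ)).integrable_sq
    (hρ.tendsto_logStep.mono fun y hy => hy.pow 2)
  filter_upwards [eventually_ge_atTop 1] with w hw
  filter_upwards [hρ.abs_logStep_le hw hs] with y hy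
  rw [Real.norm_of_nonneg (sq_nonneg _), ← sq_abs]
  simp only [Pi.add_apply]
  gcongr
  refine hy.trans ?_
  gcongr
  exact min_le_right _ _

theorem integral_log_neg {s : ℝ} (hs : 0 < s) (hsξ : s < ξ)
    (hint : Integrable (fun y : ℝ × ℝ × ℝ => Real.log y.1) ρ) : ∫ y, Real.log y.1 ∂ρ < 0 := by
  have hlam := hρ.integral_rpow_lt_one hs hsξ
  have i1 := hρ.integrable_rpow hs hsξ.le
  have hle : s * ∫ y, Real.log y.1 ∂ρ ≤ ∫ y, (y.1 ^ s - 1) ∂ρ := by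
    rw [← integral_const_mul]
    refine integral_mono_ae (hint.const_mul s) (i1.sub (integrable_const 1)) ?_
    filter_upwards [hρ.A_pos] with y hy
    rw [← Real.log_rpow hy]
    exact Real.log_le_sub_one_of_pos (by positivity)
  rw [integral_sub i1 (integrable_const 1)] at hle
  simp only [integral_const, probReal_univ, one_smul] at hle
  nlinarith

end Hypotheses

end

end Letac

namespace Letac

noncomputable section

/-! ### The constants at each level -/

/-- Minus the mean increment of the dominating walk at the level `w`. -/
def stepDrift (ρ : Measure (ℝ × ℝ × ℝ)) (w : ℝ) : ℝ := -∫ y, logStep w y ∂ρ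

/-- The overshoot constant of the dominating walk at the level `w`. -/
def stepOvershoot (ρ : Measure (ℝ × ℝ × ℝ)) (w : ℝ) : ℝ :=
  (∫ y, logStep w y ^ 2 ∂ρ) / stepDrift ρ w ^ 2

section

variable {ρ : Measure (ℝ × ℝ × ℝ)} [IsProbabilityMeasure ρ] {ξ : ℝ}
  {ν : Measure ℝ} [IsProbabilityMeasure ν]

theorem stepOvershoot_nonneg (w : ℝ) : 0 ≤ stepOvershoot ρ w :=
  div_nonneg (integral_nonneg fun _ => sq_nonneg _) (sq_nonneg _)

theorem Hypotheses.walkCount_logStep_le (hρ : Hypotheses ρ ξ) {s : ℝ} (hs : 0 < s) (hs1 : s ≤ 1)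
    (hsξ : s ≤ ξ) {w : ℝ} (hw : 1 ≤ w) (hm : 0 < stepDrift ρ w) (n : ℕ) {z : ℝ} (hz : 0 ≤ z) :
    walkCount (ρ.map (logStep w)) n z
      ≤ ENNReal.ofReal (1 / stepDrift ρ w * z + stepOvershoot ρ w) := by
  have hmeas := measurable_logStep w
  have e1 : ∫ x, x ∂(ρ.map (logStep w)) = -stepDrift ρ w := by
    rw [stepDrift, neg_neg, integral_map hmeas.aemeasurable (by fun_prop)]
  have e2 : ∫ x, x ^ 2 ∂(ρ.map (logStep w)) = ∫ y, logStep w y ^ 2 ∂ρ := by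
    rw [integral_map hmeas.aemeasurable (by fun_prop)]
  have hL : MemLp (fun x : ℝ => x) 2 (ρ.map (logStep w)) :=
    (memLp_map_measure_iff (by fun_prop) hmeas.aemeasurable).2 (hρ.memLp_logStep hw hs hs1 hsξ)
  have h := walkCount_le (ρ.map (logStep w)) hL (by rw [e1]; linarith) n hz
  rw [e1, e2, neg_neg, neg_sq] at h
  rwa [one_div_mul_eq_div]

theorem Hypotheses.potential_Ioi_le (hρ : Hypotheses ρ ξ) {s : ℝ} (hs : 0 < s) (hs1 : s ≤ 1)
    (hsξ : s ≤ ξ) {Q : Kernel ℝ ℝ} {k : ℝ → ℝ≥0∞}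
    (hPQ : ∀ v, transition ρ v = Q v + k v • ν) {S : Set ℝ}
    (hS : ∀ x ∈ S, transition ρ x Sᶜ = 0) {u w : ℝ} (hw : 1 ≤ w) (hwu : w ≤ u)
    (hm : 0 < stepDrift ρ w) {b : ℝ} (hb0 : 0 ≤ b)
    (hb : ∀ v ∈ S, v ≤ w → potential Q 1 ((Set.Ioi u).indicator 1) v ≤ ENNReal.ofReal b)
    {v : ℝ} (hvS : v ∈ S) (hv : u < v) :
    potential Q 1 ((Set.Ioi u).indicator 1) v ≤
      ENNReal.ofReal (1 / stepDrift ρ w * Real.log (v / u) + (stepOvershoot ρ w + b)) := by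
  have hw0 : 0 < w := by linarith
  have hu0 : 0 < u := by linarith
  have hlog : 0 ≤ Real.log (v / u) := Real.log_nonneg ((one_le_div hu0).2 hv.le)
  refine iSup_le fun n => (partialPotential_Ioi_le hρ hPQ hS hu0 hw0 hb n hvS
    (hwu.trans_lt hv)).trans ?_
  rw [← add_assoc, ENNReal.ofReal_add (add_nonneg (by positivity) (stepOvershoot_nonneg w)) hb0]
  gcongr
  exact hρ.walkCount_logStep_le hs hs1 hsξ hw hm n hlog

theorem Hypotheses.tendsto_stepDrift (hρ : Hypotheses ρ ξ) {s : ℝ} (hs : 0 < s) (hs1 : s ≤ 1)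
    (hsξ : s ≤ ξ) (hint : Integrable (fun y : ℝ × ℝ × ℝ => Real.log y.1) ρ) :
    Tendsto (stepDrift ρ) atTop (𝓝 (drift ρ)) :=
  (hρ.tendsto_integral_logStep hs hs1 hsξ hint).neg

theorem Hypotheses.tendsto_stepOvershoot (hρ : Hypotheses ρ ξ) {s : ℝ} (hs : 0 < s) (hs1 : s ≤ 1)
    (hsξ : s < ξ) (hint : MemLp (fun y : ℝ × ℝ × ℝ => Real.log y.1) 2 ρ) :
    Tendsto (stepOvershoot ρ) atTop (𝓝 (1 + logVariance ρ / drift ρ ^ 2)) := by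
  have hi := hint.integrable one_le_two
  have hneg := hρ.integral_log_neg hs hsξ hi
  have hm : drift ρ ^ 2 ≠ 0 := pow_ne_zero _ (by rw [drift]; linarith)
  have he : 1 + logVariance ρ / drift ρ ^ 2 = (∫ y, Real.log y.1 ^ 2 ∂ρ) / drift ρ ^ 2 := by
    rw [eq_div_iff hm, add_mul, div_mul_cancel₀ _ hm, logVariance, variance_eq_sub hint, drift]
    simp only [Pi.pow_apply]
    ring
  rw [he]
  exact (hρ.tendsto_integral_logStep_sq hs hs1 hsξ.le hint).div
    ((hρ.tendsto_stepDrift hs hs1 hsξ.le hi).pow 2) hm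

/-- The constants of the theorem, in terms of the potential of the killed chain. -/
theorem Hypotheses.exists_level_constants (hρ : Hypotheses ρ ξ) {Q : Kernel ℝ ℝ} {k : ℝ → ℝ≥0∞}
    (hPQ : ∀ v, transition ρ v = Q v + k v • ν) {S C : Set ℝ}
    (hS : ∀ x ∈ S, transition ρ x Sᶜ = 0)
    (hK : ∀ K : Set ℝ, IsCompact K → ∃ M : ℝ≥0∞, M ≠ ∞ ∧
      ∀ x ∈ S, potential Q 1 (K.indicator 1) x ≤ M)
    (hC : Bornology.IsBounded C) {a : ℝ} (ha : 1 ≤ a) :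
    ∃ C₁ C₂ : ℝ → ℝ,
      (∀ u : ℝ, 0 < u → 0 < C₁ u ∧ 0 < C₂ u) ∧
      (∀ u : ℝ, 0 < u → ∀ v ∈ S, u < v → C.indicator (fun _ => ENNReal.ofReal (a - 1)) v *
        potential Q 1 ((Set.Ioi u).indicator 1) v + potential Q 1 ((Set.Ioi u).indicator 1) v
          ≤ ENNReal.ofReal (C₁ u * Real.log (v / u) + C₂ u)) ∧
      (Integrable (fun y : ℝ × ℝ × ℝ => Real.log y.1) ρ → Tendsto C₁ atTop (𝓝 (1 / drift ρ))) ∧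
      (MemLp (fun y : ℝ × ℝ × ℝ => Real.log y.1) 2 ρ →
        Tendsto C₂ atTop (𝓝 (1 + logVariance ρ / drift ρ ^ 2))) := by
  have hξ := hρ.xi_pos
  obtain ⟨s, hs, hs1, hsξ⟩ : ∃ s, 0 < s ∧ s ≤ 1 ∧ s < ξ :=
    ⟨min 1 (ξ / 2), lt_min one_pos (by linarith), min_le_left _ _,
      (min_le_right _ _).trans_lt (by linarith)⟩
  obtain ⟨c, hc, hbd⟩ := exists_potential_Ioi_le hρ hs hs1 hsξ hPQ hS hK
  -- The dominating walk is run above `√u`: this level tends to infinity, so the increments converge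
  -- to `log A`, yet it is so far below `u` that the cost `b u` of a return is of order `u^{-s/2}`.
  set b : ℝ → ℝ := fun u => c * (1 + √u ^ s) * u ^ (-s) with hb
  have hbpos : ∀ u, 0 < u → 0 < b u := fun u hu => by positivity
  have hlow : ∀ u, 0 < u → ∀ v ∈ S, v ≤ √u →
      potential Q 1 ((Set.Ioi u).indicator 1) v ≤ ENNReal.ofReal (b u) :=
    fun u hu v hv hvu => hbd u √u hu (Real.sqrt_nonneg u) v hv hvu
  have hbtend : Tendsto b atTop (𝓝 0) := by
    have h1 : Tendsto (fun u : ℝ => c * (u ^ (-s) + u ^ (-(s / 2)))) atTop (𝓝 (c * (0 + 0))) :=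
      ((tendsto_rpow_neg_atTop hs).add (tendsto_rpow_neg_atTop (half_pos hs))).const_mul c
    rw [add_zero, mul_zero] at h1
    refine h1.congr' ?_
    filter_upwards [eventually_gt_atTop 0] with u hu
    have : √u ^ s * u ^ (-s) = u ^ (-(s / 2)) := by
      rw [Real.sqrt_eq_rpow, ← Real.rpow_mul hu.le, ← Real.rpow_add hu]
      congr 1; ring
    simp only [hb]
    rw [mul_assoc, add_mul, one_mul, this]
  obtain ⟨R, hR⟩ := hC.subset_closedBall 0
  have hsqrt : Tendsto (fun u : ℝ => √u) atTop atTop := Real.tendsto_sqrt_atTop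
  have hev : ∀ᶠ u : ℝ in atTop, 0 < stepDrift ρ √u := by
    filter_upwards [hsqrt.eventually (hρ.eventually_integral_logStep_neg hs hs1 hsξ)] with u hu
    rw [stepDrift]; linarith
  -- Beyond `u₀` the walk at level `√u` drifts down, and all of `C` lies at or below `u`.
  obtain ⟨u₀, hu₀⟩ :=
    (hev.and ((eventually_ge_atTop 1).and (eventually_ge_atTop R))).exists_forall_of_atTop
  have hu₀1 : 1 ≤ u₀ := (hu₀ u₀ le_rfl).2.1
  have hu₀0 : 0 < u₀ := by linarith
  have hmain : ∀ u, u₀ ≤ u → ∀ v ∈ S, u < v → potential Q 1 ((Set.Ioi u).indicator 1) v ≤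
      ENNReal.ofReal (1 / stepDrift ρ √u * Real.log (v / u) + (stepOvershoot ρ √u + b u)) := by
    intro u hu v hvS hv
    obtain ⟨hm, hu1, -⟩ := hu₀ u hu
    exact hρ.potential_Ioi_le hs hs1 hsξ.le hPQ hS (Real.one_le_sqrt.2 hu1)
      (Real.sqrt_le_iff.2 ⟨by linarith, by nlinarith⟩) hm (hbpos u (by linarith)).le
      (hlow u (by linarith)) hvS hv
  obtain ⟨M, hM, hMK⟩ := hK (Set.Icc 0 u₀) isCompact_Icc
  set k₁ := 1 / stepDrift ρ √u₀ with hk₁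
  have hk₁0 : 0 < k₁ := one_div_pos.2 (hu₀ u₀ le_rfl).1
  have hou := stepOvershoot_nonneg (ρ := ρ) √u₀
  set k₂ := stepOvershoot ρ √u₀ + b u₀ + c * (1 + u₀ ^ s) * u₀ ^ (-s) + M.toReal with hk₂
  have hb₀ := hbpos u₀ hu₀0
  have hc₀ : 0 < c * (1 + u₀ ^ s) * u₀ ^ (-s) := by positivity
  have hk₂0 : 0 < k₂ := by positivity
  -- For small `u` only finiteness matters: visits in `[0, u₀]` are bounded by compactness, and
  -- visits above `u₀` by the estimates at `u₀`.
  have hsmall : ∀ u, 0 < u → u ≤ u₀ → ∀ v ∈ S, u < v →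
      potential Q 1 ((Set.Ioi u).indicator 1) v ≤
        ENNReal.ofReal (k₁ * Real.log (v / u) + k₂) := by
    intro u hu huu v hvS hv
    have hlog : 0 ≤ Real.log (v / u) := Real.log_nonneg ((one_le_div hu).2 hv.le)
    have hmeas : ∀ {E : Set ℝ}, MeasurableSet E → Measurable (E.indicator (1 : ℝ → ℝ≥0∞)) :=
      fun hE => measurable_one.indicator hE
    have h1 : potential Q 1 ((Set.Ioi u).indicator 1) v ≤
        potential Q 1 ((Set.Icc 0 u₀).indicator 1) v
          + potential Q 1 ((Set.Ioi u₀).indicator 1) v := by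
      rw [← potential_add (hmeas measurableSet_Icc)]
      refine potential_mono ((hmeas measurableSet_Icc).add (hmeas measurableSet_Ioi)) ?_ v
      intro x
      by_cases hx : u < x
      · rcases le_or_gt x u₀ with h | h
        · simp [Set.indicator, hx, h, (hu.trans hx).le]
        · simp [Set.indicator, hx, h]
      · simp [Set.indicator, hx]
    have h2 : potential Q 1 ((Set.Ioi u₀).indicator 1) v ≤
        ENNReal.ofReal (k₁ * Real.log (v / u)
          + (stepOvershoot ρ √u₀ + b u₀ + c * (1 + u₀ ^ s) * u₀ ^ (-s))) := by
      rcases le_or_gt v u₀ with h | h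
      · refine (hbd u₀ u₀ hu₀0 hu₀0.le v hvS h).trans (ENNReal.ofReal_le_ofReal ?_)
        have : 0 ≤ k₁ * Real.log (v / u) := by positivity
        linarith
      · refine (hmain u₀ le_rfl v hvS h).trans (ENNReal.ofReal_le_ofReal ?_)
        have : Real.log (v / u₀) ≤ Real.log (v / u) :=
          Real.log_le_log (by have := hu₀0.trans h; positivity) (by have := hu₀0.trans h; gcongr)
        have := mul_le_mul_of_nonneg_left this hk₁0.le
        linarith
    refine h1.trans ((add_le_add (hMK v hvS) h2).trans (le_of_eq ?_))
    rw [hk₂, ← add_assoc _ _ M.toReal, ENNReal.ofReal_add (by positivity) ENNReal.toReal_nonneg,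
      ENNReal.ofReal_toReal hM, add_comm]
  -- The factor `a`, the price of conditioning on the splitting variable, is needed only for `u ≤
  -- u₀`: for larger `u` a point `v > u` is outside `C`.
  refine ⟨fun u => if u₀ < u then 1 / stepDrift ρ √u else a * k₁,
    fun u => if u₀ < u then stepOvershoot ρ √u + b u else a * k₂, ?_, ?_, ?_, ?_⟩
  · intro u hu
    by_cases h : u₀ < u
    · simp only [h, if_true]
      exact ⟨one_div_pos.2 (hu₀ u h.le).1, add_pos_of_nonneg_of_pos (stepOvershoot_nonneg _)
        (hbpos u hu)⟩
    · simp only [h, if_false]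
      exact ⟨by positivity, by positivity⟩
  · intro u hu v hvS hv
    by_cases h : u₀ < u
    · simp only [h, if_true]
      have hvC : v ∉ C := fun hvC => by
        have h1 := hR hvC
        rw [mem_closedBall_zero_iff, Real.norm_eq_abs] at h1
        have h2 := le_abs_self v
        have h3 := (hu₀ u₀ le_rfl).2.2
        linarith
      rw [Set.indicator_of_notMem hvC, zero_mul, zero_add]
      exact hmain u h.le v hvS hv
    · simp only [h, if_false]
      have h1 := hsmall u hu (not_lt.1 h) v hvS hv
      have h2 : C.indicator (fun _ => ENNReal.ofReal (a - 1)) v ≤ ENNReal.ofReal (a - 1) :=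
        Set.indicator_le_self' (fun _ _ => zero_le) v
      calc _ ≤ ENNReal.ofReal (a - 1) * ENNReal.ofReal (k₁ * Real.log (v / u) + k₂)
            + 1 * ENNReal.ofReal (k₁ * Real.log (v / u) + k₂) := by
              rw [one_mul]; gcongr
        _ = ENNReal.ofReal a * ENNReal.ofReal (k₁ * Real.log (v / u) + k₂) := by
              rw [← add_mul, ← ENNReal.ofReal_one, ← ENNReal.ofReal_add (by linarith) zero_le_one,
                sub_add_cancel]
        _ = _ := by
              rw [← ENNReal.ofReal_mul (by linarith)]
              congr 1; ring
  · intro hint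
    have hneg := hρ.integral_log_neg hs hsξ hint
    have h1 := (tendsto_const_nhds (x := (1 : ℝ))).div
      ((hρ.tendsto_stepDrift hs hs1 hsξ.le hint).comp hsqrt) (by rw [drift]; linarith)
    refine h1.congr' ?_
    filter_upwards [eventually_gt_atTop u₀] with u hu
    simp [hu]
  · intro hint
    have h1 := ((hρ.tendsto_stepOvershoot hs hs1 hsξ hint).comp hsqrt).add hbtend
    rw [add_zero] at h1
    refine h1.congr' ?_
    filter_upwards [eventually_gt_atTop u₀] with u hu
    simp [hu]

end

end

end Letac

namespace Letac

noncomputable section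

/-! ### Times and histories of the augmented chain -/

section

variable {Ω : Type*} {V : ℕ → Ω → ℝ} {η : ℕ → Ω → Bool} {C : Set ℝ} {u : ℝ}

theorem exceedTime_le_iff {n : ℕ} {ω : Ω} :
    exceedTime V u ω ≤ (n : WithTop ℕ) ↔ ∃ j ≤ n, u < V j ω :=
  (hittingAfter_le_iff (i := n)).trans (by simp)

theorem lt_exceedTime_iff {n : ℕ} {ω : Ω} :
    (n : WithTop ℕ) < exceedTime V u ω ↔ ∀ j ≤ n, V j ω ≤ u := by
  rw [← not_le, exceedTime_le_iff]
  push Not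
  rfl

theorem exceedTime_eq_iff {n : ℕ} {ω : Ω} :
    exceedTime V u ω = (n : WithTop ℕ) ↔ u < V n ω ∧ ∀ j < n, V j ω ≤ u := by
  constructor
  · intro h
    have h1 : ∀ j < n, V j ω ≤ u := fun j hj =>
      lt_exceedTime_iff.1 (h ▸ (by exact_mod_cast hj : (j : WithTop ℕ) < n)) j le_rfl
    obtain ⟨j, hj, hu⟩ := exceedTime_le_iff.1 h.le
    rcases hj.lt_or_eq with hlt | rfl
    · exact absurd (h1 j hlt) (not_le.2 hu)
    · exact ⟨hu, h1⟩
  · rintro ⟨h1, h2⟩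
    refine le_antisymm (exceedTime_le_iff.2 ⟨n, le_rfl, h1⟩) ?_
    by_contra! hlt
    obtain ⟨j, hj⟩ := WithTop.ne_top_iff_exists.1 (ne_top_of_lt hlt)
    rw [← hj] at hlt
    obtain ⟨i, hi, hu⟩ := exceedTime_le_iff.1 hj.symm.le
    exact not_le.2 hu (h2 i (hi.trans_lt (WithTop.coe_lt_coe.1 hlt)))

/-- The shift by one in `τ = (τ - 1) + 1` makes `T_u` and `T_u ∧ (τ - 1)` agree on `{T_u < τ}`. -/
theorem lt_regenTime_iff_le {n : ℕ} {ω : Ω} :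
    (n : WithTop ℕ) < regenTime C V η ω ↔ (n : WithTop ℕ) ≤ regenTimePred C V η ω := by
  rw [regenTime]
  cases h : regenTimePred C V η ω with
  | top => simp
  | coe k =>
    exact (WithTop.coe_lt_coe (a := k + 1) (b := n)).trans
      (Nat.lt_succ_iff.trans (WithTop.coe_le_coe (a := k) (b := n)).symm)

theorem lt_regenTime_iff {n : ℕ} {ω : Ω} :
    (n : WithTop ℕ) < regenTime C V η ω ↔ ∀ j < n, ¬ (V j ω ∈ C ∧ η j ω = true) := by
  rw [lt_regenTime_iff_le, ← not_lt, regenTimePred]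
  refine (not_congr (hittingAfter_lt_iff (i := n))).trans ?_
  simp

theorem history_le [mΩ : MeasurableSpace Ω] (hV : ∀ n, Measurable (V n))
    (hη : ∀ n, Measurable (η n)) (n : ℕ) : history V η n ≤ mΩ :=
  sup_le (iSup₂_le fun k _ => (hV k).comap_le) (iSup₂_le fun k _ => (hη k).comap_le)

theorem history_mono {m n : ℕ} (hmn : m ≤ n) : history V η m ≤ history V η n :=
  sup_le_sup (biSup_mono fun _ hk => hk.trans hmn) (biSup_mono fun _ hk => hk.trans_le hmn)

theorem measurable_history_left {k n : ℕ} (hk : k ≤ n) : Measurable[history V η n] (V k) :=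
  Measurable.of_comap_le (le_sup_of_le_left
    (le_iSup₂_of_le (f := fun k (_ : k ≤ n) => MeasurableSpace.comap (V k) inferInstance)
      k hk le_rfl))

theorem measurable_history_right {k n : ℕ} (hk : k < n) : Measurable[history V η n] (η k) :=
  Measurable.of_comap_le (le_sup_of_le_right
    (le_iSup₂_of_le (f := fun k (_ : k < n) => MeasurableSpace.comap (η k) inferInstance)
      k hk le_rfl))

theorem measurableSet_lt_exceedTime (n : ℕ) :
    MeasurableSet[history V η n] {ω | (n : WithTop ℕ) < exceedTime V u ω} := by
  have : {ω | (n : WithTop ℕ) < exceedTime V u ω} = ⋂ j, ⋂ (_ : j ≤ n), V j ⁻¹' Set.Iic u := by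
    ext ω
    simp [lt_exceedTime_iff]
  rw [this]
  exact MeasurableSet.iInter fun j => MeasurableSet.iInter fun hj =>
    measurable_history_left hj measurableSet_Iic

theorem measurableSet_exceedTime_le (n : ℕ) :
    MeasurableSet[history V η n] {ω | exceedTime V u ω ≤ (n : WithTop ℕ)} := by
  have : {ω | exceedTime V u ω ≤ (n : WithTop ℕ)} = {ω | (n : WithTop ℕ) < exceedTime V u ω}ᶜ := by
    ext ω
    simp
  rw [this]
  exact (measurableSet_lt_exceedTime n).compl

theorem measurableSet_exceedTime_eq (n : ℕ) :
    MeasurableSet[history V η n] {ω | exceedTime V u ω = (n : WithTop ℕ)} := by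
  have : {ω | exceedTime V u ω = (n : WithTop ℕ)}
      = V n ⁻¹' Set.Ioi u ∩ ⋂ j, ⋂ (_ : j < n), V j ⁻¹' Set.Iic u := by
    ext ω
    simp [exceedTime_eq_iff]
  rw [this]
  exact (measurable_history_left le_rfl measurableSet_Ioi).inter
    (MeasurableSet.iInter fun j => MeasurableSet.iInter fun hj =>
      measurable_history_left hj.le measurableSet_Iic)

theorem measurableSet_regeneration (hC : MeasurableSet C) {j n : ℕ} (hj : j < n) :
    MeasurableSet[history V η n] {ω | V j ω ∈ C ∧ η j ω = true} :=
  (measurable_history_left hj.le hC).inter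
    (measurable_history_right hj (measurableSet_singleton true))

theorem measurableSet_lt_regenTime (hC : MeasurableSet C) (n : ℕ) :
    MeasurableSet[history V η n] {ω | (n : WithTop ℕ) < regenTime C V η ω} := by
  have : {ω | (n : WithTop ℕ) < regenTime C V η ω}
      = ⋂ j, ⋂ (_ : j < n), {ω | V j ω ∈ C ∧ η j ω = true}ᶜ := by
    ext ω
    simp [lt_regenTime_iff]
  rw [this]
  exact MeasurableSet.iInter fun j => MeasurableSet.iInter fun hj =>
    (measurableSet_regeneration hC hj).compl

theorem history_le_filtration [mΩ : MeasurableSpace Ω] (hV : ∀ n, Measurable (V n))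
    (hη : ∀ n, Measurable (η n)) (n : ℕ) : history V η n ≤ filtration V η hV hη n :=
  sup_le
    (iSup₂_le fun k hk => (measurable_fst.comp ((measurable_pair_filtration V η hV hη k).mono
      ((filtration V η hV hη).mono hk) le_rfl)).comap_le)
    (iSup₂_le fun k hk => (measurable_snd.comp ((measurable_pair_filtration V η hV hη k).mono
      ((filtration V η hV hη).mono hk.le) le_rfl)).comap_le)

theorem filtration_le_history_sup [MeasurableSpace Ω] (hV : ∀ n, Measurable (V n))
    (hη : ∀ n, Measurable (η n)) (n : ℕ) :
    filtration V η hV hη n ≤ history V η n ⊔ MeasurableSpace.comap (η n) inferInstance := by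
  refine iSup₂_le fun k hk => ?_
  refine Measurable.comap_le (Measurable.prodMk ?_ ?_)
  · exact (measurable_history_left hk).mono le_sup_left le_rfl
  · rcases hk.lt_or_eq with h | rfl
    · exact (measurable_history_right h).mono le_sup_left le_rfl
    · exact Measurable.of_comap_le le_sup_right

/-- Events of `𝔉_n` are determined by events of the history on each value of `η_n`. -/
theorem exists_history_of_filtration [mΩ : MeasurableSpace Ω] (hV : ∀ n, Measurable (V n))
    (hη : ∀ n, Measurable (η n)) {n : ℕ} {G : Set Ω}
    (hG : MeasurableSet[filtration V η hV hη n] G) (b : Bool) :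
    ∃ H, MeasurableSet[history V η n] H ∧
      ∀ ω, η n ω = b → (ω ∈ G ↔ ω ∈ H) := by
  have hG' := filtration_le_history_sup hV hη n G hG
  have he : history V η n ⊔ MeasurableSpace.comap (η n) inferInstance
      = MeasurableSpace.comap (fun ω => (ω, η n ω))
        (@Prod.instMeasurableSpace Ω Bool (history V η n) inferInstance) := by
    refine Eq.trans ?_ (@MeasurableSpace.comap_prodMk Ω Ω Bool (history V η n) _ id (η n)).symm
    rw [MeasurableSpace.comap_id]
  rw [he] at hG'
  obtain ⟨E, hE, rfl⟩ := hG'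
  refine ⟨(fun ω => (ω, b)) ⁻¹' E, ?_, fun ω hω => ?_⟩
  · exact @measurable_prodMk_right Ω Bool (history V η n) inferInstance b E hE
  · simp [hω]

end

end

end Letac

namespace Letac

noncomputable section

/-! ### One step of the dual chain -/

theorem act_eq_of_notMem
    {ρ : Measure (ℝ × ℝ × ℝ)} [IsProbabilityMeasure ρ] {δ : ℝ} {C : Set ℝ}
    {ν : Measure ℝ} [IsProbabilityMeasure ν] {Q : Kernel ℝ ℝ} {f : ℝ → ℝ≥0∞}
    (hPQ : ∀ v, transition ρ v = Q v + C.indicator (fun _ => ENNReal.ofReal δ) v • ν)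
    {v : ℝ} (hv : v ∉ C) : act (transition ρ) f v = act Q f v := by
  rw [act_eq_act_add hPQ, Set.indicator_of_notMem hv, zero_mul, add_zero]

namespace IsDualChain

variable {ρ : Measure (ℝ × ℝ × ℝ)} [IsProbabilityMeasure ρ] {ξ δ : ℝ} {C : Set ℝ}
  {ν : Measure ℝ} [IsProbabilityMeasure ν] {u : ℝ} {Ω : Type*} [MeasurableSpace Ω]
  {P : Measure Ω} [IsProbabilityMeasure P] {V : ℕ → Ω → ℝ} {η : ℕ → Ω → Bool}
  {Y : ℕ → Ω → ℝ × ℝ × ℝ} (h : IsDualChain ρ ξ δ C ν u P V η Y)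

include h

theorem history_le (n : ℕ) : history V η n ≤ ‹MeasurableSpace Ω› :=
  Letac.history_le h.measurable_V h.measurable_η n

/-- On `G` the pair `(V_n, Y_{n+1})` has a product law. The law `κ` is left free so that both the
shifted and the original regime are covered. -/
theorem setLIntegral_step {κ : Measure (ℝ × ℝ × ℝ)} [SigmaFinite κ] {n : ℕ} {G : Set Ω}
    (hG : MeasurableSet[history V η n] G)
    (hprod : ∀ H ⊆ G, MeasurableSet[history V η n] H → ∀ E : Set (ℝ × ℝ × ℝ), MeasurableSet E →
      P (H ∩ Y (n + 1) ⁻¹' E) = P H * κ E) {f : ℝ → ℝ≥0∞} (hf : Measurable f) :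
    ∫⁻ ω in G, f (V (n + 1) ω) ∂P = ∫⁻ ω in G, ∫⁻ y, f (step y (V n ω)) ∂κ ∂P := by
  have hVn := h.measurable_V n
  have hYn := h.measurable_Y (n + 1)
  have hG' := h.history_le n G hG
  have hmap : ((P.restrict G).map (V n)).prod κ
      = (P.restrict G).map (fun ω => (V n ω, Y (n + 1) ω)) := by
    refine Measure.prod_eq fun s t hs ht => ?_
    have e : (fun ω => (V n ω, Y (n + 1) ω)) ⁻¹' (s ×ˢ t) ∩ G
        = (V n ⁻¹' s ∩ G) ∩ Y (n + 1) ⁻¹' t := by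
      ext ω
      simp only [Set.mem_inter_iff, Set.mem_preimage, Set.mem_prod]
      tauto
    rw [Measure.map_apply (hVn.prodMk hYn) (hs.prod ht), Measure.map_apply hVn hs,
      Measure.restrict_apply (hVn.prodMk hYn (hs.prod ht)), Measure.restrict_apply (hVn hs), e]
    exact hprod _ Set.inter_subset_right ((measurable_history_left le_rfl hs).inter hG) t ht
  have hF : Measurable (fun p : ℝ × (ℝ × ℝ × ℝ) => f (step p.2 p.1)) := hf.comp measurable_step
  calc ∫⁻ ω in G, f (V (n + 1) ω) ∂P
      = ∫⁻ ω in G, f (step (Y (n + 1) ω) (V n ω)) ∂P := by simp_rw [h.recursion]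
    _ = ∫⁻ p, f (step p.2 p.1) ∂((P.restrict G).map (fun ω => (V n ω, Y (n + 1) ω))) :=
        (lintegral_map hF (hVn.prodMk hYn)).symm
    _ = _ := by
        rw [← hmap, lintegral_prod _ hF.aemeasurable, lintegral_map hF.lintegral_prod_right' hVn]

/-- Once the level `u` has been exceeded, `V` moves according to the original kernel. -/
theorem setLIntegral_succ {n : ℕ} {G : Set Ω} (hG : MeasurableSet[history V η n] G)
    (hT : ∀ ω ∈ G, exceedTime V u ω ≤ (n : WithTop ℕ)) {f : ℝ → ℝ≥0∞} (hf : Measurable f) :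
    ∫⁻ ω in G, f (V (n + 1) ω) ∂P = ∫⁻ ω in G, act (transition ρ) f (V n ω) ∂P := by
  simp_rw [act_transition ρ hf]
  exact h.setLIntegral_step hG
    (fun H hHG hH E hE => h.original n H hH (fun ω hω => hT ω (hHG hω)) E hE) hf

/-- The dual chain stays in each absorbing set of full regeneration measure. -/
theorem ae_mem {S : Set ℝ} (hSm : MeasurableSet S) (hS : ∀ x ∈ S, transition ρ x Sᶜ = 0)
    (hν : ν Sᶜ = 0) (n : ℕ) : ∀ᵐ ω ∂P, V n ω ∈ S := by
  have hstep : ∀ v ∈ S, ∀ᵐ y ∂ρ, step y v ∈ S := fun v hv => by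
    have := hS v hv
    have hm : Measurable (fun y => step y v) := measurable_step.comp measurable_prodMk_left
    rwa [transition, Kernel.coe_mk, Measure.map_apply hm hSm.compl] at this
  induction n with
  | zero =>
    have : ∀ᵐ v ∂(P.map (V 0)), v ∈ S := by rw [h.initial]; exact hν
    exact ae_of_ae_map (h.measurable_V 0).aemeasurable this
  | succ n ih =>
    have key : ∀ (κ : Measure (ℝ × ℝ × ℝ)) [SigmaFinite κ] (G : Set Ω), κ ≪ ρ →
        MeasurableSet[history V η n] G →
        (∀ H ⊆ G, MeasurableSet[history V η n] H → ∀ E : Set (ℝ × ℝ × ℝ), MeasurableSet E →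
          P (H ∩ Y (n + 1) ⁻¹' E) = P H * κ E) → P (V (n + 1) ⁻¹' Sᶜ ∩ G) = 0 := by
      intro κ _ G hκ hG hprod
      have hm := h.measurable_V (n + 1) hSm.compl
      have e := h.setLIntegral_step hG hprod (measurable_one.indicator hSm.compl)
      have e1 : ∫⁻ ω in G, Sᶜ.indicator (1 : ℝ → ℝ≥0∞) (V (n + 1) ω) ∂P
          = P (V (n + 1) ⁻¹' Sᶜ ∩ G) := by
        rw [← Measure.restrict_apply hm, ← lintegral_indicator_one hm]
        rfl
      rw [← e1, e]
      refine (lintegral_congr_ae ?_).trans lintegral_zero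
      filter_upwards [ae_restrict_of_ae ih] with ω hω
      refine (lintegral_congr_ae ?_).trans lintegral_zero
      filter_upwards [hκ.ae_le (hstep _ hω)] with y hy
      simp [hy]
    -- The shifted law is absolutely continuous with respect to `ρ`, so the set stays absorbing
    -- before `T_u` too.
    have : SigmaFinite (shiftedLaw ρ ξ) := SigmaFinite.withDensity_ofReal _
    have h1 := key ρ {ω | exceedTime V u ω ≤ (n : WithTop ℕ)} Measure.AbsolutelyContinuous.rfl
      (measurableSet_exceedTime_le n) fun H hHG hH E hE => h.original n H hH hHG E hE
    have h2 := key (shiftedLaw ρ ξ) {ω | (n : WithTop ℕ) < exceedTime V u ω}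
      (withDensity_absolutelyContinuous _ _) (measurableSet_lt_exceedTime n)
      fun H hHG hH E hE => h.shifted n H hH hHG E hE
    refine measure_mono_null (fun ω hω => ?_) (measure_union_null h1 h2)
    rcases le_or_gt (exceedTime V u ω) (n : WithTop ℕ) with hle | hlt
    · exact Or.inl ⟨hω, hle⟩
    · exact Or.inr ⟨hω, hlt⟩

theorem measurableSet_eta (n : ℕ) (b : Bool) : MeasurableSet {ω | η n ω = b} :=
  h.measurable_η n (measurableSet_singleton b)

open Classical in
/-- The law of the state that follows the event `η_n = 1`. -/
theorem setLIntegral_succ_of_eta (hC : MeasurableSet C) {n : ℕ} {G : Set Ω}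
    (hG : MeasurableSet[history V η n] G)
    (hT : ∀ ω ∈ G, exceedTime V u ω ≤ (n : WithTop ℕ)) {f : ℝ → ℝ≥0∞} (hf : Measurable f) :
    ∫⁻ ω in G ∩ {ω | η n ω = true}, f (V (n + 1) ω) ∂P = ENNReal.ofReal δ *
      ∫⁻ ω in G, (if V n ω ∈ C then ∫⁻ v, f v ∂ν else act (transition ρ) f (V n ω)) ∂P := by
  have hVn := h.measurable_V n
  have hV' := h.measurable_V (n + 1)
  set κ : Kernel ℝ ℝ := Kernel.piecewise hC (Kernel.const ℝ ν) (transition ρ) with hκ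
  have hmap : (P.restrict (G ∩ {ω | η n ω = true})).map (V (n + 1))
      = ENNReal.ofReal δ • ((P.restrict G).map (V n)).bind κ := by
    ext E hE
    rw [Measure.map_apply hV' hE, Measure.restrict_apply (hV' hE), Set.inter_comm,
      h.split n G hG hT E hE, Measure.smul_apply, smul_eq_mul,
      Measure.bind_apply hE κ.measurable.aemeasurable,
      lintegral_map (κ.measurable_coe hE) hVn]
    congr 2 with ω
    by_cases hω : V n ω ∈ C <;> simp [hκ, Kernel.piecewise_apply, hω]
  rw [← lintegral_map hf hV', hmap, lintegral_smul_measure, smul_eq_mul,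
    Measure.lintegral_bind κ.measurable.aemeasurable hf.aemeasurable,
    lintegral_map hf.lintegral_kernel hVn]
  congr 2 with ω
  by_cases hω : V n ω ∈ C <;> simp [hκ, Kernel.piecewise_apply, hω, act]

/-- With `f = 1` in the law of the successor, both branches have mass one, so `η_n` is
Bernoulli(`δ`) independently of the history. -/
theorem setLIntegral_eta_true (hC : MeasurableSet C) {n : ℕ} {G : Set Ω}
    (hG : MeasurableSet[history V η n] G)
    (hT : ∀ ω ∈ G, exceedTime V u ω ≤ (n : WithTop ℕ)) {g : ℝ → ℝ≥0∞} (hg : Measurable g) :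
    ∫⁻ ω in G ∩ {ω | η n ω = true}, g (V n ω) ∂P
      = ENNReal.ofReal δ * ∫⁻ ω in G, g (V n ω) ∂P := by
  have hVn := h.measurable_V n
  have hmap : (P.restrict (G ∩ {ω | η n ω = true})).map (V n)
      = ENNReal.ofReal δ • (P.restrict G).map (V n) := by
    ext E hE
    have e := h.setLIntegral_succ_of_eta hC ((measurable_history_left le_rfl hE).inter hG)
      (fun ω hω => hT ω hω.2) (measurable_one (α := ℝ≥0∞))
    simp only [Pi.one_apply, lintegral_one, measure_univ, act, ite_self, Measure.restrict_apply,
      MeasurableSet.univ, Set.univ_inter] at e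
    rw [Measure.smul_apply, smul_eq_mul, Measure.map_apply hVn hE, Measure.map_apply hVn hE,
      Measure.restrict_apply (hVn hE), Measure.restrict_apply (hVn hE), ← e, Set.inter_assoc]
  rw [← lintegral_map hg hVn, hmap, lintegral_smul_measure, lintegral_map hg hVn, smul_eq_mul]

theorem setLIntegral_eta_false (hC : MeasurableSet C) {n : ℕ} {G : Set Ω}
    (hG : MeasurableSet[history V η n] G)
    (hT : ∀ ω ∈ G, exceedTime V u ω ≤ (n : WithTop ℕ)) {g : ℝ → ℝ≥0∞} (hg : Measurable g) :
    ∫⁻ ω in G ∩ {ω | η n ω = false}, g (V n ω) ∂P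
      = (1 - ENNReal.ofReal δ) * ∫⁻ ω in G, g (V n ω) ∂P := by
  have hVn := h.measurable_V n
  have hmap : (P.restrict (G ∩ {ω | η n ω = false})).map (V n)
      = (1 - ENNReal.ofReal δ) • (P.restrict G).map (V n) := by
    ext E hE
    have hH := (measurable_history_left (V := V) (η := η) (le_refl n) hE).inter hG
    have e := h.setLIntegral_eta_true hC hH (fun ω hω => hT ω hω.2) (measurable_one (α := ℝ≥0∞))
    simp only [Pi.one_apply, lintegral_one, Measure.restrict_apply,
      MeasurableSet.univ, Set.univ_inter] at e
    have e2 := measure_inter_add_sdiff (μ := P) (V n ⁻¹' E ∩ G) (h.measurableSet_eta n true)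
    have e3 : (V n ⁻¹' E ∩ G) \ {ω | η n ω = true} = V n ⁻¹' E ∩ (G ∩ {ω | η n ω = false}) := by
      ext ω; simp [and_assoc]
    rw [Measure.smul_apply, smul_eq_mul, Measure.map_apply hVn hE, Measure.map_apply hVn hE,
      Measure.restrict_apply (hVn hE), Measure.restrict_apply (hVn hE), ← e3,
      ENNReal.sub_mul (fun _ _ => measure_ne_top _ _), one_mul, ← e]
    exact ENNReal.eq_sub_of_add_eq (measure_ne_top _ _) (by rw [add_comm]; exact e2)
  rw [← lintegral_map hg hVn, hmap, lintegral_smul_measure, lintegral_map hg hVn, smul_eq_mul]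

section

variable {Q : Kernel ℝ ℝ} {f : ℝ → ℝ≥0∞} {K : ℝ≥0∞}

/-- On `C`, subtracting the contribution `δ ν` of `η_n = 1` from `P` leaves exactly `Q`. The bound
on `f` makes the subtraction finite. -/
theorem setLIntegral_alive_of_mem (hC : MeasurableSet C)
    (hPQ : ∀ v, transition ρ v = Q v + C.indicator (fun _ => ENNReal.ofReal δ) v • ν)
    {n : ℕ} {G : Set Ω} (hG : MeasurableSet[history V η n] G)
    (hT : ∀ ω ∈ G, exceedTime V u ω ≤ (n : WithTop ℕ)) (hGC : ∀ ω ∈ G, V n ω ∈ C)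
    (hf : Measurable f) (hK : K ≠ ∞) (hfK : ∀ v, f v ≤ K) :
    ∫⁻ ω in G ∩ {ω | η n ω = false}, f (V (n + 1) ω) ∂P = ∫⁻ ω in G, act Q f (V n ω) ∂P := by
  have hG' := h.history_le n G hG
  have e1 := h.setLIntegral_succ_of_eta hC hG hT hf
  have e2 := h.setLIntegral_succ hG hT hf
  have e3 := lintegral_inter_add_sdiff (μ := P) (fun ω => f (V (n + 1) ω)) G
    (h.measurableSet_eta n true)
  have e4 : G \ {ω | η n ω = true} = G ∩ {ω | η n ω = false} := by ext ω; simp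
  have e5 : ∫⁻ ω in G, act (transition ρ) f (V n ω) ∂P
      = ∫⁻ ω in G, act Q f (V n ω) ∂P
        + ∫⁻ ω in G ∩ {ω | η n ω = true}, f (V (n + 1) ω) ∂P := by
    rw [e1, ← lintegral_const_mul', ← lintegral_add_left]
    · refine setLIntegral_congr_fun hG' fun ω hω => ?_
      simp only [act_eq_act_add hPQ, hGC ω hω, Set.indicator_of_mem, if_true]
    · exact (measurable_act hf).comp (h.measurable_V n)
    · exact ENNReal.ofReal_ne_top
  have hfin : ∫⁻ ω in G ∩ {ω | η n ω = true}, f (V (n + 1) ω) ∂P ≠ ∞ := by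
    refine ne_top_of_le_ne_top hK ((lintegral_mono fun ω => hfK _).trans ?_)
    rw [lintegral_const, Measure.restrict_apply_univ]
    exact mul_le_of_le_one_right' prob_le_one
  rw [e4, e2, e5, add_comm] at e3
  exact (ENNReal.add_left_inj hfin).1 e3

/-- The chain killed at its regenerations moves according to `Q`. -/
theorem setLIntegral_alive (hC : MeasurableSet C)
    (hPQ : ∀ v, transition ρ v = Q v + C.indicator (fun _ => ENNReal.ofReal δ) v • ν)
    {n : ℕ} {G : Set Ω} (hG : MeasurableSet[history V η n] G)
    (hT : ∀ ω ∈ G, exceedTime V u ω ≤ (n : WithTop ℕ))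
    (hf : Measurable f) (hK : K ≠ ∞) (hfK : ∀ v, f v ≤ K) :
    ∫⁻ ω in G ∩ {ω | V n ω ∈ C ∧ η n ω = true}ᶜ, f (V (n + 1) ω) ∂P
      = ∫⁻ ω in G, act Q f (V n ω) ∂P := by
  have hCn : MeasurableSet[history V η n] (V n ⁻¹' C) := measurable_history_left le_rfl hC
  have hCn' := h.measurable_V n hC
  rw [← lintegral_inter_add_sdiff _ _ hCn', ← lintegral_inter_add_sdiff _ G hCn']
  congr 1
  · rw [← h.setLIntegral_alive_of_mem hC hPQ (hG.inter hCn) (fun ω hω => hT ω hω.1)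
      (fun ω hω => hω.2) hf hK hfK]
    congr 2
    ext ω
    simp only [Set.mem_inter_iff, Set.mem_compl_iff, Set.mem_ofPred_eq, Set.mem_preimage]
    cases η n ω <;> simp
  · have e : (G ∩ {ω | V n ω ∈ C ∧ η n ω = true}ᶜ) \ V n ⁻¹' C = G \ V n ⁻¹' C := by
      ext ω
      simp only [Set.mem_inter_iff, Set.mem_compl_iff, Set.mem_ofPred_eq, Set.mem_preimage,
        Set.mem_sdiff]
      tauto
    rw [e, h.setLIntegral_succ (hG.diff hCn) (fun ω hω => hT ω hω.1) hf]
    exact setLIntegral_congr_fun (h.history_le n _ (hG.diff hCn))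
      fun ω hω => act_eq_of_notMem hPQ hω.2

/-- One step of the killed chain, given also the value of the splitting variable. -/
theorem setLIntegral_alive_eta_le (hC : MeasurableSet C)
    (hPQ : ∀ v, transition ρ v = Q v + C.indicator (fun _ => ENNReal.ofReal δ) v • ν)
    {a : ℝ≥0∞} (ha : ENNReal.ofReal δ < 1 → 1 ≤ (a + 1) * (1 - ENNReal.ofReal δ))
    {n : ℕ} {G : Set Ω} (hG : MeasurableSet[history V η n] G)
    (hT : ∀ ω ∈ G, exceedTime V u ω ≤ (n : WithTop ℕ))
    (hf : Measurable f) (hK : K ≠ ∞) (hfK : ∀ v, f v ≤ K) (b : Bool) :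
    ∫⁻ ω in (G ∩ {ω | η n ω = b}) ∩ {ω | V n ω ∈ C ∧ η n ω = true}ᶜ, f (V (n + 1) ω) ∂P
      ≤ ∫⁻ ω in G ∩ {ω | η n ω = b},
        (C.indicator (fun _ => a) (V n ω) + 1) * act Q f (V n ω) ∂P := by
  have hCn : MeasurableSet[history V η n] (V n ⁻¹' C) := measurable_history_left le_rfl hC
  have hCn' := h.measurable_V n hC
  have hg : Measurable (act Q f) := measurable_act hf
  rw [← lintegral_inter_add_sdiff _ _ hCn',
    ← lintegral_inter_add_sdiff _ (G ∩ {ω | η n ω = b}) hCn']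
  refine add_le_add ?_ ?_
  · have hH := hG.inter hCn
    have hHT : ∀ ω ∈ G ∩ V n ⁻¹' C, exceedTime V u ω ≤ (n : WithTop ℕ) := fun ω hω => hT ω hω.1
    cases b with
    | true =>
      have e : (G ∩ {ω | η n ω = true}) ∩ {ω | V n ω ∈ C ∧ η n ω = true}ᶜ ∩ V n ⁻¹' C = ∅ := by
        ext ω
        simp only [Set.mem_inter_iff, Set.mem_compl_iff, Set.mem_ofPred_eq, Set.mem_preimage,
          Set.mem_empty_iff_false, iff_false]
        tauto
      simp [e]
    | false =>
      have e : (G ∩ {ω | η n ω = false}) ∩ {ω | V n ω ∈ C ∧ η n ω = true}ᶜ ∩ V n ⁻¹' C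
          = (G ∩ V n ⁻¹' C) ∩ {ω | η n ω = false} := by
        ext ω
        simp only [Set.mem_inter_iff, Set.mem_compl_iff, Set.mem_ofPred_eq, Set.mem_preimage]
        cases η n ω <;> simp
      have e' : G ∩ {ω | η n ω = false} ∩ V n ⁻¹' C
          = (G ∩ V n ⁻¹' C) ∩ {ω | η n ω = false} := Set.inter_right_comm _ _ _
      have hm := (h.history_le n _ hH).inter (h.measurableSet_eta n false)
      have e1 : ∫⁻ ω in (G ∩ V n ⁻¹' C) ∩ {ω | η n ω = false},
            (C.indicator (fun _ => a) (V n ω) + 1) * act Q f (V n ω) ∂P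
          = (a + 1) * ((1 - ENNReal.ofReal δ) * ∫⁻ ω in G ∩ V n ⁻¹' C, act Q f (V n ω) ∂P) := by
        rw [← h.setLIntegral_eta_false hC hH hHT hg,
          ← lintegral_const_mul _ (show Measurable fun ω => act Q f (V n ω) from
            hg.comp (h.measurable_V n))]
        refine setLIntegral_congr_fun hm fun ω hω => ?_
        simp only [Set.indicator_of_mem (show V n ω ∈ C from hω.1.2)]
      rw [e, e', e1]
      -- Given `η_n = 0` in `C`, the next state has law `Q / (1 - δ)`, which the weight `a + 1`
      -- covers; for `δ ≥ 1` the event `η_n = 0` is null.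
      rcases lt_or_ge (ENNReal.ofReal δ) 1 with hδ | hδ
      · rw [h.setLIntegral_alive_of_mem hC hPQ hH hHT (fun ω hω => hω.2) hf hK hfK, ← mul_assoc]
        exact le_mul_of_one_le_left' (ha hδ)
      · have := h.setLIntegral_eta_false hC hH hHT (measurable_one (α := ℝ≥0∞))
        simp only [Pi.one_apply, tsub_eq_zero_of_le hδ, zero_mul, lintegral_one,
          Measure.restrict_apply MeasurableSet.univ, Set.univ_inter] at this
        rw [setLIntegral_measure_zero _ _ this]
        exact zero_le
  · have hH := hG.diff hCn
    have hHT : ∀ ω ∈ G \ V n ⁻¹' C, exceedTime V u ω ≤ (n : WithTop ℕ) := fun ω hω => hT ω hω.1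
    have hHm := h.history_le n _ hH
    have e : ((G ∩ {ω | η n ω = b}) ∩ {ω | V n ω ∈ C ∧ η n ω = true}ᶜ) \ V n ⁻¹' C
        = (G \ V n ⁻¹' C) ∩ {ω | η n ω = b} := by
      ext ω
      simp only [Set.mem_inter_iff, Set.mem_compl_iff, Set.mem_ofPred_eq, Set.mem_preimage,
        Set.mem_sdiff]
      tauto
    have e' : (G ∩ {ω | η n ω = b}) \ V n ⁻¹' C = (G \ V n ⁻¹' C) ∩ {ω | η n ω = b} := by
      ext ω
      simp only [Set.mem_inter_iff, Set.mem_ofPred_eq, Set.mem_preimage, Set.mem_sdiff]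
      tauto
    have hm := hHm.inter (h.measurableSet_eta n b)
    have e1 : ∫⁻ ω in (G \ V n ⁻¹' C) ∩ {ω | η n ω = b},
          (C.indicator (fun _ => a) (V n ω) + 1) * act Q f (V n ω) ∂P
        = ∫⁻ ω in (G \ V n ⁻¹' C) ∩ {ω | η n ω = b}, act Q f (V n ω) ∂P := by
      refine setLIntegral_congr_fun hm fun ω hω => ?_
      simp only [Set.indicator_of_notMem (show V n ω ∉ C from hω.1.2), zero_add, one_mul]
    have e2 : ∫⁻ ω in (G \ V n ⁻¹' C) ∩ {ω | η n ω = true}, f (V (n + 1) ω) ∂P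
        = ENNReal.ofReal δ * ∫⁻ ω in G \ V n ⁻¹' C, act Q f (V n ω) ∂P := by
      rw [h.setLIntegral_succ_of_eta hC hH hHT hf]
      congr 1
      refine setLIntegral_congr_fun hHm fun ω hω => ?_
      simp only [if_neg (show V n ω ∉ C from hω.2), act_eq_of_notMem hPQ hω.2]
    rw [e, e', e1]
    -- Outside `C` the next state has law `P = Q` given `η_n = 1` by assumption, and hence given
    -- `η_n = 0` by subtraction.
    cases b with
    | true => rw [e2, h.setLIntegral_eta_true hC hH hHT hg]
    | false =>
      have e3 := lintegral_inter_add_sdiff (μ := P) (fun ω => f (V (n + 1) ω)) (G \ V n ⁻¹' C)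
        (h.measurableSet_eta n true)
      have e4 : (G \ V n ⁻¹' C) \ {ω | η n ω = true}
          = (G \ V n ⁻¹' C) ∩ {ω | η n ω = false} := by ext ω; simp
      have e5 : ∫⁻ ω in G \ V n ⁻¹' C, f (V (n + 1) ω) ∂P
          = ∫⁻ ω in G \ V n ⁻¹' C, act Q f (V n ω) ∂P := by
        rw [h.setLIntegral_succ hH hHT hf]
        exact setLIntegral_congr_fun hHm fun ω hω => act_eq_of_notMem hPQ hω.2
      have hfin : ∫⁻ ω in G \ V n ⁻¹' C, act Q f (V n ω) ∂P ≠ ∞ := by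
        rw [← e5]
        refine ne_top_of_le_ne_top hK ((lintegral_mono fun ω => hfK _).trans ?_)
        rw [lintegral_const, Measure.restrict_apply_univ]
        exact mul_le_of_le_one_right' prob_le_one
      rw [e2, e4, e5] at e3
      rw [h.setLIntegral_eta_false hC hH hHT hg, ENNReal.sub_mul (fun _ _ => hfin), one_mul]
      exact (ENNReal.eq_sub_of_add_eq (ENNReal.mul_ne_top ENNReal.ofReal_ne_top hfin)
        (by rw [add_comm]; exact e3)).le

end

end IsDualChain

end

end Letac

namespace Letac

noncomputable section

/-! ### Exceedances along a cycle of the dual chain -/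

section

variable {Ω : Type*}

/-- The event that `V_n` exceeds `u` before the regeneration time. -/
def exceedEvent (C : Set ℝ) (V : ℕ → Ω → ℝ) (η : ℕ → Ω → Bool) (u : ℝ) (n : ℕ) : Set Ω :=
  {ω | (n : WithTop ℕ) < regenTime C V η ω ∧ u < V n ω}

variable {C : Set ℝ} {V : ℕ → Ω → ℝ} {η : ℕ → Ω → Bool} {u : ℝ}

theorem exceedances_eq (ω : Ω) :
    exceedances C V η u ω = ∑' n, (exceedEvent C V η u n).indicator 1 ω := by
  refine tsum_congr fun n => ?_
  by_cases hn : ω ∈ exceedEvent C V η u n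
  · rw [Set.indicator_of_mem hn]
    exact if_pos hn
  · rw [Set.indicator_of_notMem hn]
    exact if_neg hn

theorem measurableSet_exceedEvent (hC : MeasurableSet C) (n : ℕ) :
    MeasurableSet[history V η n] (exceedEvent C V η u n) :=
  (measurableSet_lt_regenTime hC n).inter (measurable_history_left le_rfl measurableSet_Ioi)

theorem exceedances_eq_zero {ω : Ω}
    (hω : ¬ exceedTime V u ω < regenTime C V η ω) : exceedances C V η u ω = 0 := by
  rw [exceedances_eq, ENNReal.tsum_eq_zero]
  refine fun n => Set.indicator_of_notMem (fun hn => hω ?_) _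
  exact (exceedTime_le_iff.2 ⟨n, le_rfl, hn.2⟩).trans_lt hn.1

/-- On `{T_u = n}`, the exceedances are counted from the time `n`. -/
theorem exceedances_le_of_exceedTime_eq {n : ℕ} {ω : Ω}
    (hω : exceedTime V u ω = (n : WithTop ℕ)) : exceedances C V η u ω
      ≤ 1 + ∑' j, (exceedEvent C V η u (n + 1 + j)).indicator 1 ω := by
  rw [exceedances_eq, ← ENNReal.summable.sum_add_tsum_nat_add' (k := n + 1),
    Finset.sum_range_succ]
  have hzero : ∑ j ∈ Finset.range n, (exceedEvent C V η u j).indicator (1 : Ω → ℝ≥0∞) ω = 0 :=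
    Finset.sum_eq_zero fun j hj => Set.indicator_of_notMem
      (fun hj' => not_le.2 hj'.2 ((exceedTime_eq_iff.1 hω).2 j (Finset.mem_range.1 hj))) _
  rw [hzero, zero_add]
  refine add_le_add (Set.indicator_le_self' (fun _ _ => zero_le) ω) (le_of_eq ?_)
  exact tsum_congr fun j => by rw [add_comm j]

end

theorem partialPotential_le_of_eq_add {ρ : Measure (ℝ × ℝ × ℝ)} [IsProbabilityMeasure ρ]
    {ν : Measure ℝ} [IsProbabilityMeasure ν] {Q : Kernel ℝ ℝ} {k : ℝ → ℝ≥0∞}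
    (hPQ : ∀ v, transition ρ v = Q v + k v • ν)
    {f : ℝ → ℝ≥0∞} (n : ℕ) (v : ℝ) :
    partialPotential Q 1 f n v ≤ partialPotential (transition ρ) 1 f n v := by
  induction n generalizing v with
  | zero => exact le_rfl
  | succ n ih =>
    simp only [partialPotential, one_mul]
    gcongr
    exact (act_mono ih v).trans (act_le_act_of_eq_add hPQ _ v)

theorem setLIntegral_eq_of_subset {α : Type*} [MeasurableSpace α] {μ : Measure α} {A B : Set α}
    (hA : MeasurableSet A) (hB : MeasurableSet B) (hBA : B ⊆ A) {f : α → ℝ≥0∞}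
    (hf : ∀ x ∈ A \ B, f x = 0) : ∫⁻ x in A, f x ∂μ = ∫⁻ x in B, f x ∂μ := by
  rw [← lintegral_inter_add_sdiff f A hB, Set.inter_eq_right.2 hBA,
    setLIntegral_congr_fun (hA.diff hB) hf, lintegral_zero, add_zero]

namespace IsDualChain

variable {ρ : Measure (ℝ × ℝ × ℝ)} [IsProbabilityMeasure ρ] {ξ δ : ℝ} {C : Set ℝ}
  {ν : Measure ℝ} [IsProbabilityMeasure ν] {u : ℝ} {Ω : Type*} [MeasurableSpace Ω]
  {P : Measure Ω} [IsProbabilityMeasure P] {V : ℕ → Ω → ℝ} {η : ℕ → Ω → Bool}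
  {Y : ℕ → Ω → ℝ × ℝ × ℝ} (h : IsDualChain ρ ξ δ C ν u P V η Y)

include h

theorem measurable_indicator_exceedEvent (hC : MeasurableSet C) (n : ℕ) :
    Measurable ((exceedEvent C V η u n).indicator (1 : Ω → ℝ≥0∞)) :=
  measurable_one.indicator (h.history_le n _ (measurableSet_exceedEvent hC n))

variable {Q : Kernel ℝ ℝ}

/-- After the level `u` has been exceeded, the exceedances are counted by the potential of the
killed chain. -/
theorem setLIntegral_sum_exceedEvent_le (hC : MeasurableSet C)
    (hPQ : ∀ v, transition ρ v = Q v + C.indicator (fun _ => ENNReal.ofReal δ) v • ν)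
    (N : ℕ) {n : ℕ} {G : Set Ω} (hG : MeasurableSet[history V η n] G)
    (hT : ∀ ω ∈ G, exceedTime V u ω ≤ (n : WithTop ℕ)) :
    ∫⁻ ω in G, ∑ j ∈ Finset.range N, (exceedEvent C V η u (n + j)).indicator 1 ω ∂P
      ≤ ∫⁻ ω in G, partialPotential Q 1 ((Set.Ioi u).indicator 1) N (V n ω) ∂P := by
  have hmeas : Measurable ((Set.Ioi u).indicator (1 : ℝ → ℝ≥0∞)) :=
    measurable_one.indicator measurableSet_Ioi
  induction N generalizing n G with
  | zero => simp
  | succ N ih =>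
    have hfm := measurable_partialPotential (κ := Q) (c := 1) hmeas N
    have hGm := h.history_le n G hG
    have hsum : Measurable fun ω => ∑ j ∈ Finset.range N,
        (exceedEvent C V η u (n + 1 + j)).indicator (1 : Ω → ℝ≥0∞) ω :=
      Finset.measurable_sum _ fun j _ => h.measurable_indicator_exceedEvent hC _
    set H := G ∩ {ω | V n ω ∈ C ∧ η n ω = true}ᶜ with hH
    have hHm : MeasurableSet[history V η (n + 1)] H :=
      (history_mono n.le_succ _ hG).inter (measurableSet_regeneration hC n.lt_succ_self).compl
    have hHT : ∀ ω ∈ H, exceedTime V u ω ≤ ((n + 1 : ℕ) : WithTop ℕ) := fun ω hω =>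
      (hT ω hω.1).trans (WithTop.coe_le_coe.2 n.le_succ)
    -- A regeneration at time `n` excludes every later exceedance of the cycle, so only the
    -- surviving paths contribute.
    have hGH : ∫⁻ ω in G, ∑ j ∈ Finset.range N, (exceedEvent C V η u (n + 1 + j)).indicator 1 ω ∂P
        = ∫⁻ ω in H, ∑ j ∈ Finset.range N,
          (exceedEvent C V η u (n + 1 + j)).indicator 1 ω ∂P := by
      refine setLIntegral_eq_of_subset hGm (h.history_le _ _ hHm) Set.inter_subset_left ?_
      rintro ω ⟨hωG, hωH⟩
      refine Finset.sum_eq_zero fun j _ => Set.indicator_of_notMem (fun hj => hωH ⟨hωG, ?_⟩) _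
      exact lt_regenTime_iff.1 hj.1 n (by omega)
    calc ∫⁻ ω in G, ∑ j ∈ Finset.range (N + 1), (exceedEvent C V η u (n + j)).indicator 1 ω ∂P
        ≤ ∫⁻ ω in G, ((Set.Ioi u).indicator 1 (V n ω) + ∑ j ∈ Finset.range N,
            (exceedEvent C V η u (n + 1 + j)).indicator 1 ω) ∂P := by
          refine lintegral_mono fun ω => ?_
          rw [Finset.sum_range_succ', add_comm]
          refine add_le_add ?_ (le_of_eq (Finset.sum_congr rfl fun j _ => by
            rw [add_right_comm, add_assoc]))
          by_cases hω : u < V n ω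
          · simpa [hω] using Set.indicator_le_self' (f := (1 : Ω → ℝ≥0∞)) (fun _ _ => zero_le) ω
          · simp [exceedEvent, hω]
      _ = ∫⁻ ω in G, (Set.Ioi u).indicator 1 (V n ω) ∂P
          + ∫⁻ ω in H, ∑ j ∈ Finset.range N,
            (exceedEvent C V η u (n + 1 + j)).indicator 1 ω ∂P := by
          rw [lintegral_add_right _ hsum, hGH]
      _ ≤ ∫⁻ ω in G, (Set.Ioi u).indicator 1 (V n ω) ∂P
          + ∫⁻ ω in H, partialPotential Q 1 ((Set.Ioi u).indicator 1) N (V (n + 1) ω) ∂P := by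
          exact add_le_add le_rfl (ih hHm hHT)
      _ = ∫⁻ ω in G, (Set.Ioi u).indicator 1 (V n ω) ∂P
          + ∫⁻ ω in G, act Q (partialPotential Q 1 ((Set.Ioi u).indicator 1) N) (V n ω) ∂P := by
          rw [h.setLIntegral_alive hC hPQ hG hT hfm (ENNReal.natCast_ne_top N)]
          exact fun v => (partialPotential_le_of_eq_add hPQ N v).trans
            (partialPotential_le_natCast (Set.indicator_le_self' fun _ _ => zero_le) N v)
      _ = _ := by
          rw [← lintegral_add_left (show Measurable fun ω => (Set.Ioi u).indicator 1 (V n ω) from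
            hmeas.comp (h.measurable_V n))]
          simp [partialPotential]

/-- The expected number of exceedances, from the first one, given the past and the present value
of the splitting variable. -/
theorem setLIntegral_exceedances_eta_le (hC : MeasurableSet C)
    (hPQ : ∀ v, transition ρ v = Q v + C.indicator (fun _ => ENNReal.ofReal δ) v • ν)
    {a : ℝ≥0∞} (ha : ENNReal.ofReal δ < 1 → 1 ≤ (a + 1) * (1 - ENNReal.ofReal δ))
    {n : ℕ} {G : Set Ω} (hG : MeasurableSet[history V η n] G)
    (hT : ∀ ω ∈ G, exceedTime V u ω = (n : WithTop ℕ)) (b : Bool) :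
    ∫⁻ ω in G ∩ {ω | η n ω = b}, exceedances C V η u ω ∂P
      ≤ ∫⁻ ω in G ∩ {ω | η n ω = b}, (C.indicator (fun _ => a) (V n ω) *
        potential Q 1 ((Set.Ioi u).indicator 1) (V n ω)
          + potential Q 1 ((Set.Ioi u).indicator 1) (V n ω)) ∂P := by
  have hmeas : Measurable ((Set.Ioi u).indicator (1 : ℝ → ℝ≥0∞)) :=
    measurable_one.indicator measurableSet_Ioi
  have hVn := h.measurable_V n
  have hAm := (h.history_le n _ hG).inter (h.measurableSet_eta n b)
  set A := G ∩ {ω | η n ω = b} with hA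
  set H := A ∩ {ω | V n ω ∈ C ∧ η n ω = true}ᶜ with hH
  have hHm : MeasurableSet[history V η (n + 1)] H :=
    ((history_mono n.le_succ _ hG).inter
      (measurable_history_right n.lt_succ_self (measurableSet_singleton b))).inter
      (measurableSet_regeneration hC n.lt_succ_self).compl
  have hHT : ∀ ω ∈ H, exceedTime V u ω ≤ ((n + 1 : ℕ) : WithTop ℕ) := fun ω hω =>
    (hT ω hω.1.1).le.trans (WithTop.coe_le_coe.2 n.le_succ)
  set g : ℝ → ℝ≥0∞ := fun v => (C.indicator (fun _ => a) v + 1)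
    * act Q (potential Q 1 ((Set.Ioi u).indicator 1)) v with hg
  have htail : ∫⁻ ω in A, ∑' j, (exceedEvent C V η u (n + 1 + j)).indicator 1 ω ∂P
      ≤ ∫⁻ ω in A, g (V n ω) ∂P := by
    rw [lintegral_tsum fun j => (h.measurable_indicator_exceedEvent hC _).aemeasurable,
      ENNReal.tsum_eq_iSup_nat]
    refine iSup_le fun N => ?_
    have hfm := measurable_partialPotential (κ := Q) (c := 1) hmeas N
    rw [← lintegral_finsetSum _ fun j _ => h.measurable_indicator_exceedEvent hC _]
    have hAH : ∫⁻ ω in A, ∑ j ∈ Finset.range N, (exceedEvent C V η u (n + 1 + j)).indicator 1 ω ∂P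
        = ∫⁻ ω in H, ∑ j ∈ Finset.range N,
          (exceedEvent C V η u (n + 1 + j)).indicator 1 ω ∂P := by
      refine setLIntegral_eq_of_subset hAm (h.history_le _ _ hHm) Set.inter_subset_left ?_
      rintro ω ⟨hωA, hωH⟩
      refine Finset.sum_eq_zero fun j _ => Set.indicator_of_notMem (fun hj => hωH ⟨hωA, ?_⟩) _
      exact lt_regenTime_iff.1 hj.1 n (by omega)
    rw [hAH]
    refine (h.setLIntegral_sum_exceedEvent_le hC hPQ N hHm hHT).trans ?_
    refine (h.setLIntegral_alive_eta_le hC hPQ ha hG (fun ω hω => (hT ω hω).le) hfm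
      (ENNReal.natCast_ne_top N) (fun v => (partialPotential_le_of_eq_add hPQ N v).trans
        (partialPotential_le_natCast (Set.indicator_le_self' fun _ _ => zero_le) N v)) b).trans ?_
    refine lintegral_mono fun ω => ?_
    simp only [hg]
    gcongr
    exact act_mono (fun v => partialPotential_le_potential N v) _
  -- The summand `1` is the exceedance at time `n = T_u` itself; only later ones depend on `η_n` and
  -- carry the weight.
  calc ∫⁻ ω in A, exceedances C V η u ω ∂P
      ≤ ∫⁻ ω in A, (1 + ∑' j, (exceedEvent C V η u (n + 1 + j)).indicator 1 ω) ∂P :=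
        setLIntegral_mono' hAm fun ω hω => exceedances_le_of_exceedTime_eq (hT ω hω.1)
    _ = ∫⁻ ω in A, 1 ∂P
        + ∫⁻ ω in A, ∑' j, (exceedEvent C V η u (n + 1 + j)).indicator 1 ω ∂P :=
        lintegral_add_left measurable_const _
    _ ≤ ∫⁻ ω in A, 1 ∂P + ∫⁻ ω in A, g (V n ω) ∂P := by gcongr
    _ = ∫⁻ ω in A, (1 + g (V n ω)) ∂P := (lintegral_add_left measurable_const _).symm
    _ ≤ _ := by
        refine setLIntegral_mono' hAm fun ω hω => ?_
        have hu : V n ω ∈ Set.Ioi u := (exceedTime_eq_iff.1 (hT ω hω.1)).1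
        set x := C.indicator (fun _ => a) (V n ω) with hx
        rw [potential_eq hmeas (V n ω), Set.indicator_of_mem hu, Pi.one_apply, one_mul]
        simp only [hg, ← hx]
        rw [mul_add, mul_one, add_mul, one_mul]
        calc _ ≤ x + (1 + (x * act Q (potential Q 1 ((Set.Ioi u).indicator 1)) (V n ω)
              + act Q (potential Q 1 ((Set.Ioi u).indicator 1)) (V n ω))) := le_add_self
          _ = _ := by ring

/-- The filtration at time `n` contains `η_n`, while the laws of the chain are prescribed given the
history without it; hence the split by the value of `η_n`. -/
theorem setLIntegral_exceedances_le (hC : MeasurableSet C)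
    (hPQ : ∀ v, transition ρ v = Q v + C.indicator (fun _ => ENNReal.ofReal δ) v • ν)
    {a : ℝ≥0∞} (ha : ENNReal.ofReal δ < 1 → 1 ≤ (a + 1) * (1 - ENNReal.ofReal δ))
    {n : ℕ} {G : Set Ω}
    (hG : MeasurableSet[filtration V η h.measurable_V h.measurable_η n] G)
    (hT : ∀ ω ∈ G, exceedTime V u ω = (n : WithTop ℕ)) :
    ∫⁻ ω in G, exceedances C V η u ω ∂P
      ≤ ∫⁻ ω in G, (C.indicator (fun _ => a) (V n ω) *
        potential Q 1 ((Set.Ioi u).indicator 1) (V n ω)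
          + potential Q 1 ((Set.Ioi u).indicator 1) (V n ω)) ∂P := by
  have key : ∀ b : Bool, ∫⁻ ω in G ∩ {ω | η n ω = b}, exceedances C V η u ω ∂P
      ≤ ∫⁻ ω in G ∩ {ω | η n ω = b}, (C.indicator (fun _ => a) (V n ω) *
        potential Q 1 ((Set.Ioi u).indicator 1) (V n ω)
          + potential Q 1 ((Set.Ioi u).indicator 1) (V n ω)) ∂P := by
    intro b
    obtain ⟨H, hH, hGH⟩ := exists_history_of_filtration h.measurable_V h.measurable_η hG b
    have e : G ∩ {ω | η n ω = b}
        = (H ∩ {ω | exceedTime V u ω = (n : WithTop ℕ)}) ∩ {ω | η n ω = b} := by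
      ext ω
      constructor
      · rintro ⟨h1, h2⟩
        exact ⟨⟨(hGH ω h2).1 h1, hT ω h1⟩, h2⟩
      · rintro ⟨⟨h1, -⟩, h2⟩
        exact ⟨(hGH ω h2).2 h1, h2⟩
    rw [e]
    exact h.setLIntegral_exceedances_eta_le hC hPQ ha (hH.inter (measurableSet_exceedTime_eq n))
      (fun ω hω => hω.2) b
  have e4 : G \ {ω | η n ω = true} = G ∩ {ω | η n ω = false} := by ext ω; simp
  rw [← lintegral_inter_add_sdiff _ G (h.measurableSet_eta n true),
    ← lintegral_inter_add_sdiff (fun ω => _ * _ + _) G (h.measurableSet_eta n true), e4]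
  exact add_le_add (key true) (key false)

/-- A bound on the potential of the killed chain is a bound on the conditional expectation of the
number of exceedances. -/
theorem condLExp_exceedances_le (hC : MeasurableSet C)
    (hPQ : ∀ v, transition ρ v = Q v + C.indicator (fun _ => ENNReal.ofReal δ) v • ν)
    {a : ℝ≥0∞} (ha : ENNReal.ofReal δ < 1 → 1 ≤ (a + 1) * (1 - ENNReal.ofReal δ))
    {S : Set ℝ} (hSm : MeasurableSet S) (hS : ∀ x ∈ S, transition ρ x Sᶜ = 0) (hν : ν Sᶜ = 0)
    {g : ℝ → ℝ≥0∞} (hg : Measurable g)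
    (hgS : ∀ v ∈ S, u < v → C.indicator (fun _ => a) v *
      potential Q 1 ((Set.Ioi u).indicator 1) v + potential Q 1 ((Set.Ioi u).indicator 1) v
        ≤ g v) :
    condLExp (isStoppingTime_min h.measurable_V h.measurable_η hC u).measurableSpace P
        (exceedances C V η u)
      ≤ᵐ[P] Set.indicator {ω | exceedTime V u ω < regenTime C V η ω}
        (fun ω => g (stoppedValue V (exceedTime V u) ω)) := by
  set hσ := isStoppingTime_min h.measurable_V h.measurable_η hC u with hσ_def
  have hle := hσ.measurableSpace_le
  -- On `D n` the stopping time equals `n`, so the stopped σ-algebra has there the same events as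
  -- the filtration at time `n`. Off the union of the `D n` there are no exceedances.
  set D : ℕ → Set Ω := fun n =>
    {ω | exceedTime V u ω = (n : WithTop ℕ) ∧ (n : WithTop ℕ) < regenTime C V η ω} with hD
  have hDσ : ∀ n, D n ⊆ {ω | min (exceedTime V u ω) (regenTimePred C V η ω) = (n : WithTop ℕ)} := by
    rintro n ω ⟨h1, h2⟩
    rw [Set.mem_ofPred_eq, h1]
    exact min_eq_left (lt_regenTime_iff_le.1 h2)
  have hDm : ∀ n, MeasurableSet[history V η n] (D n) := fun n =>
    (measurableSet_exceedTime_eq n).inter (measurableSet_lt_regenTime hC n)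
  have hDF : ∀ n, MeasurableSet[filtration V η h.measurable_V h.measurable_η n] (D n) := fun n =>
    history_le_filtration h.measurable_V h.measurable_η n _ (hDm n)
  have hmem : ∀ (n : ℕ) (s : Set Ω), s ⊆ D n → (MeasurableSet[hσ.measurableSpace] s ↔
      MeasurableSet[filtration V η h.measurable_V h.measurable_η n] s) := by
    intro n s hs
    have e := Set.inter_eq_left.2 (hs.trans (hDσ n))
    rw [← e]
    exact hσ.measurableSet_inter_eq_iff s n
  have hdisj : Pairwise (Function.onFun Disjoint D) := by
    intro i j hij
    refine Set.disjoint_left.2 fun ω h1 h2 => hij ?_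
    exact WithTop.coe_injective (h1.1.symm.trans h2.1)
  have hUnion : {ω | exceedTime V u ω < regenTime C V η ω} = ⋃ n, D n := by
    ext ω
    simp only [hD, Set.mem_ofPred_eq, Set.mem_iUnion]
    constructor
    · intro hω
      obtain ⟨n, hn⟩ := WithTop.ne_top_iff_exists.1 (ne_top_of_lt hω)
      exact ⟨n, hn.symm, hn.trans_lt hω⟩
    · rintro ⟨n, h1, h2⟩
      exact h1.trans_lt h2
  set F : Ω → ℝ≥0∞ := Set.indicator {ω | exceedTime V u ω < regenTime C V η ω}
    (fun ω => g (stoppedValue V (exceedTime V u) ω)) with hF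
  have hFD : ∀ n, ∀ ω ∈ D n, F ω = g (V n ω) := by
    intro n ω hω
    rw [hF, Set.indicator_of_mem (by rw [hUnion]; exact Set.mem_iUnion.2 ⟨n, hω⟩), stoppedValue,
      hω.1]
    rfl
  have hFm : Measurable[hσ.measurableSpace] F := by
    intro E hE
    have hDn : ∀ n, MeasurableSet[hσ.measurableSpace] (D n ∩ F ⁻¹' E) := by
      intro n
      rw [hmem n _ Set.inter_subset_left]
      have e : D n ∩ F ⁻¹' E = D n ∩ V n ⁻¹' (g ⁻¹' E) := by
        ext ω
        simp only [Set.mem_inter_iff, Set.mem_preimage]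
        exact and_congr_right fun hω => by rw [hFD n ω hω]
      rw [e]
      exact (hDF n).inter (history_le_filtration h.measurable_V h.measurable_η n _
        (measurable_history_left le_rfl (hg hE)))
    have hU : MeasurableSet[hσ.measurableSpace] (⋃ n, D n) :=
      MeasurableSet.iUnion fun n => (hmem n _ subset_rfl).2 (hDF n)
    have e : F ⁻¹' E = (⋃ n, D n ∩ F ⁻¹' E) ∪ ((⋃ n, D n)ᶜ ∩ {_ω | (0 : ℝ≥0∞) ∈ E}) := by
      rw [← Set.iUnion_inter, ← hUnion]
      ext ω
      by_cases hω : exceedTime V u ω < regenTime C V η ω <;> simp [hF, hω]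
    rw [e]
    exact (MeasurableSet.iUnion hDn).union (hU.compl.inter (MeasurableSet.const _))
  have hint : ∀ s, MeasurableSet[hσ.measurableSpace] s →
      ∫⁻ ω in s, exceedances C V η u ω ∂P ≤ ∫⁻ ω in s, F ω ∂P := by
    intro s hs
    have hsD : ∀ n, MeasurableSet (s ∩ D n) := fun n =>
      (hle s hs).inter (h.history_le n _ (hDm n))
    have hsdisj : Pairwise (Function.onFun Disjoint fun n => s ∩ D n) := fun i j hij =>
      (hdisj hij).mono Set.inter_subset_right Set.inter_subset_right
    have hN : ∫⁻ ω in s, exceedances C V η u ω ∂P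
        = ∫⁻ ω in ⋃ n, s ∩ D n, exceedances C V η u ω ∂P := by
      rw [← Set.inter_iUnion]
      refine setLIntegral_eq_of_subset (hle s hs)
        ((hle s hs).inter (MeasurableSet.iUnion fun n => h.history_le n _ (hDm n)))
        Set.inter_subset_left ?_
      rintro ω ⟨h1, h2⟩
      refine exceedances_eq_zero fun hlt => h2 ⟨h1, ?_⟩
      rw [← hUnion]
      exact hlt
    calc ∫⁻ ω in s, exceedances C V η u ω ∂P
        = ∑' n, ∫⁻ ω in s ∩ D n, exceedances C V η u ω ∂P := by
          rw [hN, lintegral_iUnion hsD hsdisj]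
      _ ≤ ∑' n, ∫⁻ ω in s ∩ D n, F ω ∂P := by
          refine ENNReal.tsum_le_tsum fun n => ?_
          have hsF := (hmem n (s ∩ D n) Set.inter_subset_right).1
            (hs.inter ((hmem n _ subset_rfl).2 (hDF n)))
          refine (h.setLIntegral_exceedances_le hC hPQ ha hsF fun ω hω => hω.2.1).trans ?_
          refine lintegral_mono_ae ?_
          filter_upwards [ae_restrict_mem (hsD n), ae_restrict_of_ae (h.ae_mem hSm hS hν n)]
            with ω hω hωS
          rw [hFD n ω hω.2]
          exact hgS _ hωS (exceedTime_eq_iff.1 hω.2.1).1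
      _ = ∫⁻ ω in ⋃ n, s ∩ D n, F ω ∂P := (lintegral_iUnion hsD hsdisj _).symm
      _ ≤ ∫⁻ ω in s, F ω ∂P :=
          lintegral_mono_set (Set.iUnion_subset fun n => Set.inter_subset_left)
  refine ae_le_of_ae_le_trim (hm := hle) ?_
  refine ae_le_of_forall_setLIntegral_le_of_sigmaFinite (μ := P.trim hle)
    (measurable_condLExp _ _ _) fun s hs _ => ?_
  rw [setLIntegral_condLExp_trim hle _ _ hs, setLIntegral_trim hle hFm hs]
  exact hint s hs

end IsDualChain

end

end Letac

theorem theorem4p2 (ρ : Measure (ℝ × ℝ × ℝ)) [IsProbabilityMeasure ρ] (ξ : ℝ)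
    (hρ : Letac.Hypotheses ρ ξ) (δ : ℝ) (C : Set ℝ) (ν : Measure ℝ) [IsProbabilityMeasure ν]
    (hM : Letac.Minorization ρ δ C ν) :
    ∃ C₁ C₂ : ℝ → ℝ,
      (∀ u : ℝ, 0 < u → 0 < C₁ u ∧ 0 < C₂ u) ∧
      (∀ u : ℝ, 0 < u →
        ∀ (Ω : Type*) [MeasurableSpace Ω] (P : Measure Ω) [IsProbabilityMeasure P]
          (V : ℕ → Ω → ℝ) (η : ℕ → Ω → Bool) (Y : ℕ → Ω → ℝ × ℝ × ℝ)
          (h : Letac.IsDualChain ρ ξ δ C ν u P V η Y),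
          condLExp (Letac.isStoppingTime_min h.measurable_V h.measurable_η
              hM.measurableSet u).measurableSpace P (Letac.exceedances C V η u)
            ≤ᵐ[P] Set.indicator {ω | Letac.exceedTime V u ω < Letac.regenTime C V η ω}
              (fun ω => ENNReal.ofReal
                (C₁ u * Real.log (stoppedValue V (Letac.exceedTime V u) ω / u) + C₂ u))) ∧
      (Integrable (fun y : ℝ × ℝ × ℝ => Real.log y.1) ρ →
        Tendsto C₁ atTop (𝓝 (1 / Letac.drift ρ))) ∧
      (MemLp (fun y : ℝ × ℝ × ℝ => Real.log y.1) 2 ρ →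
        Tendsto C₂ atTop (𝓝 (1 + Letac.logVariance ρ / Letac.drift ρ ^ 2))) := by
  obtain ⟨Q, hPQ⟩ := hM.exists_killed
  obtain ⟨φ, hirr, hφ⟩ := hM.charged
  obtain ⟨S, hSc, hS, hν, hK⟩ := Letac.exists_absorbing_potential_compact_le
    (Letac.isFeller_transition ρ) hirr hM.measurableSet hφ
    (ENNReal.ofReal_pos.2 hM.delta_pos).ne' ENNReal.ofReal_ne_top hPQ
  -- The weight is `a = 1 / (1 - δ)`, the normalization of `Q` given `η = 0` in `C`; for `δ ≥ 1`
  -- there is nothing to normalize and `a = 1` serves.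
  obtain ⟨a, ha, haδ⟩ : ∃ a : ℝ, 1 ≤ a ∧ (ENNReal.ofReal δ < 1 →
      1 ≤ (ENNReal.ofReal (a - 1) + 1) * (1 - ENNReal.ofReal δ)) := by
    by_cases hδ : δ < 1
    · have h1 : 1 ≤ (1 - δ)⁻¹ := (one_le_inv₀ (by linarith)).2 (by linarith [hM.delta_pos])
      refine ⟨(1 - δ)⁻¹, h1, fun _ => le_of_eq ?_⟩
      rw [← ENNReal.ofReal_one, ← ENNReal.ofReal_add (by linarith) zero_le_one, sub_add_cancel,
        ← ENNReal.ofReal_sub _ hM.delta_pos.le, ← ENNReal.ofReal_mul (by positivity),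
        inv_mul_cancel₀ (by linarith)]
    · exact ⟨1, le_rfl, fun h => absurd (ENNReal.ofReal_lt_one.1 h) hδ⟩
  obtain ⟨C₁, C₂, hpos, hle, h1, h2⟩ :=
    hρ.exists_level_constants hPQ hS hK hM.bounded ha
  refine ⟨C₁, C₂, hpos, ?_, h1, h2⟩
  intro u hu Ω _ P _ V η Y h
  exact h.condLExp_exceedances_le hM.measurableSet hPQ haδ hSc.measurableSet hS hν
    (g := fun v => ENNReal.ofReal (C₁ u * Real.log (v / u) + C₂ u)) (by fun_prop)
    (hle u hu)
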